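/- **Conventions.** Let $d\ge 1$. Cubes in $\mathbb{R}^d$ are axis-parallel with positive side length, and a weight on a cube $Q$ is a measurable function $Q\to(0,\infty)$. For $p\in[1,\infty)$ let $\frac1{p'}=1-\frac1p$ (with $p'=\infty$ if $p=1$), and for a weight $\sigma$ put $$\|f\|_{L^p_\sigma(Q)}:=\Big(\int_Q|f|^p\sigma^p\,dx\Big)^{1/p},\qquad \langle f\rangle_Q:=\frac1{|Q|}\int_Q f\,dx,\qquad \langle f\rangle_{r,Q}:=\langle|f|^r\rangle_Q^{1/r}\ (r<\infty),\qquad \langle f\rangle_{\infty,Q}:=\|f\|_{L^\infty(Q)}.$$ The space $W^{1,p}_\sigma(Q)$ consists of all measurable $f\colon Q\to\mathbb{C}$ with $\|f\|_{L^p_\sigma(Q)}<\infty$ whose distributional derivatives $\partial_jf$ on the interior of $Q$ satisfy $\|\partial_j f\|_{L^p_\sigma(Q)}<\infty$ for $1\le j\le d$. For weights $\omega,\sigma$ and $\alpha\ge0$ we write $(\omega,\sigma)\in A^\alpha_{p,q}(Q)$ if $$[\omega,\sigma]_{A^\alpha_{p,q}(Q)}:=\sup_{R\subseteq Q}|R|^\alpha\,\langle\omega\rangle_{q,R}\,\langle\sigma^{-1}\rangle_{p',R}<\infty,$$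 and for a weight $w$ integrable on $Q$ we write $w\in A_\infty(Q)$ if $$[w]_{A_\infty(Q)}:=\sup_{R\subseteq Q}\frac1{w(R)}\int_R\sup_{S\subseteq R}\langle w\rangle_{1,S}\mathbf 1_S(x)\,dx<\infty,\qquad w(R):=\int_R w\,dx,$$ where all suprema are over cubes. **Theorem 4.1.** Let $Q\subseteq\mathbb{R}^d$ be a cube, let $1\le p\le q<\infty$, $0\le\alpha<\frac1q+\frac1{p'}$, $(\omega,\sigma)\in A^\alpha_{p,q}(Q)$, and assume $$\varepsilon:=\tfrac1d-\big(\tfrac1p-\tfrac1q\big)-\alpha\ge0 .$$ Then the following hold for all $f\in W^{1,p}_\sigma(Q)$. (i) (Subcritical case) If $\varepsilon>0$, then $$\|f-\langle f\rangle_Q\|_{L^q_\omega(Q)}\le C\,[\omega,\sigma]_{A^\alpha_{p,q}(Q)}\cdot\frac{|Q|^\varepsilon}{\varepsilon}\,\big\||\nabla f|\big\|_{L^p_\sigma(Q)},$$ where the constant $C$ depends only on $d$. (ii) (Critical case) If $\varepsilon=0$ and in addition $\omega^q\in A_\infty(Q)$, then $$\|f-\langle f\rangle_Q\|_{L^q_\omega(Q)}\le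 C\,\big\||\nabla f|\big\|_{L^p_\sigma(Q)}\cdot[\omega,\sigma]_{A^\alpha_{p,q}(Q)}\cdot\begin{cases}[\omega^q]_{A_\infty(Q)}^{1/p'}&\text{if }1<p<q,\\ [\omega^q]_{A_\infty(Q)}&\text{otherwise,}\end{cases}$$ where the constant $C$ depends only on $p$, $q$ and $d$. -/

import Mathlib

open MeasureTheory
open scoped ENNReal NNReal

noncomputable section

namespace PoincareSobolev

/-- A (closed, axis-parallel, non-degenerate) cube in `ℝ^d`, given by its lower corner and its
side length. -/
structure Cube (d : ℕ) where
  corner : Fin d → ℝ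
  side : ℝ
  side_pos : 0 < side

/-- The point set `∏ i, [corner i, corner i + side]` of a cube. On `ℝ^d = (Fin d → ℝ)` only the
topology, the smooth structure and the Lebesgue measure are used below, never its norm. -/
def Cube.toSet {d : ℕ} (Q : Cube d) : Set (Fin d → ℝ) :=
  {x | ∀ i, x i ∈ Set.Icc (Q.corner i) (Q.corner i + Q.side)}

/-- The Lebesgue measure `|Q|` of a cube. -/
def Cube.vol {d : ℕ} (Q : Cube d) : ℝ≥0∞ := volume Q.toSet

/-- A weight on `Q`: a measurable function `Q → (0,∞)`. (Values outside `Q` play no role.) -/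
def IsWeight {d : ℕ} (Q : Cube d) (w : (Fin d → ℝ) → ℝ) : Prop :=
  AEMeasurable w (volume.restrict Q.toSet) ∧ ∀ x ∈ Q.toSet, 0 < w x

/-- The weighted norm `(∫_Q |f|^p σ^p)^(1/p)`, where the weight enters as a multiplier. -/
def wLpNorm {d : ℕ} {F : Type*} [NormedAddCommGroup F] (Q : Cube d) (p : ℝ)
    (σ : (Fin d → ℝ) → ℝ) (f : (Fin d → ℝ) → F) : ℝ≥0∞ :=
  (∫⁻ x in Q.toSet, (‖f x‖ₑ ^ p * ENNReal.ofReal (σ x) ^ p)) ^ (1 / p)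

/-- Membership in the weighted Lebesgue space `L^p_σ(Q)`. -/
def MemWLp {d : ℕ} {F : Type*} [NormedAddCommGroup F] (Q : Cube d) (p : ℝ)
    (σ : (Fin d → ℝ) → ℝ) (f : (Fin d → ℝ) → F) : Prop :=
  AEStronglyMeasurable f (volume.restrict Q.toSet) ∧ wLpNorm Q p σ f < ⊤

/-- `g = (g_1, …, g_d)` is the distributional gradient of `f` on (the interior of) `Q`. -/
structure HasWeakGradient {d : ℕ} (Q : Cube d) (f : (Fin d → ℝ) → ℂ)
    (g : (Fin d → ℝ) → EuclideanSpace ℂ (Fin d)) : Prop where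
  locallyIntegrableOn : LocallyIntegrableOn f (interior Q.toSet) volume
  locallyIntegrableOn_grad : LocallyIntegrableOn g (interior Q.toSet) volume
  integral_eq : ∀ φ : (Fin d → ℝ) → ℝ, ContDiff ℝ (⊤ : ℕ∞) φ → HasCompactSupport φ →
    tsupport φ ⊆ interior Q.toSet → ∀ j : Fin d,
      ∫ x in Q.toSet, (fderiv ℝ φ x (Pi.single j 1)) • f x = - ∫ x in Q.toSet, φ x • g x j

/-- Membership in the weighted Sobolev space `W^{1,p}_σ(Q)`: `f ∈ L^p_σ(Q)` and its distributional
derivatives `∂_j f` lie in `L^p_σ(Q)`. -/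
def MemSobolev {d : ℕ} (Q : Cube d) (p : ℝ) (σ : (Fin d → ℝ) → ℝ) (f : (Fin d → ℝ) → ℂ) : Prop :=
  MemWLp Q p σ f ∧ ∃ g : (Fin d → ℝ) → EuclideanSpace ℂ (Fin d),
    HasWeakGradient Q f g ∧ ∀ j : Fin d, MemWLp Q p σ (fun x => g x j)

/-- The average `⟨h⟩_{r,R}`: the `L^r` norm for normalized Lebesgue measure on `R`, that is
`(|R|⁻¹ ∫_R |h|^r)^(1/r)` for `0 < r < ∞` and the essential supremum of `|h|` on `R` for
`r = ∞`. -/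
def avgLp {d : ℕ} (r : ℝ≥0∞) (R : Cube d) (h : (Fin d → ℝ) → ℝ) : ℝ≥0∞ :=
  eLpNorm h r (R.vol⁻¹ • volume.restrict R.toSet)

/-- The two-weight characteristic
`[ω,σ]_{A^α_{p,q}(Q)} = sup_{R ⊆ Q} |R|^α ⟨ω⟩_{q,R} ⟨σ⁻¹⟩_{p',R}`, the supremum being over cubes,
where `p'` is the conjugate exponent (`p' = ∞` if `p = 1`). -/
def apqChar {d : ℕ} (Q : Cube d) (p q α : ℝ) (ω σ : (Fin d → ℝ) → ℝ) : ℝ≥0∞ :=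
  ⨆ (R : Cube d) (_ : R.toSet ⊆ Q.toSet),
    R.vol ^ α * avgLp (ENNReal.ofReal q) R ω *
      avgLp (ENNReal.conjExponent (ENNReal.ofReal p)) R (fun x => (σ x)⁻¹)

/-- The class `A^α_{p,q}(Q)` of pairs of weights. -/
def MemApq {d : ℕ} (Q : Cube d) (p q α : ℝ) (ω σ : (Fin d → ℝ) → ℝ) : Prop :=
  IsWeight Q ω ∧ IsWeight Q σ ∧ apqChar Q p q α ω σ < ⊤

/-- The (Fujii–Wilson) characteristic
`[w]_{A_∞(Q)} = sup_{R ⊆ Q} w(R)⁻¹ ∫_R sup_{S ⊆ R} ⟨w⟩_{1,S} 1_S(x) dx` of a weight that is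
integrable on `Q`. -/
def ainftyChar {d : ℕ} (Q : Cube d) (w : (Fin d → ℝ) → ℝ) : ℝ≥0∞ :=
  ⨆ (R : Cube d) (_ : R.toSet ⊆ Q.toSet),
    (∫⁻ x in R.toSet, ENNReal.ofReal (w x))⁻¹ *
      ∫⁻ x in R.toSet, ⨆ (S : Cube d) (_ : S.toSet ⊆ R.toSet),
        S.toSet.indicator (fun _ => avgLp 1 S w) x

end PoincareSobolev

end

/-!
Both inequalities reduce to estimates for the dyadic fractional integral operator
`T H (x) = ∑ ℓ(R) ⟨H⟩_R`, the sum running over the dyadic subcubes `R ∋ x` of `Q`.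

*Reduction.* Mollification carries the `L¹` Poincaré inequality on cubes over to `Φ ∘ f`, with
`|DΦ(f)| |∇f|` on the right-hand side (`poincare_of_hasWeakGradient`). Telescoping averages along
the dyadic cubes that shrink to a Lebesgue point gives `|Φ(f) - ⟨Φ(f)⟩_Q| ≲ T(|DΦ(f)| |∇f|)` almost
everywhere (`ae_enorm_sub_average_le`). Hölder's inequality and the two-weight characteristic bound
one term: `ℓ(R) ⟨H⟩_R w(R)^(1/q) ≤ [ω,σ] |R|^ε ν(R)^(1/p)`, where `w = ω^q dx` and
`ν = (H σ)^p dx` (`side_mul_lavg_mul_le`).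

*Subcritical case.* The factors `|R|^ε` form a geometric series over the generations, and `p ≤ q`
lets the terms of one generation be summed (`subcritical_fullSum`); the sum of the series produces
the factor `1/ε`.

*Critical case.* The series no longer converges, and `T` is first bounded by its sum over principal
cubes, those on which the average of `H` has more than doubled (`fullSum_le_sparseSum`). The
`A_∞` condition says that principal cubes are Carleson packed with respect to `w`
(`lintegral_sparseSum_one_le`, `lintegral_pathMax_le`). For `1 < p < q` a dual testing condition,
again proved by a geometric series, now in `(ℓ(R)/|R|)^(1-θ) w(R)^(1-θ/q) μ(R)^(1-θ/p')` with
`μ = σ^(-p') dx` and `1/θ = 1/p' + 1/q`, gives the exponent `1/p'` of the `A_∞` characteristic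
(`exists_lintegral_sparseSum_rpow_le`); otherwise the maximal function and the packing give the
exponent `1`. In both cases a good-`λ` argument absorbs the main term and leaves a weak-type bound
for `T` (`exists_critical_fullSum`).

Truncation upgrades weak type to strong type: the weak-type bound is applied to smooth truncations
of `f - ⟨f⟩_Q` at heights `2^k A`, whose gradients live on disjoint sets, and the resulting bounds
for the level sets are summed (`lintegral_le_of_truncation`). The starting height `A` is twice the
mean oscillation of `f`, so that all truncations have mean at least `1/2`.

All sums along dyadic cubes are cut off at a finite depth, and the estimates are proved by
induction on this depth, passing from the children of a cube to the cube.
-/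

namespace PoincareSobolev

variable {d : ℕ}

/-! ### Dyadic subcubes -/

/-- The dyadic child of `R` selected by `e`: the half of each edge that lies above the midpoint
where `e i` is true, and below it where `e i` is false. -/
noncomputable def Cube.child (R : Cube d) (e : Fin d → Bool) : Cube d where
  corner i := R.corner i + if e i then R.side / 2 else 0
  side := R.side / 2
  side_pos := half_pos R.side_pos

/-- The index of the dyadic child of `R` selected by the point `x`: points on a dividing
hyperplane belong to the upper half. -/
noncomputable def Cube.selIdx (R : Cube d) (x : Fin d → ℝ) : Fin d → Bool :=
  fun i => decide (R.corner i + R.side / 2 ≤ x i)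

/-- The dyadic child of `R` selected by the point `x`. -/
noncomputable def Cube.sel (R : Cube d) (x : Fin d → ℝ) : Cube d := R.child (R.selIdx x)

@[simp] lemma Cube.child_side (R : Cube d) (e : Fin d → Bool) : (R.child e).side = R.side / 2 := rfl

@[simp] lemma Cube.sel_side (R : Cube d) (x : Fin d → ℝ) : (R.sel x).side = R.side / 2 := rfl

lemma Cube.toSet_eq_pi (R : Cube d) :
    R.toSet = Set.univ.pi fun i => Set.Icc (R.corner i) (R.corner i + R.side) := by
  ext x; simp only [Cube.toSet, Set.mem_pi, Set.mem_univ, true_implies]; rfl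

lemma Cube.toSet_eq_closedBall (R : Cube d) :
    R.toSet = Metric.closedBall (fun i => R.corner i + R.side / 2) (R.side / 2) := by
  have := R.side_pos
  rw [closedBall_pi _ (by positivity), R.toSet_eq_pi]
  congr 1; ext i : 1
  rw [Real.closedBall_eq_Icc]
  congr 1 <;> ring

lemma Cube.measurableSet (R : Cube d) : MeasurableSet R.toSet := by
  rw [R.toSet_eq_closedBall]; exact Metric.isClosed_closedBall.measurableSet

lemma Cube.isCompact (R : Cube d) : IsCompact R.toSet := by
  rw [R.toSet_eq_closedBall]; exact isCompact_closedBall _ _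

lemma Cube.convex (R : Cube d) : Convex ℝ R.toSet := by
  rw [R.toSet_eq_closedBall]; exact convex_closedBall _ _

lemma Cube.vol_eq (R : Cube d) : R.vol = ENNReal.ofReal R.side ^ d := by
  rw [Cube.vol, R.toSet_eq_pi, volume_pi_pi]
  simp [Real.volume_Icc]

lemma Cube.vol_ne_zero (R : Cube d) : R.vol ≠ 0 := by
  rw [R.vol_eq]; exact pow_ne_zero _ (by simpa using R.side_pos)

lemma Cube.vol_ne_top (R : Cube d) : R.vol ≠ ⊤ := by
  rw [R.vol_eq]; exact ENNReal.pow_ne_top ENNReal.ofReal_ne_top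

lemma Cube.ofReal_side_ne_zero (R : Cube d) : ENNReal.ofReal R.side ≠ 0 := by
  simpa using R.side_pos

lemma Cube.ofReal_side_half (R : Cube d) :
    ENNReal.ofReal (R.side / 2) = ENNReal.ofReal R.side / 2 := by
  rw [ENNReal.ofReal_div_of_pos (by norm_num)]; simp

lemma Cube.child_vol (R : Cube d) (e : Fin d → Bool) : 2 ^ d * (R.child e).vol = R.vol := by
  rw [Cube.vol_eq, Cube.vol_eq, Cube.child_side, ← mul_pow, R.ofReal_side_half,
    ENNReal.mul_div_cancel (by simp) (by simp)]

lemma Cube.child_subset (R : Cube d) (e : Fin d → Bool) : (R.child e).toSet ⊆ R.toSet := by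
  intro x hx i
  have h := hx i
  have := R.side_pos
  simp only [Cube.child, Set.mem_Icc] at h ⊢
  split_ifs at h <;> constructor <;> linarith [h.1, h.2]

lemma Cube.sel_subset (R : Cube d) (x : Fin d → ℝ) : (R.sel x).toSet ⊆ R.toSet :=
  R.child_subset _

lemma Cube.mem_sel (R : Cube d) {x : Fin d → ℝ} (hx : x ∈ R.toSet) : x ∈ (R.sel x).toSet := by
  intro i
  have h := hx i
  simp only [Cube.sel, Cube.child, Cube.selIdx, Set.mem_Icc, decide_eq_true_eq] at h ⊢
  split_ifs with hi <;> constructor <;> linarith [h.1, h.2]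

lemma Cube.toSet_eq_iUnion_child (R : Cube d) : R.toSet = ⋃ e, (R.child e).toSet := by
  apply subset_antisymm
  · intro x hx
    exact Set.mem_iUnion.2 ⟨_, R.mem_sel hx⟩
  · exact Set.iUnion_subset R.child_subset

lemma measurable_selIdx (R : Cube d) : Measurable R.selIdx := by
  refine measurable_pi_lambda _ fun i => ?_
  refine measurable_to_bool ?_
  have : (fun x : Fin d → ℝ => R.selIdx x i) ⁻¹' {true} =
      {x | R.corner i + R.side / 2 ≤ x i} := by
    ext x; simp [Cube.selIdx]
  rw [this]
  exact measurableSet_le measurable_const (measurable_pi_apply i)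

/-- Off the dividing hyperplanes, every point of a child selects that child. -/
lemma ae_child_sel (m : Measure (Fin d → ℝ)) (hm : m ≪ volume) (R : Cube d) (e : Fin d → Bool) :
    ∀ᵐ x ∂(m.restrict (R.child e).toSet), R.sel x = R.child e := by
  have h : ∀ᵐ x ∂(m.restrict (R.child e).toSet), ∀ i, x i ≠ R.corner i + R.side / 2 := by
    refine ae_restrict_of_ae (hm.ae_le ?_)
    refine ae_all_iff.2 fun i => ?_
    exact compl_mem_ae_iff.2 (Measure.pi_hyperplane (fun _ => volume) i _)
  filter_upwards [h, ae_restrict_mem (R.child e).measurableSet] with x hx hxe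
  rw [Cube.sel]
  congr 1
  ext i
  have h1 := hxe i
  have h2 := hx i
  have h3 := R.side_pos
  simp only [Cube.child, Set.mem_Icc] at h1
  simp only [Cube.selIdx]
  cases he : e i
  · simp only [he, Bool.false_eq_true, if_false] at h1
    rw [decide_eq_false_iff_not, not_le]
    refine lt_of_le_of_ne ?_ h2
    linarith [h1.2]
  · simp only [he, if_true] at h1
    rw [decide_eq_true_eq]
    exact h1.1

lemma restrict_eq_sum_child (m : Measure (Fin d → ℝ)) (hm : m ≪ volume) (R : Cube d) :
    m.restrict R.toSet = ∑ e, m.restrict (R.child e).toSet := by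
  conv_lhs => rw [R.toSet_eq_iUnion_child]
  rw [Measure.restrict_iUnion_ae, Measure.sum_fintype]
  · intro e e' hee
    obtain ⟨i, hi⟩ := Function.ne_iff.1 hee
    refine measure_mono_null (t := {x | x i = R.corner i + R.side / 2}) ?_
      (hm (Measure.pi_hyperplane (fun _ => volume) i _))
    rintro x ⟨h1, h2⟩
    have h1 := h1 i
    have h2 := h2 i
    have h3 := R.side_pos
    simp only [Cube.child, Set.mem_Icc] at h1 h2
    change x i = _
    cases h : e i <;> cases h' : e' i <;> simp only [h, h'] at hi h1 h2 <;>
      first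
      | exact absurd rfl hi
      | (simp only [Bool.false_eq_true, if_true, if_false] at h1 h2; linarith [h1.1, h1.2, h2.1, h2.2])
  · exact fun e => (R.child e).measurableSet.nullMeasurableSet

/-- Integration over a cube, child by child; the integrand may depend on the selected child. -/
lemma lintegral_eq_sum_child (m : Measure (Fin d → ℝ)) (hm : m ≪ volume) (R : Cube d)
    (F : Cube d → (Fin d → ℝ) → ℝ≥0∞) :
    ∫⁻ x in R.toSet, F (R.sel x) x ∂m =
      ∑ e, ∫⁻ x in (R.child e).toSet, F (R.child e) x ∂m := by
  rw [restrict_eq_sum_child m hm R, lintegral_finsetSum_measure]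
  refine Finset.sum_congr rfl fun e _ => lintegral_congr_ae ?_
  filter_upwards [ae_child_sel m hm R e] with x hx
  rw [hx]

lemma measure_eq_sum_child (m : Measure (Fin d → ℝ)) (hm : m ≪ volume) (R : Cube d)
    (P : Cube d → (Fin d → ℝ) → Prop) :
    m.restrict R.toSet {x | P (R.sel x) x} =
      ∑ e, m.restrict (R.child e).toSet {x | P (R.child e) x} := by
  rw [restrict_eq_sum_child m hm R, Measure.finsetSum_apply]
  refine Finset.sum_congr rfl fun e _ => measure_congr ?_
  filter_upwards [ae_child_sel m hm R e] with x hx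
  change P (R.sel x) x = P (R.child e) x
  rw [hx]

lemma measure_cube_eq_sum_child (m : Measure (Fin d → ℝ)) (hm : m ≪ volume) (R : Cube d) :
    m R.toSet = ∑ e, m (R.child e).toSet := by
  have := measure_eq_sum_child m hm R (fun _ _ => True)
  simpa using this

/-! ### Dyadic sums, principal cubes and the good-`λ` inequality -/

/-- The average of `H` over `R`, in the extended nonnegative reals. -/
noncomputable def lavg (H : (Fin d → ℝ) → ℝ≥0∞) (R : Cube d) : ℝ≥0∞ :=
  (∫⁻ x in R.toSet, H x) / R.vol

/-- The sum of `c` over the first `n` dyadic cubes containing `x`, starting from `R`. -/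
noncomputable def fullSum (c : Cube d → ℝ≥0∞) : ℕ → Cube d → (Fin d → ℝ) → ℝ≥0∞
  | 0, _, _ => 0
  | n + 1, R, x => c R + fullSum c n (R.sel x) x

/-- The maximum of `c` over the first `n` dyadic cubes containing `x`, starting from `R`. -/
noncomputable def pathMax (c : Cube d → ℝ≥0∞) : ℕ → Cube d → (Fin d → ℝ) → ℝ≥0∞
  | 0, _, _ => 0
  | n + 1, R, x => max (c R) (pathMax c n (R.sel x) x)

/-- The sum of `c` over the principal cubes among the first `n` dyadic cubes containing `x`,
starting from `R`. The parameter `A` is the average of `H` over the last principal cube above `R`,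
and a cube is principal if its average more than doubles `A`. -/
noncomputable def sparseSum (H : (Fin d → ℝ) → ℝ≥0∞) (c : Cube d → ℝ≥0∞) :
    ℕ → ℝ≥0∞ → Cube d → (Fin d → ℝ) → ℝ≥0∞
  | 0, _, _, _ => 0
  | n + 1, A, R, x =>
    if 2 * A < lavg H R then c R + sparseSum H c n (lavg H R) (R.sel x) x
    else sparseSum H c n A (R.sel x) x

lemma measurable_comp_sel (R : Cube d) (F : Cube d → (Fin d → ℝ) → ℝ≥0∞)
    (hF : ∀ S, Measurable (F S)) : Measurable fun x => F (R.sel x) x := by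
  have h : Measurable fun p : (Fin d → Bool) × (Fin d → ℝ) => F (R.child p.1) p.2 :=
    measurable_from_prod_countable_right fun e => hF (R.child e)
  exact h.comp ((measurable_selIdx R).prodMk measurable_id)

lemma measurable_fullSum (c : Cube d → ℝ≥0∞) (n : ℕ) (R : Cube d) :
    Measurable (fullSum c n R) := by
  induction n generalizing R with
  | zero => exact measurable_const
  | succ n ih => exact (measurable_comp_sel R (fullSum c n) ih).const_add _

lemma measurable_sparseSum (H : (Fin d → ℝ) → ℝ≥0∞) (c : Cube d → ℝ≥0∞) (n : ℕ) (A : ℝ≥0∞)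
    (R : Cube d) : Measurable (sparseSum H c n A R) := by
  induction n generalizing R A with
  | zero => exact measurable_const
  | succ n ih =>
    change Measurable fun x => if 2 * A < lavg H R then c R + sparseSum H c n (lavg H R) (R.sel x) x
      else sparseSum H c n A (R.sel x) x
    split_ifs
    · exact (measurable_comp_sel R (sparseSum H c n _) (ih _)).const_add _
    · exact measurable_comp_sel R (sparseSum H c n _) (ih _)

lemma fullSum_mono (c : Cube d → ℝ≥0∞) (R : Cube d) (x : Fin d → ℝ) :
    Monotone fun n => fullSum c n R x := by
  refine monotone_nat_of_le_succ fun n => ?_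
  induction n generalizing R with
  | zero => exact zero_le
  | succ n ih => exact add_le_add le_rfl (ih _)

/-- Principal cubes dominate: between two principal cubes the averages of `H` are comparable and
the side lengths form a geometric series. -/
lemma fullSum_le_sparseSum (H : (Fin d → ℝ) → ℝ≥0∞) (n : ℕ) (A : ℝ≥0∞) (R : Cube d)
    (x : Fin d → ℝ) :
    fullSum (fun S => ENNReal.ofReal S.side * lavg H S) n R x ≤
      4 * A * ENNReal.ofReal R.side +
        3 * sparseSum H (fun S => ENNReal.ofReal S.side * lavg H S) n A R x := by
  induction n generalizing R A with
  | zero => simp [fullSum]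
  | succ n ih =>
    have key (B : ℝ≥0∞) : 4 * B * ENNReal.ofReal (R.sel x).side = 2 * B * ENNReal.ofReal R.side := by
      rw [Cube.sel_side, R.ofReal_side_half]
      calc 4 * B * (ENNReal.ofReal R.side / 2) = 2 * B * (2 * (ENNReal.ofReal R.side / 2)) := by ring
        _ = _ := by rw [ENNReal.mul_div_cancel (by simp) (by simp)]
    simp only [fullSum, sparseSum]
    split_ifs with h
    · refine (add_le_add_right (ih (lavg H R) (R.sel x)) _).trans ?_
      rw [key]
      refine le_trans (le_of_eq ?_) le_add_self
      ring
    · refine (add_le_add_right (ih A (R.sel x)) _).trans ?_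
      rw [key]
      have : ENNReal.ofReal R.side * lavg H R ≤ 2 * A * ENNReal.ofReal R.side := by
        rw [mul_comm]; exact mul_le_mul_left (not_lt.1 h) _
      calc _ ≤ 2 * A * ENNReal.ofReal R.side + (2 * A * ENNReal.ofReal R.side + _) :=
            add_le_add_left this _
        _ = _ := by ring

lemma sparseSum_le_pathMax_mul (H : (Fin d → ℝ) → ℝ≥0∞) (c : Cube d → ℝ≥0∞) (n : ℕ) (A : ℝ≥0∞)
    (R : Cube d) (x : Fin d → ℝ) :
    sparseSum H c n A R x ≤ pathMax c n R x * sparseSum H (fun _ => 1) n A R x := by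
  induction n generalizing R A with
  | zero => simp [sparseSum]
  | succ n ih =>
    simp only [pathMax, sparseSum]
    split_ifs
    · rw [mul_add, mul_one]
      exact add_le_add (le_max_left _ _) ((ih _ _).trans (mul_le_mul_left (le_max_right _ _) _))
    · exact (ih _ _).trans (mul_le_mul_left (le_max_right _ _) _)

lemma sum_rpow_le_rpow_sum {ι : Type*} (s : Finset ι) (f : ι → ℝ≥0∞) {θ : ℝ} (hθ : 1 ≤ θ) :
    ∑ i ∈ s, f i ^ θ ≤ (∑ i ∈ s, f i) ^ θ := by
  classical
  induction s using Finset.induction_on with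
  | empty => simp
  | insert i s hi ih =>
    rw [Finset.sum_insert hi, Finset.sum_insert hi]
    exact (add_le_add_right ih _).trans (ENNReal.add_rpow_le_rpow_add _ _ hθ)

/-- The weak-type bound for the dyadic maximal operator; no constant is lost. -/
lemma measure_pathMax_gt_le (m ν : Measure (Fin d → ℝ)) (hm : m ≪ volume) (hν : ν ≪ volume)
    (c : Cube d → ℝ≥0∞) {q θ : ℝ} (hq : 0 < q) (hθ : 1 ≤ θ) (K t : ℝ≥0∞) (n : ℕ) (R : Cube d)
    (h : ∀ S : Cube d, S.toSet ⊆ R.toSet → c S ^ q * m S.toSet ≤ K * ν S.toSet ^ θ) :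
    t ^ q * m.restrict R.toSet {x | t < pathMax c n R x} ≤ K * ν R.toSet ^ θ := by
  induction n generalizing R with
  | zero => simp [pathMax]
  | succ n ih =>
    by_cases ht : t < c R
    · calc t ^ q * m.restrict R.toSet {x | t < pathMax c (n + 1) R x}
          ≤ c R ^ q * m.restrict R.toSet Set.univ := by
            gcongr; exact Set.subset_univ _
        _ ≤ _ := by simpa using h R subset_rfl
    · have : {x | t < pathMax c (n + 1) R x} = {x | t < pathMax c n (R.sel x) x} := by
        ext x
        change t < max _ _ ↔ t < _
        simp [ht]
      rw [this, measure_eq_sum_child m hm R (fun S x => t < pathMax c n S x), Finset.mul_sum,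
        measure_cube_eq_sum_child ν hν R]
      calc _ ≤ ∑ e, K * ν (R.child e).toSet ^ θ := Finset.sum_le_sum fun e _ =>
            ih _ fun S hS => h S (hS.trans (R.child_subset e))
        _ ≤ _ := by rw [← Finset.mul_sum]; gcongr; exact sum_rpow_le_rpow_sum _ _ hθ

lemma lavg_mul_vol (H : (Fin d → ℝ) → ℝ≥0∞) (R : Cube d) :
    lavg H R * R.vol = ∫⁻ x in R.toSet, H x :=
  ENNReal.div_mul_cancel R.vol_ne_zero R.vol_ne_top

/-- The Carleson packing of the principal cubes with respect to a measure `m`, in terms of its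
dyadic maximal function. The parameter `a` is a lower bound for the maximal function coming from
the principal cubes above `R`; the terms `2 a |R|` and `(a / A) ∫ H` keep account of the fact that
the principal cubes below a principal cube fill at most half of it. -/
lemma lintegral_sparseSum_one_add_le (m : Measure (Fin d → ℝ)) (hm : m ≪ volume)
    (H : (Fin d → ℝ) → ℝ≥0∞) (n : ℕ) (A a : ℝ≥0∞) (R : Cube d) (ha : a ≠ ⊤) (hA : A = 0 → a = 0)
    (hmR : m R.toSet ≠ ⊤) (hH : ∫⁻ x in R.toSet, H x ≠ ⊤) :
    ∫⁻ x in R.toSet, sparseSum H (fun _ => 1) n A R x ∂m + 2 * a * R.vol ≤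
      (2 * ∫⁻ x in R.toSet, max a (pathMax (fun S => m S.toSet / S.vol) n R x)) +
        a / A * ∫⁻ x in R.toSet, H x := by
  induction n generalizing R A a with
  | zero =>
    refine le_trans (le_of_eq ?_) le_self_add
    simp [sparseSum, pathMax, Cube.vol, mul_assoc]
  | succ n ih =>
    have hstep (A a : ℝ≥0∞) (ha : a ≠ ⊤) (hA : A = 0 → a = 0) :
        ∫⁻ x in R.toSet, sparseSum H (fun _ => 1) n A (R.sel x) x ∂m + 2 * a * R.vol ≤
          (2 * ∫⁻ x in R.toSet, max a (pathMax (fun S => m S.toSet / S.vol) n (R.sel x) x)) +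
            a / A * ∫⁻ x in R.toSet, H x := by
      rw [lintegral_eq_sum_child m hm R (fun S x => sparseSum H (fun _ => 1) n A S x),
        lintegral_eq_sum_child volume Measure.AbsolutelyContinuous.rfl R
          (fun S x => max a (pathMax (fun S => m S.toSet / S.vol) n S x)),
        lintegral_eq_sum_child volume Measure.AbsolutelyContinuous.rfl R (fun _ x => H x),
        Cube.vol, measure_cube_eq_sum_child volume Measure.AbsolutelyContinuous.rfl R,
        Finset.mul_sum, Finset.mul_sum, Finset.mul_sum, ← Finset.sum_add_distrib,
        ← Finset.sum_add_distrib]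
      refine Finset.sum_le_sum fun e _ => ih A a _ ha hA ?_ ?_
      · exact ne_top_of_le_ne_top hmR (measure_mono (R.child_subset e))
      · exact ne_top_of_le_ne_top hH (lintegral_mono_set (R.child_subset e))
    simp only [sparseSum, pathMax]
    split_ifs with h
    · set b := max a (m R.toSet / R.vol) with hb
      set B := lavg H R with hBdef
      have hbtop : b ≠ ⊤ := by
        rw [hb]; exact (max_lt ha.lt_top (ENNReal.div_lt_top hmR R.vol_ne_zero)).ne
      have hB0 : B ≠ 0 := (bot_le.trans_lt h).ne'
      have hBtop : B ≠ ⊤ := (ENNReal.div_lt_top hH R.vol_ne_zero).ne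
      have h1 := hstep B b hbtop (fun h0 => absurd h0 hB0)
      have h2 : b / B * ∫⁻ x in R.toSet, H x = b * R.vol := by
        rw [← lavg_mul_vol, ← hBdef, ← mul_assoc, ENNReal.div_mul_cancel hB0 hBtop]
      have hbv : b * R.vol ≠ ⊤ := ENNReal.mul_ne_top hbtop R.vol_ne_top
      have h3 : ∫⁻ x in R.toSet, sparseSum H (fun _ => 1) n B (R.sel x) x ∂m + b * R.vol ≤
          2 * ∫⁻ x in R.toSet, max b (pathMax (fun S => m S.toSet / S.vol) n (R.sel x) x) := by
        rw [h2, show 2 * b * R.vol = b * R.vol + b * R.vol by ring, ← add_assoc] at h1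
        exact (ENNReal.add_le_add_iff_right hbv).1 h1
      have h4 : m R.toSet ≤ b * R.vol := by
        rw [← ENNReal.div_le_iff R.vol_ne_zero R.vol_ne_top]; exact le_max_right _ _
      have h5 : 2 * a * R.vol ≤ a / A * ∫⁻ x in R.toSet, H x := by
        by_cases hA0 : A = 0
        · simp [hA hA0]
        · have hAtop : A ≠ ⊤ := by
            rintro rfl; simp at h
          calc 2 * a * R.vol = a / A * ((2 * A) * R.vol) := by
                calc _ = 2 * (a / A * A) * R.vol := by rw [ENNReal.div_mul_cancel hA0 hAtop]
                  _ = _ := by ring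
            _ ≤ a / A * (B * R.vol) := by gcongr
            _ = _ := by rw [hBdef, lavg_mul_vol]
      rw [lintegral_add_left measurable_const, lintegral_const, one_mul,
        Measure.restrict_apply_univ]
      simp only [← max_assoc, ← hb]
      calc m R.toSet + (∫⁻ x in R.toSet, sparseSum H (fun _ => 1) n B (R.sel x) x ∂m)
              + 2 * a * R.vol
          ≤ (∫⁻ x in R.toSet, sparseSum H (fun _ => 1) n B (R.sel x) x ∂m + b * R.vol) +
              2 * a * R.vol := by
            rw [add_comm (m R.toSet)]; gcongr
        _ ≤ _ := add_le_add h3 h5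
    · refine (hstep A a ha hA).trans ?_
      gcongr with x
      exact le_max_right _ _

lemma lintegral_sparseSum_one_le (m : Measure (Fin d → ℝ)) (hm : m ≪ volume)
    (H : (Fin d → ℝ) → ℝ≥0∞) (n : ℕ) (A : ℝ≥0∞) (R : Cube d)
    (hmR : m R.toSet ≠ ⊤) (hH : ∫⁻ x in R.toSet, H x ≠ ⊤) :
    ∫⁻ x in R.toSet, sparseSum H (fun _ => 1) n A R x ∂m ≤
      2 * ∫⁻ x in R.toSet, pathMax (fun S => m S.toSet / S.vol) n R x := by
  simpa using lintegral_sparseSum_one_add_le m hm H n A 0 R (by simp) (by simp) hmR hH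

/-- The good-`λ` inequality: a localized bound for the tail of the sparse sum in each cube
compares the distribution function at two levels. Here `s` is the contribution of the cubes
above `R`. -/
lemma measure_add_sparseSum_gt_le (m ν : Measure (Fin d → ℝ)) (hm : m ≪ volume) (hν : ν ≪ volume)
    (H : (Fin d → ℝ) → ℝ≥0∞) (c : Cube d → ℝ≥0∞) {θ : ℝ} (hθ : 1 ≤ θ) (η D t : ℝ≥0∞) (n : ℕ)
    (A s : ℝ≥0∞) (R : Cube d) (hs : s ≤ t)
    (h : ∀ (n : ℕ) (A : ℝ≥0∞) (S : Cube d), S.toSet ⊆ R.toSet →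
      m.restrict S.toSet {x | t < sparseSum H c n A S x} ≤ η * m S.toSet + D * ν S.toSet ^ θ) :
    m.restrict R.toSet {x | 2 * t < s + sparseSum H c n A R x} ≤
      η * m.restrict R.toSet {x | t < s + sparseSum H c n A R x} + D * ν R.toSet ^ θ := by
  induction n generalizing R A s with
  | zero =>
    refine le_trans (le_of_eq ?_) zero_le
    have : {x : Fin d → ℝ | 2 * t < s + sparseSum H c 0 A R x} = ∅ := by
      ext x
      change 2 * t < s + 0 ↔ False
      simp only [add_zero, iff_false, not_lt]
      exact hs.trans (by rw [two_mul]; exact le_add_self)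
    rw [this]; simp
  | succ n ih =>
    have hstep (A s : ℝ≥0∞) (hs : s ≤ t) :
        m.restrict R.toSet {x | 2 * t < s + sparseSum H c n A (R.sel x) x} ≤
          η * m.restrict R.toSet {x | t < s + sparseSum H c n A (R.sel x) x} +
            D * ν R.toSet ^ θ := by
      rw [measure_eq_sum_child m hm R (fun S x => 2 * t < s + sparseSum H c n A S x),
        measure_eq_sum_child m hm R (fun S x => t < s + sparseSum H c n A S x),
        measure_cube_eq_sum_child ν hν R, Finset.mul_sum]
      calc _ ≤ ∑ e, (η * m.restrict (R.child e).toSet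
              {x | t < s + sparseSum H c n A (R.child e) x} + D * ν (R.child e).toSet ^ θ) :=
            Finset.sum_le_sum fun e _ => ih A s _ hs
              fun n A S hS => h n A S (hS.trans (R.child_subset e))
        _ ≤ _ := by
            rw [Finset.sum_add_distrib, ← Finset.mul_sum Finset.univ _ D]
            gcongr; exact sum_rpow_le_rpow_sum _ _ hθ
    by_cases hprinc : 2 * A < lavg H R
    · by_cases hs' : s + c R ≤ t
      · have := hstep (lavg H R) (s + c R) hs'
        simpa only [sparseSum, hprinc, if_true, add_assoc] using this
      · -- The level is first exceeded at `R`, so the localized bound applies on all of `R`.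
        have h1 : {x | t < s + sparseSum H c (n + 1) A R x} = Set.univ := by
          refine Set.eq_univ_of_forall fun x => ?_
          change t < _
          simp only [sparseSum, hprinc, if_true, ← add_assoc]
          exact (not_le.1 hs').trans_le le_self_add
        rw [h1, Measure.restrict_apply_univ]
        refine (measure_mono ?_).trans (h (n + 1) A R subset_rfl)
        intro x (hx : 2 * t < _)
        change t < _
        by_contra hcon
        refine absurd hx (not_lt.2 ?_)
        rw [two_mul]
        exact add_le_add hs (not_lt.1 hcon)
    · simpa only [sparseSum, hprinc, if_false] using hstep A s hs

/-! ### Moments of sparse sums -/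

/-- The integral of a sparse sum against `m` is the integral of the adjoint sparse sum
against `H`. -/
lemma lintegral_sparseSum_eq (m : Measure (Fin d → ℝ)) (hm : m ≪ volume)
    (H : (Fin d → ℝ) → ℝ≥0∞) (n : ℕ) (A : ℝ≥0∞) (R : Cube d)
    (hH : AEMeasurable H (volume.restrict R.toSet)) :
    ∫⁻ x in R.toSet, sparseSum H (fun S => ENNReal.ofReal S.side * lavg H S) n A R x ∂m =
      ∫⁻ x in R.toSet, H x *
        sparseSum H (fun S => ENNReal.ofReal S.side / S.vol * m S.toSet) n A R x := by
  induction n generalizing R A with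
  | zero => simp [sparseSum]
  | succ n ih =>
    have hstep (A : ℝ≥0∞) :
        ∫⁻ x in R.toSet,
          sparseSum H (fun S => ENNReal.ofReal S.side * lavg H S) n A (R.sel x) x ∂m =
        ∫⁻ x in R.toSet, H x *
          sparseSum H (fun S => ENNReal.ofReal S.side / S.vol * m S.toSet) n A (R.sel x) x := by
      rw [lintegral_eq_sum_child m hm R (fun S x => sparseSum H _ n A S x),
        lintegral_eq_sum_child volume Measure.AbsolutelyContinuous.rfl R
          (fun S x => H x * sparseSum H _ n A S x)]
      exact Finset.sum_congr rfl fun e _ =>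
        ih A _ (hH.mono_measure (Measure.restrict_mono (R.child_subset e) le_rfl))
    simp only [sparseSum]
    split_ifs
    · simp only [mul_add]
      rw [lintegral_add_left measurable_const, lintegral_add_left' (hH.mul_const _), hstep,
        lintegral_mul_const'' _ hH, lintegral_const, Measure.restrict_apply_univ, lavg]
      congr 1
      simp only [div_eq_mul_inv]
      ring
    · exact hstep A

lemma add_rpow_le_add_mul {r : ℝ} (hr : 1 < r) {s b : ℝ≥0∞} (hs : s ≠ ⊤) (hb : b ≠ ⊤) :
    (s + b) ^ r ≤ s ^ r + ENNReal.ofReal r * b * (s + b) ^ (r - 1) := by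
  lift s to ℝ≥0 using hs
  lift b to ℝ≥0 using hb
  by_cases h0 : s + b = 0
  · have : (s : ℝ≥0∞) + b = 0 := by exact_mod_cast h0
    rw [this, ENNReal.zero_rpow_of_pos (by linarith)]
    exact zero_le
  have hr0 : (0 : ℝ) ≤ r := by linarith
  have key : ((s : ℝ) + b) ^ r ≤ (s : ℝ) ^ r + r * b * ((s : ℝ) + b) ^ (r - 1) := by
    have hpos : 0 < (s : ℝ) + b := by
      have : 0 < s + b := pos_iff_ne_zero.2 h0
      exact_mod_cast this
    have hB := one_add_mul_self_le_rpow_one_add (s := -((b : ℝ) / (s + b))) (p := r)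
      (by rw [neg_le_neg_iff, div_le_one hpos]; linarith [s.coe_nonneg]) hr.le
    have h1 : (1 + -((b : ℝ) / (s + b))) = s / (s + b) := by field_simp; ring
    rw [h1, Real.div_rpow s.coe_nonneg hpos.le, le_div_iff₀ (Real.rpow_pos_of_pos hpos _)] at hB
    have h2 : ((s : ℝ) + b) ^ r = ((s : ℝ) + b) ^ (r - 1) * (s + b) := by
      rw [← Real.rpow_add_one hpos.ne', sub_add_cancel]
    have h3 : (1 + r * -((b : ℝ) / (s + b))) * ((s : ℝ) + b) ^ r =
        ((s : ℝ) + b) ^ r - r * b * ((s : ℝ) + b) ^ (r - 1) := by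
      rw [h2]; field_simp; ring
    linarith
  have h4 : (s + b) ^ r ≤ s ^ r + r.toNNReal * b * (s + b) ^ (r - 1) := by
    rw [← NNReal.coe_le_coe]
    push_cast
    rwa [Real.coe_toNNReal _ hr0]
  have e1 : ((s : ℝ≥0∞) + b) ^ r = (((s + b) ^ r : ℝ≥0) : ℝ≥0∞) := by
    rw [← ENNReal.coe_add, ENNReal.coe_rpow_of_nonneg _ hr0]
  have e2 : ((s : ℝ≥0∞) + b) ^ (r - 1) = (((s + b) ^ (r - 1) : ℝ≥0) : ℝ≥0∞) := by
    rw [← ENNReal.coe_add, ENNReal.coe_rpow_of_nonneg _ (by linarith)]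
  rw [e1, e2, ← ENNReal.coe_rpow_of_nonneg _ hr0, ENNReal.ofReal]
  exact_mod_cast h4

/-- A quasi-triangle inequality for powers with a constant close to one in front of one of the
two terms. -/
lemma exists_add_rpow_le {t : ℝ} (ht : 0 < t) {L : ℝ≥0} (hL : 1 < L) :
    ∃ C : ℝ≥0, 1 ≤ C ∧ ∀ s b : ℝ≥0∞, (s + b) ^ t ≤ L * s ^ t + C * b ^ t := by
  have hl : 1 < L ^ (1 / t) := NNReal.one_lt_rpow hL (by positivity)
  obtain ⟨δ, hδ⟩ := exists_add_of_le hl.le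
  have hδ0 : δ ≠ 0 := by rintro rfl; rw [hδ, add_zero] at hl; exact lt_irrefl _ hl
  have hδt : ((1 : ℝ≥0∞) + δ) ^ t = L := by
    have : (1 + δ) ^ t = L := by rw [← hδ, ← NNReal.rpow_mul]; simp [ht.ne']
    rw [← this, ENNReal.coe_rpow_of_nonneg _ ht.le]; push_cast; rfl
  refine ⟨(δ⁻¹ + 1) ^ t, NNReal.one_le_rpow (by simp) ht.le, fun s b => ?_⟩
  by_cases h : b ≤ δ * s
  · refine le_trans ?_ le_self_add
    rw [← hδt, ← ENNReal.mul_rpow_of_nonneg _ _ ht.le, add_mul, one_mul]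
    gcongr
  · refine le_trans ?_ le_add_self
    have hs : s ≤ (δ⁻¹ : ℝ≥0) * b := by
      rw [ENNReal.coe_inv hδ0, mul_comm, ← div_eq_mul_inv, ENNReal.le_div_iff_mul_le (by simp [hδ0])
        (by simp), mul_comm]
      exact (not_le.1 h).le
    rw [ENNReal.coe_rpow_of_nonneg _ ht.le, ← ENNReal.mul_rpow_of_nonneg _ _ ht.le]
    push_cast
    rw [add_mul, one_mul]
    gcongr

/-- The moment bound for sparse sums behind the testing condition. The sum of `b` over the
principal cubes above `R` is `s`; its power `s ^ (r - 1)` is controlled by `V`, a sum in which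
older terms are weighted by powers of `L > 1`. This growth is compensated by the geometric decay
of `Y` from a cube to its children. -/
lemma lintegral_add_sparseSum_rpow_le (m μ : Measure (Fin d → ℝ)) (hm : m ≪ volume)
    (hμ : μ ≪ volume) (H : (Fin d → ℝ) → ℝ≥0∞) (b Y : Cube d → ℝ≥0∞) {r : ℝ} (hr : 1 < r)
    (L κ C C' : ℝ≥0) (hL : 1 ≤ L)
    (hLC : ∀ s b : ℝ≥0∞, (s + b) ^ (r - 1) ≤ L * s ^ (r - 1) + C * b ^ (r - 1))
    (hLκ : 1 + C' * (L * κ) ≤ C') (Γ Z : ℝ≥0∞) (n : ℕ) (A s V : ℝ≥0∞) (R : Cube d)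
    (hY : ∀ S : Cube d, S.toSet ⊆ R.toSet → ∑ e, Y (S.child e) ≤ κ * Y S)
    (hb : ∀ S : Cube d, S.toSet ⊆ R.toSet → b S ≠ ⊤)
    (hbμ : ∀ S : Cube d, S.toSet ⊆ R.toSet → b S * μ S.toSet ≤ Γ * Y S)
    (hbY : ∀ S : Cube d, S.toSet ⊆ R.toSet → b S ^ (r - 1) * Y S ≤ Z * m S.toSet)
    (hs : s ≠ ⊤) (hsV : L * s ^ (r - 1) ≤ C * V) :
    ∫⁻ x in R.toSet, (s + sparseSum H b n A R x) ^ r ∂μ ≤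
      s ^ r * μ R.toSet + ENNReal.ofReal r * C * Γ * C' *
        (V * Y R + Z * ∫⁻ x in R.toSet, sparseSum H (fun _ => 1) n A R x ∂m) := by
  induction n generalizing R A s V with
  | zero => simp [sparseSum]
  | succ n ih =>
    have hstep (A s V : ℝ≥0∞) (hs : s ≠ ⊤) (hsV : L * s ^ (r - 1) ≤ C * (L * V)) :
        ∫⁻ x in R.toSet, (s + sparseSum H b n A (R.sel x) x) ^ r ∂μ ≤
          s ^ r * μ R.toSet + ENNReal.ofReal r * C * Γ * C' *
            (L * κ * (V * Y R) +
              Z * ∫⁻ x in R.toSet, sparseSum H (fun _ => 1) n A (R.sel x) x ∂m) := by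
      rw [lintegral_eq_sum_child μ hμ R (fun S x => (s + sparseSum H b n A S x) ^ r),
        lintegral_eq_sum_child m hm R (fun S x => sparseSum H (fun _ => 1) n A S x)]
      have hsub (e) (S : Cube d) (hS : S.toSet ⊆ (R.child e).toSet) : S.toSet ⊆ R.toSet :=
        hS.trans (R.child_subset e)
      refine (Finset.sum_le_sum fun e _ => ih A s (L * V) (R.child e)
        (fun S hS => hY S (hsub e S hS)) (fun S hS => hb S (hsub e S hS))
        (fun S hS => hbμ S (hsub e S hS)) (fun S hS => hbY S (hsub e S hS)) hs hsV).trans ?_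
      rw [Finset.sum_add_distrib, ← Finset.mul_sum, ← measure_cube_eq_sum_child μ hμ,
        ← Finset.mul_sum, Finset.sum_add_distrib, ← Finset.mul_sum, ← Finset.mul_sum]
      have h1 : L * V * ∑ e, Y (R.child e) ≤ L * κ * (V * Y R) :=
        (mul_le_mul_right (hY R subset_rfl) _).trans (le_of_eq (by ring))
      exact add_le_add_right (mul_le_mul_right (add_le_add_left h1 _) _) _
    simp only [sparseSum]
    split_ifs with h
    · have hL0 : (L : ℝ≥0∞) ≠ 0 := by
        have := zero_lt_one.trans_le hL
        exact_mod_cast this.ne'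
      have hs1 : (s + b R) ^ (r - 1) ≤ C * (V + b R ^ (r - 1)) := by
        rw [mul_add]
        exact (hLC _ _).trans (add_le_add_left hsV _)
      have h1 := hstep (lavg H R) (s + b R) (V + b R ^ (r - 1))
        (ENNReal.add_ne_top.2 ⟨hs, hb R subset_rfl⟩)
        (by rw [mul_left_comm]; exact mul_le_mul_right hs1 _)
      simp only [← add_assoc]
      refine h1.trans ?_
      rw [lintegral_add_left measurable_const, lintegral_const, one_mul,
        Measure.restrict_apply_univ]
      set I := ∫⁻ x in R.toSet, sparseSum H (fun _ => 1) n (lavg H R) (R.sel x) x ∂m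
      set V1 := V + b R ^ (r - 1) with hV1
      have h2 : (s + b R) ^ r * μ R.toSet ≤
          s ^ r * μ R.toSet + ENNReal.ofReal r * C * Γ * (V1 * Y R) := by
        calc _ ≤ (s ^ r + ENNReal.ofReal r * b R * (s + b R) ^ (r - 1)) * μ R.toSet := by
              gcongr; exact add_rpow_le_add_mul hr hs (hb R subset_rfl)
          _ ≤ (s ^ r + ENNReal.ofReal r * b R * (C * V1)) * μ R.toSet := by gcongr
          _ = s ^ r * μ R.toSet + ENNReal.ofReal r * C * V1 * (b R * μ R.toSet) := by ring
          _ ≤ s ^ r * μ R.toSet + ENNReal.ofReal r * C * V1 * (Γ * Y R) := by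
              exact add_le_add_right (mul_le_mul_right (hbμ R subset_rfl) _) _
          _ = _ := by ring
      calc _ ≤ s ^ r * μ R.toSet + ENNReal.ofReal r * C * Γ * (V1 * Y R) +
            ENNReal.ofReal r * C * Γ * C' * (L * κ * (V1 * Y R) + Z * I) :=
            add_le_add_left h2 _
        _ = s ^ r * μ R.toSet + ENNReal.ofReal r * C * Γ *
              ((1 + C' * (L * κ) : ℝ≥0) * (V1 * Y R) + C' * (Z * I)) := by push_cast; ring
        _ ≤ s ^ r * μ R.toSet + ENNReal.ofReal r * C * Γ * (C' * (V1 * Y R) + C' * (Z * I)) := by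
              gcongr
        _ = s ^ r * μ R.toSet + ENNReal.ofReal r * C * Γ * C' *
              (V * Y R + b R ^ (r - 1) * Y R + Z * I) := by rw [hV1]; ring
        _ ≤ s ^ r * μ R.toSet + ENNReal.ofReal r * C * Γ * C' *
              (V * Y R + Z * m R.toSet + Z * I) := by
            exact add_le_add_right (mul_le_mul_right (add_le_add_left
              (add_le_add_right (hbY R subset_rfl) _) _) _) _
        _ = _ := by ring
    · have hC' : L * κ ≤ 1 := by
        have h3 : C' * (L * κ) < C' := lt_of_lt_of_le (by simp) hLκ
        exact (lt_of_mul_lt_mul_left (h3.trans_eq (mul_one C').symm) C'.2).le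
      have h4 : V ≤ L * V := le_mul_of_one_le_left' (by exact_mod_cast hL)
      have h5 : L * κ * (V * Y R) ≤ V * Y R := mul_le_of_le_one_left' (by exact_mod_cast hC')
      exact (hstep A s V hs (hsV.trans (mul_le_mul_right h4 _))).trans
        (add_le_add_right (mul_le_mul_right (add_le_add_left h5 _) _) _)

/-! ### The dual testing condition -/

lemma sum_rpow_mul_rpow_le {ι : Type*} (s : Finset ι) (f g : ι → ℝ≥0∞) {a b : ℝ} (ha : 0 < a)
    (hb : 0 < b) (hab : a + b = 1) :
    ∑ i ∈ s, f i ^ a * g i ^ b ≤ (∑ i ∈ s, f i) ^ a * (∑ i ∈ s, g i) ^ b := by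
  have hc : (1 / a).HolderConjugate (1 / b) := by
    rw [Real.holderConjugate_iff]
    refine ⟨?_, by simpa using hab⟩
    rw [lt_div_iff₀ ha]; linarith
  have := ENNReal.inner_le_Lp_mul_Lq s (fun i => f i ^ a) (fun i => g i ^ b) hc
  simp only [← ENNReal.rpow_mul, one_div_one_div] at this
  simpa [ha.ne', hb.ne'] using this

lemma side_div_vol_child (R : Cube d) (e : Fin d → Bool) :
    ENNReal.ofReal (R.child e).side / (R.child e).vol =
      2 ^ ((d : ℝ) - 1) * (ENNReal.ofReal R.side / R.vol) := by
  have h2 : (2 : ℝ≥0∞) ^ ((d : ℝ) - 1) = 2 ^ d / 2 := by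
    rw [ENNReal.rpow_sub _ _ (by simp) (by simp)]; simp
  rw [h2, ← R.child_vol e, Cube.child_side, R.ofReal_side_half]
  simp only [div_eq_mul_inv]
  rw [ENNReal.mul_inv (Or.inl (by simp)) (Or.inl (by simp))]
  calc _ = ((2 : ℝ≥0∞) ^ d * (2 ^ d)⁻¹) * (ENNReal.ofReal R.side * 2⁻¹ * (R.child e).vol⁻¹) := by
        rw [ENNReal.mul_inv_cancel (by simp) (by simp), one_mul]
    _ = _ := by ring

/-- The quantity `K ^ (1 - θ) w ^ (1 - θ / q) μ ^ (1 - θ / r)` with `1 / θ = 1 / r + 1 / q` decays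
geometrically from a cube to its children. -/
lemma sum_child_le (m μ : Measure (Fin d → ℝ)) (hm : m ≪ volume) (hμ : μ ≪ volume) (R : Cube d)
    {q r θ : ℝ} (hq : 0 < q) (hr : 0 < r) (hθ : θ⁻¹ = 1 / r + 1 / q) :
    ∑ e, (ENNReal.ofReal (R.child e).side / (R.child e).vol) ^ (1 - θ) *
        (m (R.child e).toSet ^ (1 - θ / q) * μ (R.child e).toSet ^ (1 - θ / r)) ≤
      2 ^ (((d : ℝ) - 1) * (1 - θ)) * ((ENNReal.ofReal R.side / R.vol) ^ (1 - θ) *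
        (m R.toSet ^ (1 - θ / q) * μ R.toSet ^ (1 - θ / r))) := by
  have hθ0 : 0 < θ := by
    rw [← inv_pos, hθ]; positivity
  have h1 : θ / r + θ / q = 1 := by
    have : θ * θ⁻¹ = 1 := mul_inv_cancel₀ hθ0.ne'
    rw [hθ] at this; rw [← this]; ring
  have h2 : 0 < θ / r := by positivity
  have h3 : 0 < θ / q := by positivity
  simp only [side_div_vol_child]
  rw [← Finset.mul_sum, measure_cube_eq_sum_child m hm R, measure_cube_eq_sum_child μ hμ R,
    ENNReal.mul_rpow_of_ne_top (ENNReal.rpow_ne_top_of_ne_zero (by simp) (by simp))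
      (ENNReal.div_ne_top ENNReal.ofReal_ne_top R.vol_ne_zero), ← ENNReal.rpow_mul, mul_assoc]
  gcongr
  exact sum_rpow_mul_rpow_le _ _ _ (by linarith) (by linarith) (by linarith)

/-- The dual testing condition: the moment of the adjoint sparse sum over a cube. -/
lemma exists_lintegral_sparseSum_rpow_le (d : ℕ) (hd : 2 ≤ d) {q r : ℝ} (hr : 1 < r) (hq : 1 < q)
    (hqr : 1 / r + 1 / q < 1) :
    ∃ C : ℝ≥0, ∀ (m μ : Measure (Fin d → ℝ)), m ≪ volume → μ ≪ volume →
      ∀ (H : (Fin d → ℝ) → ℝ≥0∞) (Ψ P : ℝ≥0∞) (n : ℕ) (A : ℝ≥0∞) (R : Cube d),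
      (∀ S : Cube d, S.toSet ⊆ R.toSet → m S.toSet ≠ 0 ∧ m S.toSet ≠ ⊤ ∧
        μ S.toSet ≠ 0 ∧ μ S.toSet ≠ ⊤) →
      (∀ S : Cube d, S.toSet ⊆ R.toSet →
        ENNReal.ofReal S.side / S.vol * μ S.toSet ^ (1 / r) * m S.toSet ^ (1 / q) ≤ Ψ) →
      ∫⁻ x in R.toSet, sparseSum H (fun _ => 1) n A R x ∂m ≤ P * m R.toSet →
      ∫⁻ x in R.toSet,
          sparseSum H (fun S => ENNReal.ofReal S.side / S.vol * m S.toSet) n A R x ^ r ∂μ ≤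
        C * Ψ ^ r * P * m R.toSet ^ (r * (1 - 1 / q)) := by
  set θ : ℝ := (1 / r + 1 / q)⁻¹ with hθdef
  have hr0 : 0 < r := by linarith
  have hq0 : 0 < q := by linarith
  have hir : 0 < 1 / r := by positivity
  have hiq : 0 < 1 / q := by positivity
  have hθ : θ⁻¹ = 1 / r + 1 / q := by rw [hθdef, inv_inv]
  have hθ1 : 1 < θ := (one_lt_inv₀ (by positivity)).2 hqr
  have hθr : θ ≤ r := by
    rw [hθdef, inv_le_comm₀ (by positivity) hr0, ← one_div]; linarith
  set κ : ℝ≥0 := 2 ^ (((d : ℝ) - 1) * (1 - θ)) with hκdef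
  have hκ1 : κ < 1 := by
    apply NNReal.rpow_lt_one_of_one_lt_of_neg (by norm_num)
    have : (2 : ℝ) ≤ d := by exact_mod_cast hd
    nlinarith
  have hκ0 : 0 < κ := NNReal.rpow_pos (by norm_num)
  set ρ : ℝ≥0 := NNReal.sqrt κ with hρdef
  have hρ0 : 0 < ρ := NNReal.sqrt_pos.2 hκ0
  have hρ1 : ρ < 1 := by simpa using NNReal.sqrt_lt_sqrt.2 hκ1
  have hρκ : ρ⁻¹ * κ = ρ := by
    have : κ = ρ * ρ := (NNReal.mul_self_sqrt κ).symm
    rw [this, ← mul_assoc, inv_mul_cancel₀ hρ0.ne', one_mul]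
  obtain ⟨C, hC1, hC⟩ := exists_add_rpow_le (t := r - 1) (by linarith) ((one_lt_inv₀ hρ0).2 hρ1)
  set C' : ℝ≥0 := (1 - ρ)⁻¹ with hC'
  have hsub : 1 - ρ ≠ 0 := (tsub_pos_of_lt hρ1).ne'
  have hLκ : 1 + C' * (ρ⁻¹ * κ) ≤ C' := by
    rw [hρκ]
    refine le_of_eq ?_
    have h1 : C' * (1 - ρ) = 1 := inv_mul_cancel₀ hsub
    calc 1 + C' * ρ = C' * (1 - ρ) + C' * ρ := by rw [h1]
      _ = C' * ((1 - ρ) + ρ) := by ring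
      _ = C' := by rw [tsub_add_cancel_of_le hρ1.le, mul_one]
  refine ⟨r.toNNReal * C * C', ?_⟩
  intro m μ hm hμ H Ψ P n A R hfin hchar hpack
  have hexp : 0 ≤ r - r / q - 1 := by
    have : r * (1 / r + 1 / q) < r * 1 := mul_lt_mul_of_pos_left hqr hr0
    have h2 : r * (1 / r) = 1 := by field_simp
    have h3 : r * (1 / q) = r / q := by ring
    nlinarith
  have hK (S : Cube d) : ENNReal.ofReal S.side / S.vol ≠ 0 ∧ ENNReal.ofReal S.side / S.vol ≠ ⊤ :=
    ⟨ENNReal.div_ne_zero.2 ⟨S.ofReal_side_ne_zero, S.vol_ne_top⟩,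
      ENNReal.div_ne_top ENNReal.ofReal_ne_top S.vol_ne_zero⟩
  have hpow (k w u : ℝ≥0∞) (t : ℝ) (ht : 0 ≤ t) :
      (k * u ^ (1 / r) * w ^ (1 / q)) ^ t = k ^ t * u ^ (t / r) * w ^ (t / q) := by
    rw [ENNReal.mul_rpow_of_nonneg _ _ ht, ENNReal.mul_rpow_of_nonneg _ _ ht, ← ENNReal.rpow_mul,
      ← ENNReal.rpow_mul, one_div_mul_eq_div, one_div_mul_eq_div]
  have main := lintegral_add_sparseSum_rpow_le m μ hm hμ H
    (fun S => ENNReal.ofReal S.side / S.vol * m S.toSet)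
    (fun S => (ENNReal.ofReal S.side / S.vol) ^ (1 - θ) *
        (m S.toSet ^ (1 - θ / q) * μ S.toSet ^ (1 - θ / r))) hr ρ⁻¹ κ C C'
    ((one_le_inv₀ hρ0).2 hρ1.le) hC hLκ (Ψ ^ θ) (Ψ ^ (r - θ) * m R.toSet ^ (r - r / q - 1)) n A 0 0 R
    ?_ ?_ ?_ ?_ (by simp) ?_
  · simp only [zero_add, zero_mul, ENNReal.zero_rpow_of_pos hr0] at main
    refine main.trans ?_
    calc _ ≤ ENNReal.ofReal r * C * Ψ ^ θ * C' *
            (Ψ ^ (r - θ) * m R.toSet ^ (r - r / q - 1) * (P * m R.toSet)) := by gcongr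
      _ = ENNReal.ofReal r * C * C' * (Ψ ^ θ * Ψ ^ (r - θ)) * P *
            (m R.toSet ^ (r - r / q - 1) * m R.toSet ^ (1 : ℝ)) := by
          rw [ENNReal.rpow_one]; ring
      _ = _ := by
          rw [← ENNReal.rpow_add_of_nonneg _ _ (by linarith) (by linarith),
            ← ENNReal.rpow_add_of_nonneg _ _ hexp (by linarith)]
          push_cast
          rw [ENNReal.ofReal]
          congr 2
          · congr 2; ring
          · ring
  · intro S _
    have h := sum_child_le m μ hm hμ S hq0 hr0 hθ
    rwa [show (2 : ℝ≥0∞) ^ (((d : ℝ) - 1) * (1 - θ)) = κ by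
      rw [hκdef, ENNReal.coe_rpow_of_ne_zero (by simp)]; rfl] at h
  · intro S hS
    exact ENNReal.mul_ne_top (hK S).2 (hfin S hS).2.1
  · intro S hS
    obtain ⟨w0, wt, u0, ut⟩ := hfin S hS
    obtain ⟨k0, kt⟩ := hK S
    have h := ENNReal.rpow_le_rpow (hchar S hS) (by linarith : 0 ≤ θ)
    rw [hpow _ _ _ _ (by linarith)] at h
    refine le_trans (le_of_eq ?_) (mul_le_mul_left h _)
    set k := ENNReal.ofReal S.side / S.vol
    calc k * m S.toSet * μ S.toSet = k ^ (θ + (1 - θ)) * m S.toSet ^ (θ / q + (1 - θ / q)) *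
          μ S.toSet ^ (θ / r + (1 - θ / r)) := by simp
      _ = _ := by
          rw [ENNReal.rpow_add _ _ k0 kt, ENNReal.rpow_add _ _ w0 wt, ENNReal.rpow_add _ _ u0 ut]
          ring
  · intro S hS
    obtain ⟨w0, wt, u0, ut⟩ := hfin S hS
    obtain ⟨k0, kt⟩ := hK S
    have h := ENNReal.rpow_le_rpow (hchar S hS) (by linarith : 0 ≤ r - θ)
    rw [hpow _ _ _ _ (by linarith)] at h
    have hmS : m S.toSet ^ (r - r / q - 1) ≤ m R.toSet ^ (r - r / q - 1) :=
      ENNReal.rpow_le_rpow (measure_mono hS) hexp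
    refine le_trans (le_of_eq ?_)
      (mul_le_mul_left (mul_le_mul h hmS zero_le zero_le) (m S.toSet))
    set k := ENNReal.ofReal S.side / S.vol
    set w := m S.toSet
    set u := μ S.toSet
    have hkw : (k * w) ^ (r - 1) = k ^ (r - 1) * w ^ (r - 1) :=
      ENNReal.mul_rpow_of_nonneg _ _ (by linarith)
    calc (k * w) ^ (r - 1) * (k ^ (1 - θ) * (w ^ (1 - θ / q) * u ^ (1 - θ / r)))
        = (k ^ (r - 1) * k ^ (1 - θ)) * (w ^ (r - 1) * w ^ (1 - θ / q)) * u ^ (1 - θ / r) := by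
          rw [hkw]; ring
      _ = k ^ (r - θ) * w ^ ((r - θ) / q + (r - r / q - 1) + 1) * u ^ ((r - θ) / r) := by
          rw [← ENNReal.rpow_add _ _ k0 kt, ← ENNReal.rpow_add _ _ w0 wt]
          congr 3
          · ring
          · ring
          · field_simp
      _ = _ := by
          rw [ENNReal.rpow_add _ _ w0 wt, ENNReal.rpow_add _ _ w0 wt, ENNReal.rpow_one]
          ring
  · simp [ENNReal.zero_rpow_of_pos (show 0 < r - 1 by linarith)]

/-! ### From localized tail bounds to weak-type bounds -/

/-- The localized tail bound from the maximal function: where the maximal function is small, a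
large sparse sum must have many terms. -/
lemma measure_sparseSum_gt_le_of_packing (m ν : Measure (Fin d → ℝ)) (hm : m ≪ volume)
    (hν : ν ≪ volume) (H : (Fin d → ℝ) → ℝ≥0∞) (c : Cube d → ℝ≥0∞) {q θ : ℝ} (hq : 0 < q)
    (hθ : 1 ≤ θ) (η K P t : ℝ≥0∞) (hη0 : η ≠ 0) (hηt : η ≠ ⊤) (hP0 : P ≠ 0) (hPt : P ≠ ⊤)
    (ht0 : t ≠ 0) (htt : t ≠ ⊤) (n : ℕ) (A : ℝ≥0∞) (R : Cube d)
    (h : ∀ S : Cube d, S.toSet ⊆ R.toSet → c S ^ q * m S.toSet ≤ K * ν S.toSet ^ θ)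
    (hpack : ∫⁻ x in R.toSet, sparseSum H (fun _ => 1) n A R x ∂m ≤ P * m R.toSet) :
    m.restrict R.toSet {x | t < sparseSum H c n A R x} ≤
      η * m R.toSet + (P / η) ^ q * K / t ^ q * ν R.toSet ^ θ := by
  have hu0 : P / η ≠ 0 := ENNReal.div_ne_zero.2 ⟨hP0, hηt⟩
  have hut : P / η ≠ ⊤ := ENNReal.div_ne_top hPt hη0
  set u := P / η with hu
  have hsub : {x | t < sparseSum H c n A R x} ⊆
      {x | u ≤ sparseSum H (fun _ => 1) n A R x} ∪ {x | t / u < pathMax c n R x} := by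
    intro x (hx : t < _)
    by_contra hcon
    rw [Set.mem_union, not_or] at hcon
    have h1 : sparseSum H (fun _ => 1) n A R x < u := not_le.1 hcon.1
    have h2 : pathMax c n R x ≤ t / u := not_lt.1 hcon.2
    refine absurd hx (not_lt.2 ?_)
    calc _ ≤ _ := sparseSum_le_pathMax_mul H c n A R x
      _ ≤ t / u * u := mul_le_mul' h2 h1.le
      _ ≤ t := (ENNReal.div_mul_cancel hu0 hut).le
  refine (measure_mono hsub).trans ((measure_union_le _ _).trans (add_le_add ?_ ?_))
  · have h1 := mul_meas_ge_le_lintegral (μ := m.restrict R.toSet)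
      (measurable_sparseSum H (fun _ => 1) n A R) u
    rw [mul_comm, ← ENNReal.le_div_iff_mul_le (Or.inl hu0) (Or.inl hut)] at h1
    refine h1.trans ((ENNReal.div_le_div_right hpack _).trans (le_of_eq ?_))
    rw [hu, div_eq_mul_inv, ENNReal.inv_div (Or.inl hηt) (Or.inl hη0), div_eq_mul_inv]
    calc P * m R.toSet * (η * P⁻¹) = P * P⁻¹ * (η * m R.toSet) := by ring
      _ = _ := by rw [ENNReal.mul_inv_cancel hP0 hPt, one_mul]
  · have h1 := measure_pathMax_gt_le m ν hm hν c hq hθ K (t / u) n R h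
    have h2 : (t / u) ^ q = t ^ q / u ^ q := ENNReal.div_rpow_of_nonneg _ _ hq.le
    have h3 : (t / u) ^ q ≠ 0 := by
      simp only [ne_eq, ENNReal.rpow_eq_zero_iff, not_or, not_and, not_lt]
      exact ⟨fun h => absurd h (ENNReal.div_ne_zero.2 ⟨ht0, hut⟩),
        fun h => absurd h (ENNReal.div_ne_top htt hu0)⟩
    have h4 : (t / u) ^ q ≠ ⊤ :=
      ENNReal.rpow_ne_top_of_nonneg hq.le (ENNReal.div_ne_top htt hu0)
    rw [mul_comm, ← ENNReal.le_div_iff_mul_le (Or.inl h3) (Or.inl h4)] at h1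
    refine h1.trans (le_of_eq ?_)
    rw [h2, div_eq_mul_inv, ENNReal.inv_div]
    · simp only [div_eq_mul_inv]; ring
    · exact Or.inl (ENNReal.rpow_ne_top_of_nonneg hq.le hut)
    · exact Or.inl (by simp [ENNReal.rpow_eq_zero_iff, hu0, hut])

/-- The localized tail bound from a bound for the integral of the sparse sum. -/
lemma measure_sparseSum_gt_le_of_lintegral (m : Measure (Fin d → ℝ))
    (H : (Fin d → ℝ) → ℝ≥0∞) (c : Cube d → ℝ≥0∞) {q : ℝ} (hq : 1 ≤ q)
    (η X t : ℝ≥0∞) (hη0 : η ≠ 0) (hηt : η ≠ ⊤)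
    (ht0 : t ≠ 0) (htt : t ≠ ⊤) (n : ℕ) (A : ℝ≥0∞) (R : Cube d) (hm0 : m R.toSet ≠ 0)
    (hmt : m R.toSet ≠ ⊤)
    (h : ∫⁻ x in R.toSet, sparseSum H c n A R x ∂m ≤ X * m R.toSet ^ (1 - 1 / q)) :
    m.restrict R.toSet {x | t < sparseSum H c n A R x} ≤
      η * m R.toSet + (X / (η * t)) ^ q := by
  set w := m R.toSet
  have hq0 : 0 < q := by linarith
  have hle : m.restrict R.toSet {x | t < sparseSum H c n A R x} ≤ w := by
    calc _ ≤ m.restrict R.toSet Set.univ := measure_mono (Set.subset_univ _)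
      _ = w := by simp [w]
  have hch : t * m.restrict R.toSet {x | t < sparseSum H c n A R x} ≤ X * w ^ (1 - 1 / q) := by
    refine le_trans ?_ ((mul_meas_ge_le_lintegral (μ := m.restrict R.toSet)
      (measurable_sparseSum H c n A R) t).trans h)
    exact mul_le_mul_right (measure_mono fun x (hx : t < _) => hx.le) _
  by_cases hc : X * w ^ (1 - 1 / q) ≤ t * (η * w)
  · refine le_trans ?_ le_self_add
    exact (ENNReal.mul_le_mul_iff_right ht0 htt).1 (hch.trans hc)
  · -- The Chebyshev bound exceeds `η w`, hence the second term alone exceeds `w`.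
    refine hle.trans (le_trans ?_ le_add_self)
    have hηt0 : η * t ≠ 0 := mul_ne_zero hη0 ht0
    have hηtt : η * t ≠ ⊤ := ENNReal.mul_ne_top hηt htt
    have hw : w = w ^ (1 - 1 / q) * w ^ (1 / q) := by
      rw [← ENNReal.rpow_add _ _ hm0 hmt]; simp
    have hw0 : w ^ (1 - 1 / q) ≠ 0 := by simp [ENNReal.rpow_eq_zero_iff, hm0, hmt]
    have hwt : w ^ (1 - 1 / q) ≠ ⊤ := ENNReal.rpow_ne_top_of_ne_zero hm0 hmt
    have h1 : w ^ (1 / q) * (η * t) ≤ X := by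
      refine (ENNReal.mul_le_mul_iff_right hw0 hwt).1 ?_
      refine le_trans (le_of_eq ?_) ((not_le.1 hc).le.trans (le_of_eq (mul_comm _ _)))
      conv_rhs => rw [hw]
      ring
    rw [← ENNReal.le_div_iff_mul_le (Or.inl hηt0) (Or.inl hηtt)] at h1
    calc w = (w ^ (1 / q)) ^ q := by rw [← ENNReal.rpow_mul]; simp [hq0.ne']
      _ ≤ _ := ENNReal.rpow_le_rpow h1 hq0.le

/-- Absorption: a localized tail bound with a small constant in front of the measure of the cube
implies a weak-type bound. The good-`λ` inequality with `η = 2 ^ (-(q + 1))` is iterated along the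
levels `t, t / 2, t / 4, …`; halving the level costs a factor `2 ^ q`, so the error terms sum up,
and the main term tends to zero because `m` is finite on the cube. -/
lemma measure_sparseSum_gt_le (m ν : Measure (Fin d → ℝ)) (hm : m ≪ volume)
    (hν : ν ≪ volume) (H : (Fin d → ℝ) → ℝ≥0∞) (c : Cube d → ℝ≥0∞) {q θ : ℝ} (hq : 0 < q)
    (hθ : 1 ≤ θ) (E t : ℝ≥0∞) (ht0 : t ≠ 0) (htt : t ≠ ⊤) (n : ℕ) (A : ℝ≥0∞) (R : Cube d)
    (hmt : m R.toSet ≠ ⊤)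
    (h : ∀ t : ℝ≥0∞, t ≠ 0 → t ≠ ⊤ → ∀ (n : ℕ) (A : ℝ≥0∞) (S : Cube d), S.toSet ⊆ R.toSet →
      m.restrict S.toSet {x | t < sparseSum H c n A S x} ≤
        2 ^ (-(q + 1)) * m S.toSet + E / t ^ q * ν S.toSet ^ θ) :
    m.restrict R.toSet {x | t < sparseSum H c n A R x} ≤
      2 * 2 ^ q * E / t ^ q * ν R.toSet ^ θ := by
  set η : ℝ≥0∞ := 2 ^ (-(q + 1)) with hη
  set X := ν R.toSet ^ θ with hX
  have hdouble (t : ℝ≥0∞) (ht0 : t ≠ 0) (htt : t ≠ ⊤) :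
      m.restrict R.toSet {x | t < sparseSum H c n A R x} ≤
        η * m.restrict R.toSet {x | t / 2 < sparseSum H c n A R x} +
          2 ^ q * E / t ^ q * X := by
    have h1 := measure_add_sparseSum_gt_le m ν hm hν H c hθ η (E / (t / 2) ^ q) (t / 2) n A 0 R
      zero_le (h (t / 2) (by simp [ht0]) (ENNReal.div_ne_top htt (by simp)))
    rw [ENNReal.mul_div_cancel (by simp) (by simp)] at h1
    simp only [zero_add] at h1
    refine h1.trans (le_of_eq ?_)
    rw [ENNReal.div_rpow_of_nonneg _ _ hq.le]
    congr 2
    rw [div_eq_mul_inv, ENNReal.inv_div]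
    · simp only [div_eq_mul_inv]; ring
    · exact Or.inl (by simp)
    · exact Or.inl (by simp [ENNReal.rpow_eq_zero_iff])
  have hη2 : η * (2 * 2 ^ q) = 1 := by
    have : (2 : ℝ≥0∞) * 2 ^ q = 2 ^ (q + 1) := by
      rw [ENNReal.rpow_add _ _ (by simp) (by simp), ENNReal.rpow_one, mul_comm]
    rw [this, hη, ← ENNReal.rpow_add _ _ (by simp) (by simp)]
    simp
  have hiter (j : ℕ) : ∀ t : ℝ≥0∞, t ≠ 0 → t ≠ ⊤ →
      m.restrict R.toSet {x | t < sparseSum H c n A R x} ≤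
        η ^ j * m R.toSet + 2 * 2 ^ q * E / t ^ q * X := by
    induction j with
    | zero =>
      intro t _ _
      refine le_trans ?_ le_self_add
      calc _ ≤ m.restrict R.toSet Set.univ := measure_mono (Set.subset_univ _)
        _ = _ := by simp
    | succ j ih =>
      intro t ht0 htt
      refine (hdouble t ht0 htt).trans ?_
      have h1 := ih (t / 2) (by simp [ht0]) (ENNReal.div_ne_top htt (by simp))
      have h2 : η * (2 * 2 ^ q * E / (t / 2) ^ q * X) = 2 ^ q * E / t ^ q * X := by
        rw [ENNReal.div_rpow_of_nonneg _ _ hq.le, div_eq_mul_inv, ENNReal.inv_div]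
        · calc _ = η * (2 * 2 ^ q) * (2 ^ q * E / t ^ q * X) := by
                simp only [div_eq_mul_inv]; ring
            _ = _ := by rw [hη2, one_mul]
        · exact Or.inl (by simp)
        · exact Or.inl (by simp [ENNReal.rpow_eq_zero_iff])
      calc _ ≤ η * (η ^ j * m R.toSet + 2 * 2 ^ q * E / (t / 2) ^ q * X) +
            2 ^ q * E / t ^ q * X := by gcongr
        _ = η ^ (j + 1) * m R.toSet + (2 ^ q * E / t ^ q * X + 2 ^ q * E / t ^ q * X) := by
            rw [mul_add, h2]; ring
        _ = _ := by congr 1; simp only [div_eq_mul_inv]; ring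
  have hlim : Filter.Tendsto (fun j : ℕ => η ^ j * m R.toSet + 2 * 2 ^ q * E / t ^ q * X)
      Filter.atTop (nhds (0 * m R.toSet + 2 * 2 ^ q * E / t ^ q * X)) := by
    refine Filter.Tendsto.add ?_ tendsto_const_nhds
    refine ENNReal.Tendsto.mul_const (ENNReal.tendsto_pow_atTop_nhds_zero_of_lt_one ?_) (Or.inr hmt)
    rw [hη]
    exact ENNReal.rpow_lt_one_of_one_lt_of_neg (by norm_num) (by linarith)
  have := ge_of_tendsto' hlim fun j => hiter j t ht0 htt
  simpa using this

/-- The weak-type bound for the full dyadic sum, which is at most three times the sparse sum with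
starting average `0`. -/
lemma measure_iSup_fullSum_gt_le (m ν : Measure (Fin d → ℝ)) (hm : m ≪ volume)
    (hν : ν ≪ volume) (H : (Fin d → ℝ) → ℝ≥0∞) {q θ : ℝ} (hq : 0 < q)
    (hθ : 1 ≤ θ) (E t : ℝ≥0∞) (ht0 : t ≠ 0) (htt : t ≠ ⊤) (R : Cube d)
    (hmt : m R.toSet ≠ ⊤)
    (h : ∀ t : ℝ≥0∞, t ≠ 0 → t ≠ ⊤ → ∀ (n : ℕ) (A : ℝ≥0∞) (S : Cube d), S.toSet ⊆ R.toSet →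
      m.restrict S.toSet
          {x | t < sparseSum H (fun S => ENNReal.ofReal S.side * lavg H S) n A S x} ≤
        2 ^ (-(q + 1)) * m S.toSet + E / t ^ q * ν S.toSet ^ θ) :
    m.restrict R.toSet
        {x | t < ⨆ n, fullSum (fun S => ENNReal.ofReal S.side * lavg H S) n R x} ≤
      2 * 6 ^ q * E / t ^ q * ν R.toSet ^ θ := by
  set c : Cube d → ℝ≥0∞ := fun S => ENNReal.ofReal S.side * lavg H S
  have hU : {x | t < ⨆ n, fullSum c n R x} = ⋃ n, {x | t < fullSum c n R x} := by
    ext x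
    rw [Set.mem_iUnion]
    exact lt_iSup_iff (f := fun n => fullSum c n R x)
  have hmono : Monotone fun n => {x | t < fullSum c n R x} :=
    fun i j hij x (hx : t < _) => hx.trans_le (fullSum_mono c R x hij)
  rw [hU, hmono.measure_iUnion]
  refine iSup_le fun n => ?_
  have h1 := measure_sparseSum_gt_le m ν hm hν H c hq hθ E (t / 3) (by simp [ht0])
    (ENNReal.div_ne_top htt (by simp)) n 0 R hmt h
  refine (measure_mono ?_).trans (h1.trans (le_of_eq ?_))
  · intro x (hx : t < _)
    change t / 3 < _
    have h2 := hx.trans_le (fullSum_le_sparseSum H n 0 R x)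
    rw [mul_zero, zero_mul, zero_add] at h2
    rwa [ENNReal.div_lt_iff (Or.inl (by simp)) (Or.inl (by simp)), mul_comm]
  · rw [ENNReal.div_rpow_of_nonneg _ _ hq.le, div_eq_mul_inv, ENNReal.inv_div]
    · have : (6 : ℝ≥0∞) ^ q = 2 ^ q * 3 ^ q := by
        rw [← ENNReal.mul_rpow_of_nonneg _ _ hq.le]; norm_num
      rw [this]
      simp only [div_eq_mul_inv]; ring
    · exact Or.inl (by simp)
    · exact Or.inl (by simp [ENNReal.rpow_eq_zero_iff])

/-! ### Consequences of the weight conditions -/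

/-- The measure on `Q` with density `u`. -/
noncomputable def weightMeasure (Q : Cube d) (u : (Fin d → ℝ) → ℝ≥0∞) : Measure (Fin d → ℝ) :=
  (volume.restrict Q.toSet).withDensity u

lemma weightMeasure_absolutelyContinuous (Q : Cube d) (u : (Fin d → ℝ) → ℝ≥0∞) :
    weightMeasure Q u ≪ volume :=
  (withDensity_absolutelyContinuous _ _).trans Measure.absolutelyContinuous_restrict

lemma weightMeasure_apply {Q R : Cube d} (hR : R.toSet ⊆ Q.toSet) (u : (Fin d → ℝ) → ℝ≥0∞) :
    weightMeasure Q u R.toSet = ∫⁻ x in R.toSet, u x := by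
  rw [weightMeasure, withDensity_apply _ R.measurableSet,
    Measure.restrict_restrict_of_subset hR]

lemma weightMeasure_restrict {Q R : Cube d} (hR : R.toSet ⊆ Q.toSet) (u : (Fin d → ℝ) → ℝ≥0∞) :
    (weightMeasure Q u).restrict R.toSet = (volume.restrict R.toSet).withDensity u := by
  rw [weightMeasure, restrict_withDensity R.measurableSet,
    Measure.restrict_restrict_of_subset hR]

lemma aemeasurable_mono {β : Type*} [MeasurableSpace β] {Q R : Cube d} (hR : R.toSet ⊆ Q.toSet)
    {u : (Fin d → ℝ) → β} (hu : AEMeasurable u (volume.restrict Q.toSet)) :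
    AEMeasurable u (volume.restrict R.toSet) :=
  hu.mono_measure (Measure.restrict_mono hR le_rfl)

lemma lintegral_weightMeasure {Q R : Cube d} (hR : R.toSet ⊆ Q.toSet) {u : (Fin d → ℝ) → ℝ≥0∞}
    (hu : AEMeasurable u (volume.restrict Q.toSet)) (hut : ∀ x ∈ Q.toSet, u x < ⊤)
    (F : (Fin d → ℝ) → ℝ≥0∞) :
    ∫⁻ x in R.toSet, F x ∂(weightMeasure Q u) = ∫⁻ x in R.toSet, F x * u x := by
  rw [weightMeasure_restrict hR,
    lintegral_withDensity_eq_lintegral_mul_non_measurable₀ _ (aemeasurable_mono hR hu)]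
  · simp only [Pi.mul_apply, mul_comm]
  · filter_upwards [ae_restrict_mem R.measurableSet] with x hx using hut x (hR hx)

lemma lintegral_cube_ne_zero {R : Cube d} {u : (Fin d → ℝ) → ℝ≥0∞}
    (hu : AEMeasurable u (volume.restrict R.toSet)) (h : ∀ x ∈ R.toSet, u x ≠ 0) :
    ∫⁻ x in R.toSet, u x ≠ 0 := by
  intro h0
  rw [lintegral_eq_zero_iff' hu] at h0
  have : ∀ᵐ x ∂(volume.restrict R.toSet), False := by
    filter_upwards [h0, ae_restrict_mem R.measurableSet] with x hx hxR using h x hxR hx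
  rw [Filter.eventually_false_iff_eq_bot, ae_eq_bot, Measure.restrict_eq_zero] at this
  exact R.vol_ne_zero this

lemma Cube.ofReal_side_eq (hd : 1 ≤ d) (R : Cube d) :
    ENNReal.ofReal R.side = R.vol ^ (1 / (d : ℝ)) := by
  rw [R.vol_eq, ← ENNReal.rpow_natCast, ← ENNReal.rpow_mul, mul_one_div_cancel, ENNReal.rpow_one]
  exact_mod_cast (by omega : d ≠ 0)

lemma conjExponent_ofReal {p : ℝ} (hp : 1 < p) :
    ENNReal.conjExponent (ENNReal.ofReal p) = ENNReal.ofReal (p / (p - 1)) := by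
  rw [ENNReal.conjExponent, ← ENNReal.ofReal_one, ← ENNReal.ofReal_sub _ (by norm_num),
    ← ENNReal.ofReal_inv_of_pos (by linarith),
    ← ENNReal.ofReal_add (by norm_num) (by simp; linarith)]
  congr 1
  have : p - 1 ≠ 0 := by linarith
  field_simp
  ring

lemma avgLp_ofReal {r : ℝ} (hr : 0 < r) (R : Cube d) (h : (Fin d → ℝ) → ℝ) :
    avgLp (ENNReal.ofReal r) R h =
      R.vol ^ (-(1 / r)) * (∫⁻ x in R.toSet, ‖h x‖ₑ ^ r) ^ (1 / r) := by
  rw [avgLp, eLpNorm_eq_lintegral_rpow_enorm_toReal (by simpa using hr) ENNReal.ofReal_ne_top,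
    ENNReal.toReal_ofReal hr.le, lintegral_smul_measure, smul_eq_mul,
    ENNReal.mul_rpow_of_nonneg _ _ (by positivity), ENNReal.inv_rpow, ENNReal.rpow_neg]

lemma avgLp_weight {Q R : Cube d} (hR : R.toSet ⊆ Q.toSet) {r : ℝ} (hr : 0 < r)
    {h : (Fin d → ℝ) → ℝ} (hh : ∀ x ∈ Q.toSet, 0 < h x) :
    avgLp (ENNReal.ofReal r) R h = R.vol ^ (-(1 / r)) *
      weightMeasure Q (fun x => ENNReal.ofReal (h x) ^ r) R.toSet ^ (1 / r) := by
  rw [avgLp_ofReal hr, weightMeasure_apply hR]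
  congr 2
  refine setLIntegral_congr_fun R.measurableSet fun x hx => ?_
  simp only [Real.enorm_of_nonneg (hh x (hR hx)).le]

/-- Hölder's inequality on a cube, in terms of the average of `σ⁻¹`. -/
lemma lavg_le {Q R : Cube d} (hR : R.toSet ⊆ Q.toSet) {p : ℝ} (hp : 1 ≤ p)
    {σ : (Fin d → ℝ) → ℝ} (hσ : IsWeight Q σ) {H : (Fin d → ℝ) → ℝ≥0∞}
    (hH : AEMeasurable H (volume.restrict Q.toSet)) :
    lavg H R ≤ R.vol ^ (-(1 / p)) *
      weightMeasure Q (fun x => H x ^ p * ENNReal.ofReal (σ x) ^ p) R.toSet ^ (1 / p) *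
      avgLp (ENNReal.conjExponent (ENNReal.ofReal p)) R (fun x => (σ x)⁻¹) := by
  have hp0 : 0 < p := by linarith
  have hσR := aemeasurable_mono hR hσ.1
  have hHR := aemeasurable_mono hR hH
  have hσ' : AEMeasurable (fun x => ENNReal.ofReal (σ x)⁻¹) (volume.restrict R.toSet) :=
    hσR.inv.ennreal_ofReal
  have hHσ : AEMeasurable (fun x => H x * ENNReal.ofReal (σ x)) (volume.restrict R.toSet) :=
    hHR.mul hσR.ennreal_ofReal
  have hcancel : ∀ x ∈ R.toSet, H x = H x * ENNReal.ofReal (σ x) * ENNReal.ofReal (σ x)⁻¹ := by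
    intro x hx
    have := hσ.2 x (hR hx)
    rw [mul_assoc, ← ENNReal.ofReal_mul this.le, mul_inv_cancel₀ this.ne', ENNReal.ofReal_one,
      mul_one]
  have hν : weightMeasure Q (fun x => H x ^ p * ENNReal.ofReal (σ x) ^ p) R.toSet =
      ∫⁻ x in R.toSet, (H x * ENNReal.ofReal (σ x)) ^ p := by
    rw [weightMeasure_apply hR]
    simp only [ENNReal.mul_rpow_of_nonneg _ _ hp0.le]
  rw [hν, lavg, setLIntegral_congr_fun R.measurableSet hcancel]
  have hv0 := R.vol_ne_zero
  have hvt := R.vol_ne_top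
  rcases hp.eq_or_lt with rfl | hp1
  · have hc : ENNReal.conjExponent (ENNReal.ofReal 1) = ⊤ := by
      simp [ENNReal.conjExponent]
    rw [hc, avgLp, eLpNorm_exponent_top]
    set M := eLpNormEssSup (fun x => (σ x)⁻¹) (R.vol⁻¹ • volume.restrict R.toSet) with hM
    have hle : ∀ᵐ x ∂(volume.restrict R.toSet), ENNReal.ofReal (σ x)⁻¹ ≤ M := by
      have hac : volume.restrict R.toSet ≪ R.vol⁻¹ • volume.restrict R.toSet :=
        Measure.absolutelyContinuous_smul (by simpa using hvt)
      filter_upwards [hac.ae_le (ae_le_eLpNormEssSup (f := fun x => (σ x)⁻¹)),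
        ae_restrict_mem R.measurableSet] with x hx hxR
      rwa [Real.enorm_of_nonneg (inv_nonneg.2 (hσ.2 x (hR hxR)).le)] at hx
    calc _ ≤ (∫⁻ x in R.toSet, H x * ENNReal.ofReal (σ x) * M) / R.vol := by
          gcongr ?_ / _
          refine lintegral_mono_ae ?_
          filter_upwards [hle] with x hx
          gcongr
      _ = _ := by
          rw [lintegral_mul_const'' _ hHσ]
          simp only [ENNReal.rpow_one, div_eq_mul_inv, inv_one, mul_one, ENNReal.rpow_neg]
          ring
  · have hc : p.HolderConjugate (p / (p - 1)) := Real.HolderConjugate.conjExponent hp1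
    have hsum : 1 / p + 1 / (p / (p - 1)) = 1 := by
      have := hc.inv_add_inv_eq_one; simpa using this
    have hH := ENNReal.lintegral_mul_le_Lp_mul_Lq _ hc hHσ hσ'
    rw [conjExponent_ofReal hp1, avgLp_weight hR (div_pos hp0 (by linarith)) (Q := Q)
      (fun x hx => inv_pos.2 (hσ.2 x hx)), weightMeasure_apply hR]
    have e : (R.vol)⁻¹ = R.vol ^ (-(1 / p)) * R.vol ^ (-(1 / (p / (p - 1)))) := by
      rw [← ENNReal.rpow_add _ _ hv0 hvt, ← neg_add, hsum, ENNReal.rpow_neg_one]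
    rw [div_eq_mul_inv, e]
    calc _ ≤ (∫⁻ x in R.toSet, (H x * ENNReal.ofReal (σ x)) ^ p) ^ (1 / p) *
          (∫⁻ x in R.toSet, ENNReal.ofReal (σ x)⁻¹ ^ (p / (p - 1))) ^ (1 / (p / (p - 1))) *
          (R.vol ^ (-(1 / p)) * R.vol ^ (-(1 / (p / (p - 1))))) := by
          gcongr; exact hH
      _ = _ := by ring

lemma le_apqChar {Q R : Cube d} (hR : R.toSet ⊆ Q.toSet) (p q α : ℝ) (ω σ : (Fin d → ℝ) → ℝ) :
    R.vol ^ α * avgLp (ENNReal.ofReal q) R ω *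
      avgLp (ENNReal.conjExponent (ENNReal.ofReal p)) R (fun x => (σ x)⁻¹) ≤
      apqChar Q p q α ω σ :=
  le_iSup₂ (f := fun (R : Cube d) (_ : R.toSet ⊆ Q.toSet) => R.vol ^ α *
    avgLp (ENNReal.ofReal q) R ω *
      avgLp (ENNReal.conjExponent (ENNReal.ofReal p)) R (fun x => (σ x)⁻¹)) R hR

/-- The basic estimate of one term of the sparse or dyadic sum. -/
lemma side_mul_lavg_mul_le (hd : 1 ≤ d) {Q R : Cube d} (hR : R.toSet ⊆ Q.toSet) {p q α ε : ℝ}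
    (hp : 1 ≤ p) (hq : 0 < q) (hε : ε = 1 / (d : ℝ) - (1 / p - 1 / q) - α)
    {ω σ : (Fin d → ℝ) → ℝ} (hω : IsWeight Q ω) (hσ : IsWeight Q σ) {H : (Fin d → ℝ) → ℝ≥0∞}
    (hH : AEMeasurable H (volume.restrict Q.toSet)) :
    ENNReal.ofReal R.side * lavg H R *
        weightMeasure Q (fun x => ENNReal.ofReal (ω x) ^ q) R.toSet ^ (1 / q) ≤
      apqChar Q p q α ω σ * R.vol ^ ε *
        weightMeasure Q (fun x => H x ^ p * ENNReal.ofReal (σ x) ^ p) R.toSet ^ (1 / p) := by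
  have h1 := lavg_le hR hp hσ hH
  have h2 := le_apqChar hR p q α ω σ
  rw [avgLp_weight hR hq hω.2] at h2
  have hv0 := R.vol_ne_zero
  have hvt := R.vol_ne_top
  set w := weightMeasure Q (fun x => ENNReal.ofReal (ω x) ^ q) R.toSet
  set ν := weightMeasure Q (fun x => H x ^ p * ENNReal.ofReal (σ x) ^ p) R.toSet
  set T := avgLp (ENNReal.conjExponent (ENNReal.ofReal p)) R (fun x => (σ x)⁻¹)
  have e : R.vol ^ (1 / (d : ℝ)) * R.vol ^ (-(1 / p)) =
      R.vol ^ ε * (R.vol ^ α * R.vol ^ (-(1 / q))) := by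
    simp only [← ENNReal.rpow_add _ _ hv0 hvt]
    congr 1; rw [hε]; ring
  rw [R.ofReal_side_eq hd]
  calc R.vol ^ (1 / (d : ℝ)) * lavg H R * w ^ (1 / q)
      ≤ R.vol ^ (1 / (d : ℝ)) * (R.vol ^ (-(1 / p)) * ν ^ (1 / p) * T) * w ^ (1 / q) := by
        gcongr
    _ = (R.vol ^ (1 / (d : ℝ)) * R.vol ^ (-(1 / p))) * (ν ^ (1 / p) * T * w ^ (1 / q)) := by ring
    _ = (R.vol ^ α * (R.vol ^ (-(1 / q)) * w ^ (1 / q)) * T) * R.vol ^ ε * ν ^ (1 / p) := by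
        rw [e]; ring
    _ ≤ _ := by gcongr

section Characteristic

variable {Q : Cube d} {p q α : ℝ} {ω σ : (Fin d → ℝ) → ℝ}

lemma weightMeasure_omega_ne_zero (hω : IsWeight Q ω) {R : Cube d} (hR : R.toSet ⊆ Q.toSet) :
    weightMeasure Q (fun x => ENNReal.ofReal (ω x) ^ q) R.toSet ≠ 0 := by
  rw [weightMeasure_apply hR]
  refine lintegral_cube_ne_zero ((aemeasurable_mono hR hω.1).ennreal_ofReal.pow_const q) ?_
  intro x hx
  have := hω.2 x (hR hx)
  simp [ENNReal.rpow_eq_zero_iff, this]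

lemma avgLp_ne_zero {r : ℝ≥0∞} (hr : r ≠ 0) {R : Cube d} {h : (Fin d → ℝ) → ℝ}
    (hm : AEMeasurable h (volume.restrict R.toSet)) (hh : ∀ x ∈ R.toSet, 0 < h x) :
    avgLp r R h ≠ 0 := by
  intro h0
  have hac : (R.vol⁻¹ • volume.restrict R.toSet) ≪ volume.restrict R.toSet :=
    Measure.smul_absolutelyContinuous
  rw [avgLp, eLpNorm_eq_zero_iff (hm.aestronglyMeasurable.mono_ac hac) hr,
    Filter.EventuallyEq] at h0
  replace h0 := (Measure.absolutelyContinuous_smul (μ := volume.restrict R.toSet)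
    (c := R.vol⁻¹) (by simpa using R.vol_ne_top)).ae_le h0
  have : ∀ᵐ x ∂(volume.restrict R.toSet), False := by
    filter_upwards [h0, ae_restrict_mem R.measurableSet] with x hx hxR using (hh x hxR).ne' hx
  rw [Filter.eventually_false_iff_eq_bot, ae_eq_bot, Measure.restrict_eq_zero] at this
  exact R.vol_ne_zero this

lemma avgLp_omega_ne_top (h : MemApq Q p q α ω σ) :
    avgLp (ENNReal.ofReal q) Q ω ≠ ⊤ := by
  intro h0
  have h1 := (le_apqChar (subset_refl Q.toSet) p q α ω σ).trans_lt h.2.2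
  rw [h0, ENNReal.mul_top, ENNReal.top_mul] at h1
  · exact absurd h1 (lt_irrefl _)
  · exact avgLp_ne_zero (by simp [ENNReal.conjExponent]) h.2.1.1.inv
      fun x hx => inv_pos.2 (h.2.1.2 x hx)
  · simp [ENNReal.rpow_eq_zero_iff, Q.vol_ne_zero, Q.vol_ne_top]

lemma avgLp_sigma_ne_top (h : MemApq Q p q α ω σ) (hq : 0 < q) :
    avgLp (ENNReal.conjExponent (ENNReal.ofReal p)) Q (fun x => (σ x)⁻¹) ≠ ⊤ := by
  intro h0
  have h1 := (le_apqChar (subset_refl Q.toSet) p q α ω σ).trans_lt h.2.2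
  rw [h0, ENNReal.mul_top] at h1
  · exact absurd h1 (lt_irrefl _)
  · refine mul_ne_zero ?_ (avgLp_ne_zero (by simpa using hq) h.1.1 h.1.2)
    simp [ENNReal.rpow_eq_zero_iff, Q.vol_ne_zero, Q.vol_ne_top]

lemma apqChar_ne_zero (h : MemApq Q p q α ω σ) (hq : 0 < q) : apqChar Q p q α ω σ ≠ 0 := by
  have h1 := le_apqChar (subset_refl Q.toSet) p q α ω σ
  intro h0
  rw [h0, nonpos_iff_eq_zero, mul_eq_zero, mul_eq_zero] at h1
  rcases h1 with (h1 | h1) | h1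
  · simp [ENNReal.rpow_eq_zero_iff, Q.vol_ne_zero, Q.vol_ne_top] at h1
  · exact avgLp_ne_zero (by simpa using hq) h.1.1 h.1.2 h1
  · exact avgLp_ne_zero (by simp [ENNReal.conjExponent]) h.2.1.1.inv
      (fun x hx => inv_pos.2 (h.2.1.2 x hx)) h1

lemma weightMeasure_omega_ne_top (h : MemApq Q p q α ω σ) (hq : 0 < q) {R : Cube d}
    (hR : R.toSet ⊆ Q.toSet) :
    weightMeasure Q (fun x => ENNReal.ofReal (ω x) ^ q) R.toSet ≠ ⊤ := by
  refine ne_top_of_le_ne_top ?_ (measure_mono hR)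
  have h1 := avgLp_omega_ne_top h
  rw [avgLp_weight subset_rfl hq h.1.2] at h1
  intro h0
  rw [h0, ENNReal.top_rpow_of_pos (by positivity), ENNReal.mul_top] at h1
  · exact h1 rfl
  · simp [ENNReal.rpow_eq_zero_iff, Q.vol_ne_zero, Q.vol_ne_top]

lemma weightMeasure_sigma_ne_top (h : MemApq Q p q α ω σ) (hp : 1 < p) (hq : 0 < q) {R : Cube d}
    (hR : R.toSet ⊆ Q.toSet) :
    weightMeasure Q (fun x => ENNReal.ofReal (σ x)⁻¹ ^ (p / (p - 1))) R.toSet ≠ ⊤ := by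
  refine ne_top_of_le_ne_top ?_ (measure_mono hR)
  have h1 := avgLp_sigma_ne_top h hq
  have hr : 0 < p / (p - 1) := div_pos (by linarith) (by linarith)
  rw [conjExponent_ofReal hp, avgLp_weight subset_rfl hr fun x hx => inv_pos.2 (h.2.1.2 x hx)] at h1
  intro h0
  rw [h0, ENNReal.top_rpow_of_pos (by positivity), ENNReal.mul_top] at h1
  · exact h1 rfl
  · simp [ENNReal.rpow_eq_zero_iff, Q.vol_ne_zero, Q.vol_ne_top]

/-- Functions with finite weighted norm are integrable on `Q`. -/
lemma lintegral_ne_top_of_weighted (h : MemApq Q p q α ω σ) (hp : 1 ≤ p) (hq : 0 < q)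
    {H : (Fin d → ℝ) → ℝ≥0∞} (hH : AEMeasurable H (volume.restrict Q.toSet))
    (hν : ∫⁻ x in Q.toSet, H x ^ p * ENNReal.ofReal (σ x) ^ p ≠ ⊤) :
    ∫⁻ x in Q.toSet, H x ≠ ⊤ := by
  rw [← lavg_mul_vol]
  refine ENNReal.mul_ne_top (ne_top_of_le_ne_top ?_ (lavg_le subset_rfl hp h.2.1 hH)) Q.vol_ne_top
  refine ENNReal.mul_ne_top (ENNReal.mul_ne_top ?_ ?_) (avgLp_sigma_ne_top h hq)
  · exact ENNReal.rpow_ne_top_of_ne_zero Q.vol_ne_zero Q.vol_ne_top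
  · rw [weightMeasure_apply subset_rfl]
    exact ENNReal.rpow_ne_top_of_nonneg (by positivity) hν

/-- In the critical case the characteristic controls `ℓ(R)^(1-d) μ(R)^(1/p') w(R)^(1/q)`. -/
lemma side_div_vol_mul_le (hd : 1 ≤ d) (h : MemApq Q p q α ω σ) (hp : 1 < p) (hq : 0 < q)
    (hε : 1 / (d : ℝ) - (1 / p - 1 / q) - α = 0) {R : Cube d} (hR : R.toSet ⊆ Q.toSet) :
    ENNReal.ofReal R.side / R.vol *
        weightMeasure Q (fun x => ENNReal.ofReal (σ x)⁻¹ ^ (p / (p - 1))) R.toSet ^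
          (1 / (p / (p - 1))) *
        weightMeasure Q (fun x => ENNReal.ofReal (ω x) ^ q) R.toSet ^ (1 / q) ≤
      apqChar Q p q α ω σ := by
  have h1 := le_apqChar hR p q α ω σ
  have hr : 0 < p / (p - 1) := div_pos (by linarith) (by linarith)
  rw [conjExponent_ofReal hp, avgLp_weight hR hr fun x hx => inv_pos.2 (h.2.1.2 x hx),
    avgLp_weight hR hq h.1.2] at h1
  refine le_trans (le_of_eq ?_) h1
  have hv0 := R.vol_ne_zero
  have hvt := R.vol_ne_top
  have e : ENNReal.ofReal R.side / R.vol =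
      R.vol ^ α * R.vol ^ (-(1 / q)) * R.vol ^ (-(1 / (p / (p - 1)))) := by
    rw [R.ofReal_side_eq hd, div_eq_mul_inv, ← ENNReal.rpow_neg_one]
    simp only [← ENNReal.rpow_add _ _ hv0 hvt]
    congr 1
    have : 1 / (p / (p - 1)) = 1 - 1 / p := by
      have hp0 : p ≠ 0 := by linarith
      field_simp
    rw [this]; linarith
  rw [e]; ring

end Characteristic

/-- The dyadic maximal function of a weight is controlled by its Fujii–Wilson characteristic. -/
lemma lintegral_pathMax_le {Q R : Cube d} (hR : R.toSet ⊆ Q.toSet) {q : ℝ}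
    {ω : (Fin d → ℝ) → ℝ} (hω : IsWeight Q ω)
    (hwt : weightMeasure Q (fun x => ENNReal.ofReal (ω x) ^ q) R.toSet ≠ ⊤) (n : ℕ) :
    ∫⁻ x in R.toSet, pathMax (fun S =>
        weightMeasure Q (fun x => ENNReal.ofReal (ω x) ^ q) S.toSet / S.vol) n R x ≤
      ainftyChar Q (fun x => ω x ^ q) *
        weightMeasure Q (fun x => ENNReal.ofReal (ω x) ^ q) R.toSet := by
  set w := weightMeasure Q (fun x => ENNReal.ofReal (ω x) ^ q) with hw
  have hw0 : w R.toSet ≠ 0 := weightMeasure_omega_ne_zero hω hR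
  have havg (S : Cube d) (hS : S.toSet ⊆ Q.toSet) :
      w S.toSet / S.vol = avgLp 1 S (fun x => ω x ^ q) := by
    have h1 := avgLp_ofReal one_pos S (fun x => ω x ^ q)
    rw [ENNReal.ofReal_one] at h1
    rw [h1, hw, weightMeasure_apply hS]
    simp only [div_one, ENNReal.rpow_one, ENNReal.rpow_neg_one, div_eq_mul_inv _ S.vol]
    rw [mul_comm]
    congr 1
    refine setLIntegral_congr_fun S.measurableSet fun x hx => ?_
    have hx0 := hω.2 x (hS hx)
    rw [Real.enorm_of_nonneg (Real.rpow_nonneg hx0.le _), ENNReal.ofReal_rpow_of_pos hx0]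
  have hpath (n : ℕ) : ∀ S : Cube d, S.toSet ⊆ R.toSet → ∀ x ∈ S.toSet,
      pathMax (fun S => w S.toSet / S.vol) n S x ≤
        ⨆ (S : Cube d) (_ : S.toSet ⊆ R.toSet),
          S.toSet.indicator (fun _ => avgLp 1 S (fun x => ω x ^ q)) x := by
    induction n with
    | zero => intro S _ x _; exact zero_le
    | succ n ih =>
      intro S hS x hx
      refine max_le ?_ (ih _ ((S.sel_subset x).trans hS) x (S.mem_sel hx))
      refine le_iSup₂_of_le S hS ?_
      rw [Set.indicator_of_mem hx]
      exact (havg S (hS.trans hR)).le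
  have hchar : (w R.toSet)⁻¹ * ∫⁻ x in R.toSet, ⨆ (S : Cube d) (_ : S.toSet ⊆ R.toSet),
      S.toSet.indicator (fun _ => avgLp 1 S (fun x => ω x ^ q)) x ≤
        ainftyChar Q (fun x => ω x ^ q) := by
    have h1 : w R.toSet = ∫⁻ x in R.toSet, ENNReal.ofReal (ω x ^ q) := by
      rw [hw, weightMeasure_apply hR]
      refine setLIntegral_congr_fun R.measurableSet fun x hx => ?_
      simp only [ENNReal.ofReal_rpow_of_pos (hω.2 x (hR hx))]
    rw [h1]
    exact le_iSup₂ (f := fun (R : Cube d) (_ : R.toSet ⊆ Q.toSet) =>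
      (∫⁻ x in R.toSet, ENNReal.ofReal (ω x ^ q))⁻¹ *
        ∫⁻ x in R.toSet, ⨆ (S : Cube d) (_ : S.toSet ⊆ R.toSet),
          S.toSet.indicator (fun _ => avgLp 1 S (fun x => ω x ^ q)) x) R hR
  calc _ ≤ ∫⁻ x in R.toSet, ⨆ (S : Cube d) (_ : S.toSet ⊆ R.toSet),
        S.toSet.indicator (fun _ => avgLp 1 S (fun x => ω x ^ q)) x :=
        setLIntegral_mono' R.measurableSet (hpath n R subset_rfl)
    _ = w R.toSet * ((w R.toSet)⁻¹ * ∫⁻ x in R.toSet, ⨆ (S : Cube d) (_ : S.toSet ⊆ R.toSet),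
        S.toSet.indicator (fun _ => avgLp 1 S (fun x => ω x ^ q)) x) := by
        rw [← mul_assoc, ENNReal.mul_inv_cancel hw0 hwt, one_mul]
    _ ≤ _ := by rw [mul_comm]; gcongr

lemma one_le_ainftyChar {Q : Cube d} {q : ℝ} {ω : (Fin d → ℝ) → ℝ} (hω : IsWeight Q ω)
    (hwt : weightMeasure Q (fun x => ENNReal.ofReal (ω x) ^ q) Q.toSet ≠ ⊤) :
    1 ≤ ainftyChar Q (fun x => ω x ^ q) := by
  have h1 := lintegral_pathMax_le subset_rfl hω hwt 1
  have hw0 := weightMeasure_omega_ne_zero (q := q) hω subset_rfl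
  simp only [pathMax, max_eq_left zero_le, lintegral_const, Measure.restrict_apply_univ] at h1
  change _ * Q.vol ≤ _ at h1
  rw [ENNReal.div_mul_cancel Q.vol_ne_zero Q.vol_ne_top] at h1
  refine (ENNReal.mul_le_mul_iff_left hw0 hwt).1 ?_
  rwa [one_mul]

/-! ### The dyadic fractional integral operator -/

lemma child_vol_rpow (R : Cube d) (e : Fin d → Bool) (ε : ℝ) :
    (R.child e).vol ^ ε = 2 ^ (-(d * ε)) * R.vol ^ ε := by
  rw [← R.child_vol e, ENNReal.mul_rpow_of_ne_top (by simp) (R.child e).vol_ne_top, ← mul_assoc,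
    ← ENNReal.rpow_natCast, ← ENNReal.rpow_mul, ← ENNReal.rpow_add _ _ (by simp) (by simp)]
  simp

/-- In the subcritical case the generations contribute a geometric series, summed here by
induction on the depth. -/
lemma lintegral_fullSum_rpow_le (m ν : Measure (Fin d → ℝ)) (hm : m ≪ volume) (hν : ν ≪ volume)
    (c : Cube d → ℝ≥0∞) {p q ε : ℝ} (hp : 1 ≤ p) (hpq : p ≤ q) (Ψ L : ℝ≥0∞)
    (hL : Ψ + L * 2 ^ (-(d * ε)) ≤ L) (n : ℕ) (R : Cube d)
    (h : ∀ S : Cube d, S.toSet ⊆ R.toSet →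
      c S * m S.toSet ^ (1 / q) ≤ Ψ * S.vol ^ ε * ν S.toSet ^ (1 / p)) :
    (∫⁻ x in R.toSet, fullSum c n R x ^ q ∂m) ^ (1 / q) ≤ L * R.vol ^ ε * ν R.toSet ^ (1 / p) := by
  have hp0 : 0 < p := by linarith
  have hq0 : 0 < q := by linarith
  induction n generalizing R with
  | zero => simp [fullSum, ENNReal.zero_rpow_of_pos hq0, hq0]
  | succ n ih =>
    have h1 := ENNReal.lintegral_Lp_add_le (μ := m.restrict R.toSet) (p := q)
      (f := fun _ => c R) (g := fun x => fullSum c n (R.sel x) x) aemeasurable_const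
      (measurable_comp_sel R _ (measurable_fullSum c n)).aemeasurable (by linarith)
    refine h1.trans ?_
    have h2 : (∫⁻ x in R.toSet, c R ^ q ∂m) ^ (1 / q) ≤ Ψ * R.vol ^ ε * ν R.toSet ^ (1 / p) := by
      rw [lintegral_const, Measure.restrict_apply_univ, ENNReal.mul_rpow_of_nonneg _ _ (by positivity),
        ← ENNReal.rpow_mul, mul_one_div_cancel hq0.ne', ENNReal.rpow_one]
      exact h R subset_rfl
    have h3 : (∫⁻ x in R.toSet, fullSum c n (R.sel x) x ^ q ∂m) ^ (1 / q) ≤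
        L * 2 ^ (-(d * ε)) * R.vol ^ ε * ν R.toSet ^ (1 / p) := by
      rw [lintegral_eq_sum_child m hm R (fun S x => fullSum c n S x ^ q)]
      have h4 (e) : ∫⁻ x in (R.child e).toSet, fullSum c n (R.child e) x ^ q ∂m ≤
          (L * 2 ^ (-(d * ε)) * R.vol ^ ε) ^ q * ν (R.child e).toSet ^ (q / p) := by
        have h5 := ENNReal.rpow_le_rpow
          (ih (R.child e) fun S hS => h S (hS.trans (R.child_subset e))) hq0.le
        rw [← ENNReal.rpow_mul, one_div_mul_cancel hq0.ne', ENNReal.rpow_one] at h5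
        refine h5.trans (le_of_eq ?_)
        rw [child_vol_rpow, ENNReal.mul_rpow_of_nonneg _ _ hq0.le, ← ENNReal.rpow_mul,
          one_div_mul_eq_div, ← mul_assoc]
      calc _ ≤ (∑ e, (L * 2 ^ (-(d * ε)) * R.vol ^ ε) ^ q * ν (R.child e).toSet ^ (q / p)) ^
              (1 / q) := by gcongr with e; exact h4 e
        _ ≤ ((L * 2 ^ (-(d * ε)) * R.vol ^ ε) ^ q * ν R.toSet ^ (q / p)) ^ (1 / q) := by
            rw [← Finset.mul_sum, measure_cube_eq_sum_child ν hν R]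
            gcongr
            exact sum_rpow_le_rpow_sum _ _ ((one_le_div hp0).2 hpq)
        _ = _ := by
            rw [ENNReal.mul_rpow_of_nonneg _ _ (by positivity), ← ENNReal.rpow_mul,
              ← ENNReal.rpow_mul, mul_one_div_cancel hq0.ne', ENNReal.rpow_one]
            congr 2; field_simp
    calc _ ≤ Ψ * R.vol ^ ε * ν R.toSet ^ (1 / p) +
          L * 2 ^ (-(d * ε)) * R.vol ^ ε * ν R.toSet ^ (1 / p) := add_le_add h2 h3
      _ = (Ψ + L * 2 ^ (-(d * ε))) * R.vol ^ ε * ν R.toSet ^ (1 / p) := by ring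
      _ ≤ _ := by gcongr

/-- The sum of the geometric series with ratio `2 ^ (-x)` is at most `2 / x`, stated as a fixed
point inequality. -/
lemma add_mul_two_rpow_le {x : ℝ} (hx0 : 0 < x) (hx1 : x ≤ 1) (Ψ : ℝ≥0∞) :
    Ψ + Ψ * ENNReal.ofReal (2 / x) * 2 ^ (-x) ≤ Ψ * ENNReal.ofReal (2 / x) := by
  have h1 : (2 : ℝ) ^ (-x) ≤ 1 - x / 2 := by
    have := rpow_one_add_le_one_add_mul_self (s := -(1 / 2)) (by norm_num) hx0.le hx1
    have e : (1 : ℝ) + -(1 / 2) = 2⁻¹ := by norm_num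
    rw [e, Real.inv_rpow (by norm_num), ← Real.rpow_neg (by norm_num)] at this
    linarith
  have h2 : (2 : ℝ≥0∞) ^ (-x) = ENNReal.ofReal (2 ^ (-x)) := by
    rw [← ENNReal.ofReal_rpow_of_pos (by norm_num)]; simp
  calc Ψ + Ψ * ENNReal.ofReal (2 / x) * 2 ^ (-x)
      = Ψ * (ENNReal.ofReal 1 + ENNReal.ofReal (2 / x) * ENNReal.ofReal (2 ^ (-x))) := by
        rw [h2, ENNReal.ofReal_one]; ring
    _ = Ψ * ENNReal.ofReal (1 + 2 / x * 2 ^ (-x)) := by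
        rw [← ENNReal.ofReal_mul (by positivity), ← ENNReal.ofReal_add (by norm_num) (by positivity)]
    _ ≤ _ := by
        gcongr
        calc 1 + 2 / x * 2 ^ (-x) ≤ 1 + 2 / x * (1 - x / 2) := by gcongr
          _ = 2 / x := by field_simp; ring

lemma lintegral_iSup_fullSum_rpow (m : Measure (Fin d → ℝ)) (c : Cube d → ℝ≥0∞) {q : ℝ}
    (hq : 0 < q) (R : Cube d) :
    ∫⁻ x in R.toSet, (⨆ n, fullSum c n R x) ^ q ∂m =
      ⨆ n, ∫⁻ x in R.toSet, fullSum c n R x ^ q ∂m := by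
  rw [← lintegral_iSup (fun n => (measurable_fullSum c n R).pow_const q)
    (fun i j hij x => ENNReal.rpow_le_rpow (fullSum_mono c R x hij) hq.le)]
  refine lintegral_congr fun x => ?_
  exact (ENNReal.orderIsoRpow q hq).map_iSup _

/-- The subcritical estimate for the dyadic fractional integral operator. -/
lemma subcritical_fullSum (hd : 1 ≤ d) {p q α ε : ℝ} (hp : 1 ≤ p) (hpq : p ≤ q) (hα : 0 ≤ α)
    (hε : ε = 1 / (d : ℝ) - (1 / p - 1 / q) - α) (hε0 : 0 < ε) (Q : Cube d)
    {ω σ : (Fin d → ℝ) → ℝ} (h : MemApq Q p q α ω σ) {H : (Fin d → ℝ) → ℝ≥0∞}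
    (hH : AEMeasurable H (volume.restrict Q.toSet)) :
    (∫⁻ x in Q.toSet, (⨆ n, fullSum (fun S => ENNReal.ofReal S.side * lavg H S) n Q x) ^ q
        ∂(weightMeasure Q fun x => ENNReal.ofReal (ω x) ^ q)) ^ (1 / q) ≤
      2 * apqChar Q p q α ω σ * (Q.vol ^ ε / ENNReal.ofReal ε) *
        weightMeasure Q (fun x => H x ^ p * ENNReal.ofReal (σ x) ^ p) Q.toSet ^ (1 / p) := by
  have hq0 : 0 < q := by linarith
  have hd0 : (0 : ℝ) < d := by exact_mod_cast hd
  have hd1 : (1 : ℝ) ≤ d := by exact_mod_cast hd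
  have hx1 : d * ε ≤ 1 := by
    have h1 : 1 / q ≤ 1 / p := one_div_le_one_div_of_le (by linarith) hpq
    have : ε ≤ 1 / d := by linarith
    calc d * ε ≤ d * (1 / d) := by gcongr
      _ = 1 := by field_simp
  rw [lintegral_iSup_fullSum_rpow _ _ hq0]
  have hiSup (u : ℕ → ℝ≥0∞) : (⨆ n, u n) ^ (1 / q) = ⨆ n, u n ^ (1 / q) :=
    (ENNReal.orderIsoRpow (1 / q) (by positivity)).map_iSup _
  rw [hiSup]
  refine iSup_le fun n => ?_
  refine (lintegral_fullSum_rpow_le _ _ (weightMeasure_absolutelyContinuous _ _)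
    (weightMeasure_absolutelyContinuous Q (fun x => H x ^ p * ENNReal.ofReal (σ x) ^ p)) _ hp hpq
    (apqChar Q p q α ω σ) _ (add_mul_two_rpow_le (by positivity) hx1 _) n Q
    (fun S hS => side_mul_lavg_mul_le hd hS hp hq0 hε h.1 h.2.1 hH)).trans ?_
  have hle : ENNReal.ofReal (2 / (d * ε)) ≤ 2 / ENNReal.ofReal ε := by
    rw [show (2 : ℝ≥0∞) = ENNReal.ofReal 2 by simp, ← ENNReal.ofReal_div_of_pos hε0]
    gcongr
    nlinarith
  calc _ ≤ apqChar Q p q α ω σ * (2 / ENNReal.ofReal ε) * Q.vol ^ ε * _ := by gcongr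
    _ = _ := by simp only [div_eq_mul_inv]; ring

/-- The critical weak-type estimate for the dyadic fractional integral operator. For `1 < p < q`
the integral of the sparse sum is estimated by duality and the testing condition; otherwise the
maximal function and the packing of the principal cubes are used. -/
lemma exists_critical_fullSum (hd : 1 ≤ d) {p q : ℝ} (hp : 1 ≤ p) (hpq : p ≤ q) :
    ∃ C : ℝ≥0, ∀ α : ℝ, 0 ≤ α → α < 1 / q + (1 - 1 / p) →
      1 / (d : ℝ) - (1 / p - 1 / q) - α = 0 →
      ∀ (Q : Cube d) (ω σ : (Fin d → ℝ) → ℝ), MemApq Q p q α ω σ →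
      ainftyChar Q (fun x => ω x ^ q) < ⊤ →
      ∀ H : (Fin d → ℝ) → ℝ≥0∞, AEMeasurable H (volume.restrict Q.toSet) →
      ∫⁻ x in Q.toSet, H x ≠ ⊤ → ∀ t : ℝ≥0∞, t ≠ 0 → t ≠ ⊤ →
      (weightMeasure Q fun x => ENNReal.ofReal (ω x) ^ q).restrict Q.toSet
          {x | t < ⨆ n, fullSum (fun S => ENNReal.ofReal S.side * lavg H S) n Q x} ≤
        (C * apqChar Q p q α ω σ *
          ainftyChar Q (fun x => ω x ^ q) ^ (if 1 < p ∧ p < q then 1 - 1 / p else 1) / t) ^ q *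
        weightMeasure Q (fun x => H x ^ p * ENNReal.ofReal (σ x) ^ p) Q.toSet ^ (q / p) := by
  have hp0 : 0 < p := by linarith
  have hq0 : 0 < q := by linarith
  have hq1 : 1 ≤ q := by linarith
  have hθ : 1 ≤ q / p := (one_le_div hp0).2 hpq
  set η : ℝ≥0∞ := 2 ^ (-(q + 1)) with hη
  have hη0 : η ≠ 0 := by simp [hη, ENNReal.rpow_eq_zero_iff]
  have hηt : η ≠ ⊤ := by rw [hη]; exact ENNReal.rpow_ne_top_of_ne_zero (by simp) (by simp)
  have hηinv : η⁻¹ = ((2 ^ (q + 1) : ℝ≥0) : ℝ≥0∞) := by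
    rw [hη, ENNReal.rpow_neg, inv_inv, ENNReal.coe_rpow_of_nonneg _ (by linarith)]; rfl
  -- It suffices to have the localized tail bound with the constant `(X / η) ^ q`.
  have hsuff (m ν : Measure (Fin d → ℝ)) (hm : m ≪ volume) (hν : ν ≪ volume)
      (H : (Fin d → ℝ) → ℝ≥0∞) (X t : ℝ≥0∞) (ht0 : t ≠ 0) (htt : t ≠ ⊤) (Q : Cube d)
      (hmt : m Q.toSet ≠ ⊤)
      (h : ∀ t : ℝ≥0∞, t ≠ 0 → t ≠ ⊤ → ∀ (n : ℕ) (A : ℝ≥0∞) (S : Cube d), S.toSet ⊆ Q.toSet →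
        m.restrict S.toSet
            {x | t < sparseSum H (fun S => ENNReal.ofReal S.side * lavg H S) n A S x} ≤
          η * m S.toSet + (X / η) ^ q / t ^ q * ν S.toSet ^ (q / p)) :
      m.restrict Q.toSet
          {x | t < ⨆ n, fullSum (fun S => ENNReal.ofReal S.side * lavg H S) n Q x} ≤
        (12 * (2 ^ (q + 1) : ℝ≥0) * X / t) ^ q * ν Q.toSet ^ (q / p) := by
    refine (measure_iSup_fullSum_gt_le m ν hm hν H hq0 hθ _ t ht0 htt Q hmt h).trans ?_
    refine mul_le_mul_left ?_ _
    rw [← hηinv, ENNReal.div_rpow_of_nonneg (12 * η⁻¹ * X) t hq0.le]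
    refine ENNReal.div_le_div_right ?_ _
    have h2 : (2 : ℝ≥0∞) ≤ 2 ^ q := by
      calc (2 : ℝ≥0∞) = 2 ^ (1 : ℝ) := by simp
        _ ≤ 2 ^ q := ENNReal.rpow_le_rpow_of_exponent_le (by norm_num) hq1
    calc 2 * 6 ^ q * (X / η) ^ q ≤ 2 ^ q * 6 ^ q * (X / η) ^ q := by gcongr
      _ = _ := by
        rw [← ENNReal.mul_rpow_of_nonneg _ _ hq0.le, ← ENNReal.mul_rpow_of_nonneg _ _ hq0.le]
        congr 1
        rw [div_eq_mul_inv]; ring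
  by_cases hcase : 1 < p ∧ p < q
  · obtain ⟨hp1, hpq'⟩ := hcase
    set r := p / (p - 1) with hr
    have hconj : p.HolderConjugate r := Real.HolderConjugate.conjExponent hp1
    have hr1 : 1 < r := hconj.symm.lt
    have hr0 : 0 < r := by linarith
    have hrp : 1 / r = 1 - 1 / p := by
      have := hconj.inv_add_inv_eq_one
      simp only [one_div]; linarith
    by_cases hd2 : 2 ≤ d
    swap
    · refine ⟨0, fun α _ hα h0 => ?_⟩
      -- In dimension one the hypotheses on `α` are contradictory.
      exfalso
      have : d = 1 := by omega
      subst this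
      norm_num at h0
      simp only [one_div] at hα
      linarith
    obtain ⟨C, hC⟩ := exists_lintegral_sparseSum_rpow_le d hd2 (q := q) (r := r) hr1 (by linarith)
      (by rw [hrp]; have := one_div_lt_one_div_of_lt hp0 hpq'; linarith)
    refine ⟨12 * 2 ^ (q + 1) * (C ^ (1 / r) * 2 ^ (1 / r)), ?_⟩
    intro α hα0 hα hε Q ω σ h hA H hH hHt t ht0 htt
    rw [if_pos ⟨hp1, hpq'⟩, ← hrp]
    set m := weightMeasure Q fun x => ENNReal.ofReal (ω x) ^ q with hm
    set μ := weightMeasure Q fun x => ENNReal.ofReal (σ x)⁻¹ ^ r with hμ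
    set ν := weightMeasure Q (fun x => H x ^ p * ENNReal.ofReal (σ x) ^ p) with hν
    set Ψ := apqChar Q p q α ω σ
    set a := ainftyChar Q (fun x => ω x ^ q)
    have hmac : m ≪ volume := weightMeasure_absolutelyContinuous _ _
    have hσ' : AEMeasurable (fun x => ENNReal.ofReal (σ x)⁻¹) (volume.restrict Q.toSet) :=
      h.2.1.1.inv.ennreal_ofReal
    have hpack (n : ℕ) (A : ℝ≥0∞) (S : Cube d) (hS : S.toSet ⊆ Q.toSet) :
        ∫⁻ x in S.toSet, sparseSum H (fun _ => 1) n A S x ∂m ≤ 2 * a * m S.toSet := by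
      have hmS := weightMeasure_omega_ne_top h hq0 hS
      refine (lintegral_sparseSum_one_le m hmac H n A S hmS
        (ne_top_of_le_ne_top hHt (lintegral_mono_set hS))).trans ?_
      rw [mul_assoc]
      gcongr
      exact lintegral_pathMax_le hS h.1 hmS n
    have h1 := hsuff m ν hmac (weightMeasure_absolutelyContinuous _ _) H
      (C ^ (1 / r) * 2 ^ (1 / r) * Ψ * a ^ (1 / r)) t ht0 htt Q
      (weightMeasure_omega_ne_top h hq0 subset_rfl) ?_
    · refine h1.trans (le_of_eq ?_)
      congr 3
      push_cast
      rw [ENNReal.coe_rpow_of_nonneg C (by positivity : 0 ≤ 1 / r),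
        ENNReal.coe_rpow_of_nonneg (2 : ℝ≥0) (by positivity : 0 ≤ 1 / r)]
      push_cast
      ring
    · intro t ht0 htt n A S hS
      have hmS := weightMeasure_omega_ne_top h hq0 hS
      have htest := hC m μ hmac (weightMeasure_absolutelyContinuous _ _) H Ψ (2 * a) n A S
        (fun T hT => ⟨weightMeasure_omega_ne_zero h.1 (hT.trans hS),
          weightMeasure_omega_ne_top h hq0 (hT.trans hS), by
            rw [hμ, weightMeasure_apply (hT.trans hS)]
            refine lintegral_cube_ne_zero ((aemeasurable_mono (hT.trans hS) hσ').pow_const r) ?_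
            intro x hx
            have := h.2.1.2 x (hS (hT hx))
            simp [ENNReal.rpow_eq_zero_iff, this],
          weightMeasure_sigma_ne_top h hp1 hq0 (hT.trans hS)⟩)
        (fun T hT => side_div_vol_mul_le hd h hp1 hq0 hε (hT.trans hS)) (hpack n A S hS)
      have hint : ∫⁻ x in S.toSet,
          sparseSum H (fun S => ENNReal.ofReal S.side * lavg H S) n A S x ∂m ≤
          (C ^ (1 / r) * 2 ^ (1 / r) * Ψ * a ^ (1 / r)) * ν S.toSet ^ (1 / p) *
            m S.toSet ^ (1 - 1 / q) := by
        rw [lintegral_sparseSum_eq m hmac H n A S (aemeasurable_mono hS hH)]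
        set B := sparseSum H (fun S => ENNReal.ofReal S.side / S.vol * m S.toSet) n A S with hB
        have hBm : Measurable B := measurable_sparseSum _ _ _ _ _
        have hHσ : AEMeasurable (fun x => H x * ENNReal.ofReal (σ x)) (volume.restrict S.toSet) :=
          (aemeasurable_mono hS hH).mul (aemeasurable_mono hS h.2.1.1).ennreal_ofReal
        have hBσ : AEMeasurable (fun x => B x * ENNReal.ofReal (σ x)⁻¹)
            (volume.restrict S.toSet) := hBm.aemeasurable.mul (aemeasurable_mono hS hσ')
        have hhol := ENNReal.lintegral_mul_le_Lp_mul_Lq _ hconj hHσ hBσ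
        have e1 : ∫⁻ x in S.toSet, (H x * ENNReal.ofReal (σ x)) ^ p = ν S.toSet := by
          rw [hν, weightMeasure_apply hS]
          simp only [ENNReal.mul_rpow_of_nonneg _ _ hp0.le]
        have e2 : ∫⁻ x in S.toSet, (B x * ENNReal.ofReal (σ x)⁻¹) ^ r =
            ∫⁻ x in S.toSet, B x ^ r ∂μ := by
          rw [hμ, lintegral_weightMeasure hS (hσ'.pow_const r)
            (fun x _ => ENNReal.rpow_lt_top_of_nonneg hr0.le ENNReal.ofReal_ne_top)]
          simp only [ENNReal.mul_rpow_of_nonneg _ _ hr0.le]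
        have e3 : ∫⁻ x in S.toSet, H x * B x = ∫⁻ x in S.toSet,
            ((fun x => H x * ENNReal.ofReal (σ x)) * fun x => B x * ENNReal.ofReal (σ x)⁻¹) x := by
          refine setLIntegral_congr_fun S.measurableSet fun x hx => ?_
          have hx0 := h.2.1.2 x (hS hx)
          have : ENNReal.ofReal (σ x) * ENNReal.ofReal (σ x)⁻¹ = 1 := by
            rw [← ENNReal.ofReal_mul hx0.le, mul_inv_cancel₀ hx0.ne', ENNReal.ofReal_one]
          calc H x * B x = H x * B x * (ENNReal.ofReal (σ x) * ENNReal.ofReal (σ x)⁻¹) := by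
                rw [this, mul_one]
            _ = (H x * ENNReal.ofReal (σ x)) * (B x * ENNReal.ofReal (σ x)⁻¹) := by ring
        rw [e3]
        refine hhol.trans ?_
        rw [e1, e2]
        have h5 := ENNReal.rpow_le_rpow htest (by positivity : 0 ≤ 1 / r)
        calc _ ≤ ν S.toSet ^ (1 / p) *
              (C * Ψ ^ r * (2 * a) * m S.toSet ^ (r * (1 - 1 / q))) ^ (1 / r) := by gcongr
          _ = _ := by
            have hr' : (0 : ℝ) ≤ 1 / r := by positivity
            rw [ENNReal.mul_rpow_of_nonneg _ _ hr', ENNReal.mul_rpow_of_nonneg _ _ hr',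
              ENNReal.mul_rpow_of_nonneg _ _ hr', ENNReal.mul_rpow_of_nonneg _ _ hr',
              ← ENNReal.rpow_mul, ← ENNReal.rpow_mul, mul_one_div_cancel hr0.ne',
              ENNReal.rpow_one, show r * (1 - 1 / q) * (1 / r) = 1 - 1 / q by field_simp]
            ring
      have h6 := measure_sparseSum_gt_le_of_lintegral m H _ hq1 η _ t hη0 hηt ht0 htt n A S
        (weightMeasure_omega_ne_zero h.1 hS) hmS hint
      refine h6.trans (add_le_add_right (le_of_eq ?_) _)
      set X := (C : ℝ≥0∞) ^ (1 / r) * 2 ^ (1 / r) * Ψ * a ^ (1 / r)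
      calc (X * ν S.toSet ^ (1 / p) / (η * t)) ^ q =
            (X / η / t * ν S.toSet ^ (1 / p)) ^ q := by
            congr 1
            simp only [div_eq_mul_inv]
            rw [ENNReal.mul_inv (Or.inl hη0) (Or.inl hηt)]; ring
        _ = _ := by
            rw [ENNReal.mul_rpow_of_nonneg _ _ hq0.le, ENNReal.div_rpow_of_nonneg _ _ hq0.le,
              ← ENNReal.rpow_mul, one_div_mul_eq_div]
  · refine ⟨24 * 2 ^ (q + 1), ?_⟩
    intro α hα0 hα hε Q ω σ h hA H hH hHt t ht0 htt
    rw [if_neg hcase, ENNReal.rpow_one]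
    set m := weightMeasure Q fun x => ENNReal.ofReal (ω x) ^ q with hm
    set ν := weightMeasure Q (fun x => H x ^ p * ENNReal.ofReal (σ x) ^ p) with hν
    set Ψ := apqChar Q p q α ω σ
    set a := ainftyChar Q (fun x => ω x ^ q)
    have hmac : m ≪ volume := weightMeasure_absolutelyContinuous _ _
    have ha0 : a ≠ 0 := (zero_lt_one.trans_le
      (one_le_ainftyChar h.1 (weightMeasure_omega_ne_top h hq0 subset_rfl))).ne'
    have h1 := hsuff m ν hmac (weightMeasure_absolutelyContinuous _ _) H (2 * a * Ψ) t ht0 htt Q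
      (weightMeasure_omega_ne_top h hq0 subset_rfl) ?_
    · refine h1.trans (le_of_eq ?_)
      congr 3
      push_cast
      ring
    · intro t ht0 htt n A S hS
      have hmS := weightMeasure_omega_ne_top h hq0 hS
      have hpack : ∫⁻ x in S.toSet, sparseSum H (fun _ => 1) n A S x ∂m ≤ 2 * a * m S.toSet := by
        refine (lintegral_sparseSum_one_le m hmac H n A S hmS
          (ne_top_of_le_ne_top hHt (lintegral_mono_set hS))).trans ?_
        rw [mul_assoc]
        gcongr
        exact lintegral_pathMax_le hS h.1 hmS n
      have h2 := measure_sparseSum_gt_le_of_packing m ν hmac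
        (weightMeasure_absolutelyContinuous _ _) H
        (fun S => ENNReal.ofReal S.side * lavg H S) hq0 hθ η (Ψ ^ q) (2 * a) t hη0 hηt
        (mul_ne_zero (by simp) ha0) (ENNReal.mul_ne_top (by simp) hA.ne) ht0 htt n A S
        (fun T hT => ?_) hpack
      · refine h2.trans (le_of_eq ?_)
        rw [← ENNReal.mul_rpow_of_nonneg _ _ hq0.le]
        simp only [div_eq_mul_inv]
        congr 4
        ring
      · have h3 := ENNReal.rpow_le_rpow (side_mul_lavg_mul_le hd (hT.trans hS) hp hq0 hε.symm h.1
          h.2.1 hH) hq0.le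
        rw [ENNReal.rpow_zero, mul_one, ENNReal.mul_rpow_of_nonneg _ _ hq0.le,
          ENNReal.mul_rpow_of_nonneg Ψ _ hq0.le, ← ENNReal.rpow_mul, ← ENNReal.rpow_mul,
          one_div_mul_cancel hq0.ne', ENNReal.rpow_one, one_div_mul_eq_div] at h3
        exact h3

/-! ### The Poincaré inequality for smooth functions -/

lemma lintegral_comp_smul_add {h : (Fin d → ℝ) → ℝ≥0∞} (hh : Measurable h) {t : ℝ} (ht : t ≠ 0)
    (v : Fin d → ℝ) :
    ∫⁻ x, h (t • x + v) = ENNReal.ofReal (|t ^ d|⁻¹) * ∫⁻ x, h x := by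
  have h1 : ∫⁻ x, h (t • x + v) = ∫⁻ z, h (z + v) ∂(Measure.map (fun x => t • x) volume) := by
    rw [lintegral_map (f := fun z => h (z + v)) (hh.comp (measurable_add_const v))
      (measurable_const_smul t)]
  rw [h1, Measure.map_addHaar_smul volume ht, lintegral_smul_measure,
    lintegral_add_right_eq_self (fun z => h z) v]
  simp [abs_inv]

/-- The average of `h` over the segments with parameter `t` between the points of `R`. -/
lemma lintegral_segment_le (R : Cube d) {h : (Fin d → ℝ) → ℝ≥0∞} (hh : Measurable h) {t : ℝ}
    (ht : t ∈ Set.Icc (0 : ℝ) 1) :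
    ∫⁻ x in R.toSet, ∫⁻ y in R.toSet, h (y + t • (x - y)) ≤
      2 ^ d * R.vol * ∫⁻ z in R.toSet, h z := by
  -- The change of variables is made in the endpoint that is closer to the point on the segment.
  have key (t : ℝ) (ht : 1 / 2 ≤ t) (ht1 : t ≤ 1) (y : Fin d → ℝ) (hy : y ∈ R.toSet) :
      ∫⁻ x in R.toSet, h (t • x + (1 - t) • y) ≤ 2 ^ d * ∫⁻ z in R.toSet, h z := by
    have ht0 : 0 < t := by linarith
    calc ∫⁻ x in R.toSet, h (t • x + (1 - t) • y)
        ≤ ∫⁻ x in R.toSet, R.toSet.indicator h (t • x + (1 - t) • y) := by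
          refine setLIntegral_mono' R.measurableSet fun x hx => ?_
          rw [Set.indicator_of_mem]
          exact R.convex hx hy ht0.le (by linarith) (by ring)
      _ ≤ ∫⁻ x, R.toSet.indicator h (t • x + (1 - t) • y) := setLIntegral_le_lintegral _ _
      _ = ENNReal.ofReal (|t ^ d|⁻¹) * ∫⁻ z in R.toSet, h z := by
          rw [lintegral_comp_smul_add (hh.indicator R.measurableSet) ht0.ne',
            lintegral_indicator R.measurableSet]
      _ ≤ _ := by
          gcongr
          rw [abs_of_pos (by positivity), ← inv_pow]
          calc ENNReal.ofReal (t⁻¹ ^ d) ≤ ENNReal.ofReal (2 ^ d) := by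
                gcongr
                rw [inv_le_comm₀ ht0 (by norm_num)]; linarith
            _ = 2 ^ d := by rw [ENNReal.ofReal_pow (by norm_num)]; simp
  have hconst : ∫⁻ _ in R.toSet, 2 ^ d * ∫⁻ z in R.toSet, h z =
      2 ^ d * R.vol * ∫⁻ z in R.toSet, h z := by
    rw [lintegral_const, Measure.restrict_apply_univ, Cube.vol]; ring
  rcases le_total (1 / 2) t with h2 | h2
  · rw [lintegral_lintegral_swap (by fun_prop), ← hconst]
    refine setLIntegral_mono' R.measurableSet fun y hy => ?_
    refine le_trans (le_of_eq ?_) (key t h2 ht.2 y hy)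
    refine lintegral_congr fun x => ?_
    congr 1; ext i; simp; ring
  · rw [← hconst]
    refine setLIntegral_mono' R.measurableSet fun x hx => ?_
    refine le_trans (le_of_eq ?_) (key (1 - t) (by linarith) (by linarith [ht.1]) x hx)
    refine lintegral_congr fun y => ?_
    congr 1; ext i; simp; ring

/-- The `L¹` Poincaré inequality on a cube for continuously differentiable functions. -/
lemma poincare_of_contDiff {F : Type*} [NormedAddCommGroup F] [NormedSpace ℝ F] [CompleteSpace F]
    {u : (Fin d → ℝ) → F} (hu : ContDiff ℝ 1 u) (R : Cube d) :
    ∫⁻ x in R.toSet, ∫⁻ y in R.toSet, ‖u x - u y‖ₑ ≤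
      2 ^ d * ENNReal.ofReal R.side * R.vol * ∫⁻ z in R.toSet, ‖fderiv ℝ u z‖ₑ := by
  set h : (Fin d → ℝ) → ℝ≥0∞ := fun z => ‖fderiv ℝ u z‖ₑ with hh
  have hDc : Continuous (fderiv ℝ u) := hu.continuous_fderiv one_ne_zero
  have hhm : Measurable h := hDc.enorm.measurable
  have hpt : ∀ x ∈ R.toSet, ∀ y ∈ R.toSet, ‖u x - u y‖ₑ ≤
      ENNReal.ofReal R.side * ∫⁻ t in Set.Ioc (0 : ℝ) 1, h (y + t • (x - y)) := by
    intro x hx y hy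
    have hder (t : ℝ) : HasDerivAt (fun t : ℝ => u (y + t • (x - y)))
        (fderiv ℝ u (y + t • (x - y)) (x - y)) t := by
      have h1 : HasDerivAt (fun t : ℝ => y + t • (x - y)) (x - y) t := by
        simpa using ((hasDerivAt_id t).smul_const (x - y)).const_add y
      exact ((hu.differentiable one_ne_zero) _).hasFDerivAt.comp_hasDerivAt t h1
    have hc : Continuous fun t : ℝ => fderiv ℝ u (y + t • (x - y)) (x - y) := by fun_prop
    have hftc := intervalIntegral.integral_eq_sub_of_hasDerivAt (a := 0) (b := 1)
      (fun t _ => hder t) (hc.intervalIntegrable 0 1)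
    simp only [one_smul, zero_smul, add_zero, add_sub_cancel] at hftc
    have hxy : ‖x - y‖ₑ ≤ ENNReal.ofReal R.side := by
      rw [← ofReal_norm]
      refine ENNReal.ofReal_le_ofReal ((pi_norm_le_iff_of_nonneg R.side_pos.le).2 fun i => ?_)
      have h1 := hx i
      have h2 := hy i
      rw [Pi.sub_apply, Real.norm_eq_abs, abs_le]
      constructor <;> linarith [h1.1, h1.2, h2.1, h2.2]
    rw [← hftc, intervalIntegral.integral_of_le zero_le_one,
      ← lintegral_const_mul _ (by fun_prop)]
    refine (enorm_integral_le_lintegral_enorm _).trans (lintegral_mono fun t => ?_)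
    refine (ContinuousLinearMap.le_opENorm _ _).trans ?_
    rw [mul_comm]
    gcongr
  calc _ ≤ ∫⁻ x in R.toSet, ∫⁻ y in R.toSet,
        ENNReal.ofReal R.side * ∫⁻ t in Set.Ioc (0 : ℝ) 1, h (y + t • (x - y)) :=
        setLIntegral_mono' R.measurableSet fun x hx =>
          setLIntegral_mono' R.measurableSet fun y hy => hpt x hx y hy
    _ = ENNReal.ofReal R.side * ∫⁻ t in Set.Ioc (0 : ℝ) 1, ∫⁻ x in R.toSet, ∫⁻ y in R.toSet,
          h (y + t • (x - y)) := by
        have e1 (x : Fin d → ℝ) : ∫⁻ y in R.toSet,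
            ENNReal.ofReal R.side * ∫⁻ t in Set.Ioc (0 : ℝ) 1, h (y + t • (x - y)) =
            ENNReal.ofReal R.side * ∫⁻ t in Set.Ioc (0 : ℝ) 1, ∫⁻ y in R.toSet,
              h (y + t • (x - y)) := by
          rw [lintegral_const_mul' _ _ ENNReal.ofReal_ne_top, lintegral_lintegral_swap (by fun_prop)]
        simp only [e1]
        rw [lintegral_const_mul' _ _ ENNReal.ofReal_ne_top, lintegral_lintegral_swap]
        have : Measurable fun q : ((Fin d → ℝ) × ℝ) × (Fin d → ℝ) =>
          h (q.2 + q.1.2 • (q.1.1 - q.2)) := by fun_prop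
        exact (this.lintegral_prod_right' (ν := volume.restrict R.toSet)).aemeasurable
    _ ≤ ENNReal.ofReal R.side * ∫⁻ t in Set.Ioc (0 : ℝ) 1,
          2 ^ d * R.vol * ∫⁻ z in R.toSet, h z := by
        refine mul_le_mul_right ?_ _
        exact setLIntegral_mono' measurableSet_Ioc fun t ht =>
          lintegral_segment_le R hhm ⟨ht.1.le, ht.2⟩
    _ = _ := by
        rw [lintegral_const, Measure.restrict_apply_univ]
        simp only [Real.volume_Ioc, sub_zero, ENNReal.ofReal_one, mul_one]
        ring

/-! ### Domination of the oscillation by the dyadic fractional integral -/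

section Average

variable {F : Type*} [NormedAddCommGroup F] [NormedSpace ℝ F] [CompleteSpace F]

lemma enorm_sub_average_le {v : (Fin d → ℝ) → F} (R : Cube d) (hv : IntegrableOn v R.toSet)
    (c : F) : ‖c - ⨍ y in R.toSet, v y‖ₑ ≤ R.vol⁻¹ * ∫⁻ y in R.toSet, ‖c - v y‖ₑ := by
  have : IsProbabilityMeasure (R.vol⁻¹ • volume.restrict R.toSet) := ⟨by
    rw [Measure.smul_apply, Measure.restrict_apply_univ, smul_eq_mul]
    exact ENNReal.inv_mul_cancel R.vol_ne_zero R.vol_ne_top⟩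
  have hv' : Integrable v (R.vol⁻¹ • volume.restrict R.toSet) :=
    hv.smul_measure (ENNReal.inv_ne_top.2 R.vol_ne_zero)
  have h1 : c - ⨍ y in R.toSet, v y = ∫ y, (c - v y) ∂(R.vol⁻¹ • volume.restrict R.toSet) := by
    rw [integral_sub (integrable_const c) hv', integral_const, probReal_univ, one_smul,
      average, Measure.restrict_apply_univ]
    rfl
  rw [h1, ← smul_eq_mul, ← lintegral_smul_measure]
  exact enorm_integral_le_lintegral_enorm _

lemma enorm_average_sub_average_le {v : (Fin d → ℝ) → F} (R S : Cube d)
    (hvR : IntegrableOn v R.toSet) (hvS : IntegrableOn v S.toSet) :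
    ‖(⨍ x in R.toSet, v x) - ⨍ y in S.toSet, v y‖ₑ ≤
      R.vol⁻¹ * (S.vol⁻¹ * ∫⁻ x in R.toSet, ∫⁻ y in S.toSet, ‖v x - v y‖ₑ) := by
  rw [← enorm_neg, neg_sub]
  refine (enorm_sub_average_le R hvR _).trans ?_
  gcongr
  rw [← lintegral_const_mul' _ _ (ENNReal.inv_ne_top.2 S.vol_ne_zero)]
  refine lintegral_mono fun x => ?_
  rw [← enorm_neg, neg_sub]
  exact enorm_sub_average_le S hvS _

/-- The `n`-th dyadic cube containing `x`, starting from `R`. -/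
noncomputable def path : ℕ → Cube d → (Fin d → ℝ) → Cube d
  | 0, R, _ => R
  | n + 1, R, x => path n (R.sel x) x

lemma path_subset (n : ℕ) (R : Cube d) (x : Fin d → ℝ) : (path n R x).toSet ⊆ R.toSet := by
  induction n generalizing R with
  | zero => exact subset_rfl
  | succ n ih => exact (ih _).trans (R.sel_subset x)

lemma mem_path (n : ℕ) (R : Cube d) {x : Fin d → ℝ} (hx : x ∈ R.toSet) :
    x ∈ (path n R x).toSet := by
  induction n generalizing R with
  | zero => exact hx
  | succ n ih => exact ih _ (R.mem_sel hx)

lemma path_side (n : ℕ) (R : Cube d) (x : Fin d → ℝ) : (path n R x).side = R.side / 2 ^ n := by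
  induction n generalizing R with
  | zero => simp [path]
  | succ n ih => rw [path, ih, Cube.sel_side, pow_succ']; field_simp

/-- Telescoping along dyadic cubes: a local Poincaré inequality controls the difference of
averages. -/
lemma enorm_average_path_sub_le {v : (Fin d → ℝ) → F} {H : (Fin d → ℝ) → ℝ≥0∞} {C : ℝ≥0∞}
    (n : ℕ) (R : Cube d) (x : Fin d → ℝ) (hv : IntegrableOn v R.toSet)
    (h : ∀ S : Cube d, S.toSet ⊆ R.toSet → ∫⁻ x in S.toSet, ∫⁻ y in S.toSet, ‖v x - v y‖ₑ ≤
      C * ENNReal.ofReal S.side * S.vol * ∫⁻ z in S.toSet, H z) :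
    ‖(⨍ y in (path n R x).toSet, v y) - ⨍ y in R.toSet, v y‖ₑ ≤
      2 ^ d * C * fullSum (fun S => ENNReal.ofReal S.side * lavg H S) n R x := by
  induction n generalizing R with
  | zero => simp [path, fullSum]
  | succ n ih =>
    have hvs : IntegrableOn v (R.sel x).toSet := hv.mono_set (R.sel_subset x)
    have h1 := ih (R.sel x) hvs fun S hS => h S (hS.trans (R.sel_subset x))
    have h2 : ‖(⨍ y in (R.sel x).toSet, v y) - ⨍ y in R.toSet, v y‖ₑ ≤
        2 ^ d * C * (ENNReal.ofReal R.side * lavg H R) := by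
      refine (enorm_average_sub_average_le _ _ hvs hv).trans ?_
      have hvol : ((R.sel x).vol)⁻¹ = 2 ^ d * R.vol⁻¹ := by
        rw [← R.child_vol (R.selIdx x), ENNReal.mul_inv (Or.inl (by simp)) (Or.inl (by simp)),
          ← mul_assoc, ENNReal.mul_inv_cancel (by simp) (by simp), one_mul]
        rfl
      calc _ ≤ 2 ^ d * R.vol⁻¹ * (R.vol⁻¹ *
            (C * ENNReal.ofReal R.side * R.vol * ∫⁻ z in R.toSet, H z)) := by
            rw [hvol]
            gcongr
            exact (lintegral_mono_set (R.sel_subset x)).trans (h R subset_rfl)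
        _ = 2 ^ d * C * (ENNReal.ofReal R.side * ((∫⁻ z in R.toSet, H z) * R.vol⁻¹)) *
              (R.vol⁻¹ * R.vol) := by ring
        _ = _ := by
            rw [ENNReal.inv_mul_cancel R.vol_ne_zero R.vol_ne_top, mul_one, lavg, div_eq_mul_inv]
    rw [path, fullSum, mul_add, add_comm,
      ← sub_add_sub_cancel _ (⨍ y in (R.sel x).toSet, v y) _]
    exact (enorm_add_le _ _).trans (add_le_add h1 h2)

/-- The pointwise domination of the oscillation by the dyadic fractional integral operator, from
a local Poincaré inequality and Lebesgue's differentiation theorem. -/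
lemma ae_enorm_sub_average_le {v : (Fin d → ℝ) → F} {H : (Fin d → ℝ) → ℝ≥0∞} {C : ℝ≥0∞}
    (Q : Cube d) (hv : IntegrableOn v Q.toSet)
    (h : ∀ S : Cube d, S.toSet ⊆ Q.toSet → ∫⁻ x in S.toSet, ∫⁻ y in S.toSet, ‖v x - v y‖ₑ ≤
      C * ENNReal.ofReal S.side * S.vol * ∫⁻ z in S.toSet, H z) :
    ∀ᵐ x ∂(volume.restrict Q.toSet), ‖v x - ⨍ y in Q.toSet, v y‖ₑ ≤
      2 ^ d * C * ⨆ n, fullSum (fun S => ENNReal.ofReal S.side * lavg H S) n Q x := by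
  have hvi : LocallyIntegrable (Q.toSet.indicator v) volume :=
    ((integrable_indicator_iff Q.measurableSet).2 hv).locallyIntegrable
  have hL := IsUnifLocDoublingMeasure.ae_tendsto_average volume hvi 1
  filter_upwards [ae_restrict_of_ae hL, ae_restrict_mem Q.measurableSet] with x hx hxQ
  have hside : Filter.Tendsto (fun n => (path n Q x).side / 2) Filter.atTop (nhdsWithin 0 (Set.Ioi 0)) := by
    refine tendsto_nhdsWithin_iff.2 ⟨?_, Filter.Eventually.of_forall fun n =>
      half_pos (path n Q x).side_pos⟩
    have h1 : Filter.Tendsto (fun n : ℕ => Q.side / 2 * (1 / 2) ^ n) Filter.atTop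
        (nhds (Q.side / 2 * 0)) :=
      (tendsto_pow_atTop_nhds_zero_of_lt_one (by norm_num) (by norm_num)).const_mul _
    rw [mul_zero] at h1
    refine h1.congr fun n => ?_
    rw [path_side, one_div, inv_pow]; field_simp
  have h2 := hx (fun n i => (path n Q x).corner i + (path n Q x).side / 2)
    (fun n => (path n Q x).side / 2) hside (Filter.Eventually.of_forall fun n => by
      rw [one_mul, ← Cube.toSet_eq_closedBall]; exact mem_path n Q hxQ)
  simp only [← Cube.toSet_eq_closedBall, Set.indicator_of_mem hxQ] at h2
  have h3 : Filter.Tendsto (fun n => ‖(⨍ y in (path n Q x).toSet, v y) - ⨍ y in Q.toSet, v y‖ₑ)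
      Filter.atTop (nhds ‖v x - ⨍ y in Q.toSet, v y‖ₑ) := by
    refine ((h2.sub_const (⨍ y in Q.toSet, v y)).enorm).congr fun n => ?_
    congr 2
    refine setAverage_congr_fun (path n Q x).measurableSet (Filter.Eventually.of_forall ?_)
    intro y hy
    exact Set.indicator_of_mem (path_subset n Q x hy) v
  refine le_of_tendsto' h3 fun n => (enorm_average_path_sub_le n Q x hv h).trans ?_
  gcongr
  exact le_iSup (fun n => fullSum (fun S => ENNReal.ofReal S.side * lavg H S) n Q x) n

lemma lavg_enorm_sub_average_le {v : (Fin d → ℝ) → F} {H : (Fin d → ℝ) → ℝ≥0∞} {C : ℝ≥0∞}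
    (Q : Cube d) (hv : IntegrableOn v Q.toSet)
    (h : ∫⁻ x in Q.toSet, ∫⁻ y in Q.toSet, ‖v x - v y‖ₑ ≤
      C * ENNReal.ofReal Q.side * Q.vol * ∫⁻ z in Q.toSet, H z) :
    lavg (fun x => ‖v x - ⨍ y in Q.toSet, v y‖ₑ) Q ≤ C * (ENNReal.ofReal Q.side * lavg H Q) := by
  have h1 : ∫⁻ x in Q.toSet, ‖v x - ⨍ y in Q.toSet, v y‖ₑ ≤
      Q.vol⁻¹ * (C * ENNReal.ofReal Q.side * Q.vol * ∫⁻ z in Q.toSet, H z) := by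
    refine le_trans ?_ (mul_le_mul_right h _)
    rw [← lintegral_const_mul' _ _ (ENNReal.inv_ne_top.2 Q.vol_ne_zero)]
    exact lintegral_mono fun x => enorm_sub_average_le Q hv _
  rw [lavg, lavg]
  refine (ENNReal.div_le_div_right h1 _).trans (le_of_eq ?_)
  simp only [div_eq_mul_inv]
  calc _ = C * (ENNReal.ofReal Q.side * ((∫⁻ z in Q.toSet, H z) * Q.vol⁻¹)) *
        (Q.vol⁻¹ * Q.vol) := by ring
    _ = _ := by rw [ENNReal.inv_mul_cancel Q.vol_ne_zero Q.vol_ne_top, mul_one]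

end Average

/-! ### Mollification -/

open Filter Topology in
lemma tendsto_lintegral_translate_of_continuous {k : (Fin d → ℝ) → ℂ} (hk : Continuous k)
    (hkc : HasCompactSupport k) :
    Tendsto (fun s : Fin d → ℝ => ∫⁻ x, ‖k (x - s) - k x‖ₑ) (𝓝 0) (𝓝 0) := by
  obtain ⟨M, hM⟩ := hkc.exists_bound_of_continuous hk
  set K : Set (Fin d → ℝ) := Metric.cthickening 1 (tsupport k) with hK
  have hKc : IsCompact K := hkc.isCompact.cthickening
  have hlim : Tendsto (fun s : Fin d → ℝ => ∫⁻ x, ‖k (x - s) - k x‖ₑ) (𝓝 0)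
      (𝓝 (∫⁻ _ : Fin d → ℝ, (0 : ℝ≥0∞))) := by
    refine tendsto_lintegral_filter_of_dominated_convergence
      (K.indicator fun _ => ENNReal.ofReal (M + M)) ?_ ?_ ?_ ?_
    · exact Eventually.of_forall fun s => by fun_prop
    · filter_upwards [Metric.ball_mem_nhds (0 : Fin d → ℝ) one_pos] with s hs
      refine Eventually.of_forall fun x => ?_
      by_cases hx : x ∈ K
      · rw [Set.indicator_of_mem hx, ← ofReal_norm]
        exact ENNReal.ofReal_le_ofReal ((norm_sub_le _ _).trans (add_le_add (hM _) (hM _)))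
      · have h1 : k x = 0 := by
          refine image_eq_zero_of_notMem_tsupport fun h => hx ?_
          exact Metric.self_subset_cthickening _ h
        have h2 : k (x - s) = 0 := by
          refine image_eq_zero_of_notMem_tsupport fun h => hx ?_
          refine Metric.mem_cthickening_of_dist_le x (x - s) 1 _ h ?_
          rw [dist_eq_norm, sub_sub_cancel]
          exact (mem_ball_zero_iff.1 hs).le
        simp [h1, h2]
    · rw [lintegral_indicator_const hKc.measurableSet]
      exact ENNReal.mul_ne_top ENNReal.ofReal_ne_top hKc.measure_lt_top.ne
    · refine Eventually.of_forall fun x => ?_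
      have : Continuous fun s : Fin d → ℝ => ‖k (x - s) - k x‖ₑ := by fun_prop
      simpa using this.tendsto 0
  simpa using hlim

open Filter Topology in
/-- Translation is continuous in `L¹`. -/
lemma tendsto_lintegral_translate {h : (Fin d → ℝ) → ℂ} (hh : Integrable h) :
    Tendsto (fun s : Fin d → ℝ => ∫⁻ x, ‖h (x - s) - h x‖ₑ) (𝓝 0) (𝓝 0) := by
  rw [ENNReal.tendsto_nhds_zero]
  intro ε hε
  obtain ⟨k, hkc, hk, hkcont, hki⟩ := hh.exists_hasCompactSupport_lintegral_sub_le
    (ε := ε / 3) (by simp [hε.ne'])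
  have h1 := ENNReal.tendsto_nhds_zero.1 (tendsto_lintegral_translate_of_continuous hkcont hkc)
    (ε / 3) (by simp [hε.ne'])
  filter_upwards [h1] with s hs
  have hm : AEStronglyMeasurable (fun x => h x - k x) volume := (hh.sub hki).aestronglyMeasurable
  have e1 : ∫⁻ x, ‖h (x - s) - k (x - s)‖ₑ = ∫⁻ x, ‖h x - k x‖ₑ :=
    lintegral_sub_right_eq_self (fun x => ‖h x - k x‖ₑ) s
  calc ∫⁻ x, ‖h (x - s) - h x‖ₑ
      ≤ ∫⁻ x, (‖h (x - s) - k (x - s)‖ₑ + ‖k (x - s) - k x‖ₑ + ‖h x - k x‖ₑ) := by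
        refine lintegral_mono fun x => ?_
        calc ‖h (x - s) - h x‖ₑ = ‖(h (x - s) - k (x - s)) + (k (x - s) - k x) - (h x - k x)‖ₑ := by
              congr 1; ring
          _ ≤ _ := (enorm_sub_le).trans (add_le_add_left (enorm_add_le _ _) _)
    _ = (∫⁻ x, ‖h x - k x‖ₑ) + (∫⁻ x, ‖k (x - s) - k x‖ₑ) + ∫⁻ x, ‖h x - k x‖ₑ := by
        rw [lintegral_add_right' _ hm.enorm, lintegral_add_right' _ (by fun_prop), e1]
    _ ≤ ε / 3 + ε / 3 + ε / 3 := by gcongr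
    _ = ε := ENNReal.add_thirds ε

/-- A standard sequence of mollifiers. -/
noncomputable def bump (d : ℕ) (n : ℕ) : ContDiffBump (0 : Fin d → ℝ) where
  rIn := 1 / (n + 1) / 2
  rOut := 1 / (n + 1)
  rIn_pos := by positivity
  rIn_lt_rOut := half_lt_self (by positivity)

/-- The mollification of `h` at scale `1 / (n + 1)`. -/
noncomputable def mollify (n : ℕ) (h : (Fin d → ℝ) → ℂ) : (Fin d → ℝ) → ℂ :=
  convolution h ((bump d n).normed volume) (ContinuousLinearMap.lsmul ℝ ℝ).flip volume

lemma mollify_apply (n : ℕ) (h : (Fin d → ℝ) → ℂ) (x : Fin d → ℝ) :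
    mollify n h x = ∫ y, (bump d n).normed volume (x - y) • h y := rfl

lemma mollify_apply' (n : ℕ) (h : (Fin d → ℝ) → ℂ) (x : Fin d → ℝ) :
    mollify n h x = ∫ y, (bump d n).normed volume y • h (x - y) := by
  rw [mollify_apply, ← integral_sub_left_eq_self _ volume x]
  simp

lemma bump_rOut_tendsto (d : ℕ) :
    Filter.Tendsto (fun n => (bump d n).rOut) Filter.atTop (nhds 0) :=
  tendsto_one_div_add_atTop_nhds_zero_nat

open Filter Topology in
lemma ae_tendsto_mollify {h : (Fin d → ℝ) → ℂ} (hh : Integrable h) :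
    ∀ᵐ x, Tendsto (fun n => mollify n h x) atTop (𝓝 (h x)) := by
  have := ContDiffBump.ae_convolution_tendsto_right_of_locallyIntegrable (μ := volume)
    (bump_rOut_tendsto d) (K := 2) (Eventually.of_forall fun n => by
      change (1 : ℝ) / (n + 1) ≤ 2 * (1 / (n + 1) / 2)
      rw [mul_div_cancel₀ _ (by norm_num)]) hh.locallyIntegrable
  filter_upwards [this] with x hx
  refine hx.congr fun n => ?_
  rw [mollify, convolution_flip]

lemma contDiff_mollify (n : ℕ) {h : (Fin d → ℝ) → ℂ} (hh : Integrable h) :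
    ContDiff ℝ 1 (mollify n h) :=
  (bump d n).hasCompactSupport_normed.contDiff_convolution_right _ hh.locallyIntegrable
    (n := 1) ((bump d n).contDiff_normed (n := 1))

lemma fderiv_mollify_apply (n : ℕ) {h : (Fin d → ℝ) → ℂ} (hh : Integrable h) (x v : Fin d → ℝ) :
    fderiv ℝ (mollify n h) x v = ∫ y, (fderiv ℝ ((bump d n).normed volume) (x - y) v) • h y := by
  have hc := (bump d n).hasCompactSupport_normed (μ := volume)
  have hd : ContDiff ℝ 1 ((bump d n).normed volume) := (bump d n).contDiff_normed (n := 1)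
  have h1 := hc.hasFDerivAt_convolution_right (ContinuousLinearMap.lsmul ℝ ℝ).flip
    hh.locallyIntegrable hd x
  rw [mollify, h1.fderiv, convolution_precompR_apply _ hh.locallyIntegrable (hc.fderiv ℝ)
    (hd.continuous_fderiv one_ne_zero)]
  rfl

open Filter Topology in
/-- Mollifications converge in `L¹`. -/
lemma tendsto_lintegral_mollify_sub {h : (Fin d → ℝ) → ℂ} (hh : Integrable h) :
    Tendsto (fun n => ∫⁻ x, ‖mollify n h x - h x‖ₑ) atTop (𝓝 0) := by
  rw [ENNReal.tendsto_nhds_zero]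
  intro ε hε
  have h1 := ENNReal.tendsto_nhds_zero.1 (tendsto_lintegral_translate hh) ε hε
  obtain ⟨δ, hδ, hδε⟩ := Metric.eventually_nhds_iff.1 h1
  filter_upwards [(bump_rOut_tendsto d).eventually (gt_mem_nhds hδ)] with n hn
  set φ := (bump d n).normed volume with hφ
  have hφc : Continuous φ := (bump d n).continuous_normed
  have hφ1 : ∫⁻ s, ‖φ s‖ₑ = 1 := by
    have h2 : ∫ s, φ s = 1 := (bump d n).integral_normed
    have h3 : Integrable φ := (bump d n).integrable_normed
    rw [← ENNReal.ofReal_one, ← h2, ofReal_integral_eq_lintegral_ofReal h3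
      (Eventually.of_forall fun s => (bump d n).nonneg_normed s)]
    exact lintegral_congr fun s => Real.enorm_of_nonneg ((bump d n).nonneg_normed s)
  have hpt (x : Fin d → ℝ) (hx : Integrable (fun s => φ s • h (x - s))) :
      ‖mollify n h x - h x‖ₑ ≤ ∫⁻ s, ‖φ s‖ₑ * ‖h (x - s) - h x‖ₑ := by
    have h2 : ∫ s, φ s • h x = h x := by
      rw [integral_smul_const, (bump d n).integral_normed, one_smul]
    have h3 : mollify n h x - h x = ∫ s, φ s • (h (x - s) - h x) := by
      simp only [smul_sub]
      rw [integral_sub hx ((bump d n).integrable_normed.smul_const _), h2, mollify_apply']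
    rw [h3]
    refine (enorm_integral_le_lintegral_enorm _).trans (le_of_eq ?_)
    simp only [enorm_smul]
  have hint (x : Fin d → ℝ) : Integrable (fun s => φ s • h (x - s)) := by
    have h2 : Integrable fun s => h (x - s) := hh.comp_sub_left x
    obtain ⟨M, hM⟩ := (bump d n).hasCompactSupport_normed.exists_bound_of_continuous hφc
    exact h2.bdd_smul M hφc.aestronglyMeasurable (Eventually.of_forall hM)
  have hmeas : AEMeasurable (Function.uncurry fun x s => ‖φ s‖ₑ * ‖h (x - s) - h x‖ₑ)
      ((volume : Measure (Fin d → ℝ)).prod (volume : Measure (Fin d → ℝ))) := by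
    have h2 : AEStronglyMeasurable (fun z : (Fin d → ℝ) × (Fin d → ℝ) => h (z.1 - z.2))
        (volume.prod volume) :=
      hh.aestronglyMeasurable.comp_quasiMeasurePreserving
        (quasiMeasurePreserving_sub_of_right_invariant volume volume)
    have h3 : AEStronglyMeasurable (fun z : (Fin d → ℝ) × (Fin d → ℝ) => h z.1)
        (volume.prod volume) := hh.aestronglyMeasurable.comp_fst
    have h4 : AEMeasurable (fun z : (Fin d → ℝ) × (Fin d → ℝ) => ‖φ z.2‖ₑ)
        (volume.prod volume) := by
      have : Continuous (fun z : (Fin d → ℝ) × (Fin d → ℝ) => ‖φ z.2‖ₑ) := by fun_prop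
      exact this.aemeasurable
    exact h4.mul (h2.sub h3).enorm
  calc ∫⁻ x, ‖mollify n h x - h x‖ₑ ≤ ∫⁻ x, ∫⁻ s, ‖φ s‖ₑ * ‖h (x - s) - h x‖ₑ :=
        lintegral_mono fun x => hpt x (hint x)
    _ = ∫⁻ s, ∫⁻ x, ‖φ s‖ₑ * ‖h (x - s) - h x‖ₑ := lintegral_lintegral_swap hmeas
    _ = ∫⁻ s, ‖φ s‖ₑ * ∫⁻ x, ‖h (x - s) - h x‖ₑ := by
        refine lintegral_congr fun s => ?_
        rw [lintegral_const_mul' _ _ enorm_ne_top]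
    _ ≤ ∫⁻ s, ‖φ s‖ₑ * ε := by
        refine lintegral_mono fun s => ?_
        by_cases hs : φ s = 0
        · simp [hs]
        · have hs' : s ∈ Function.support φ := hs
          rw [hφ, (bump d n).support_normed_eq] at hs'
          gcongr
          exact hδε ((Metric.mem_ball.1 hs').trans hn)
    _ = ε := by rw [lintegral_mul_const _ (by fun_prop), hφ1, one_mul]

/-! ### The Poincaré inequality for weak gradients -/

lemma Cube.volume_frontier (R : Cube d) : volume (frontier R.toSet) = 0 :=
  R.convex.addHaar_frontier volume

lemma Cube.restrict_interior (R : Cube d) :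
    volume.restrict (interior R.toSet) = volume.restrict R.toSet :=
  Measure.restrict_congr_set (interior_ae_eq_of_null_frontier R.volume_frontier)

lemma enorm_le_sum_enorm_single {F : Type*} [NormedAddCommGroup F] [NormedSpace ℝ F]
    (A : (Fin d → ℝ) →L[ℝ] F) : ‖A‖ₑ ≤ ∑ j, ‖A (Pi.single j 1)‖ₑ := by
  have h1 : ‖A‖ ≤ ∑ j, ‖A (Pi.single j 1)‖ := by
    refine A.opNorm_le_bound (Finset.sum_nonneg fun _ _ => norm_nonneg _) fun v => ?_
    have hv : v = ∑ j, v j • (Pi.single j 1 : Fin d → ℝ) := by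
      conv_lhs => rw [← Finset.univ_sum_single v]
      refine Finset.sum_congr rfl fun j _ => ?_
      rw [← Pi.single_smul', smul_eq_mul, mul_one]
    conv_lhs => rw [hv, map_sum]
    rw [Finset.sum_mul]
    refine (norm_sum_le _ _).trans (Finset.sum_le_sum fun j _ => ?_)
    rw [map_smul, norm_smul, mul_comm]
    exact mul_le_mul_of_nonneg_left (norm_le_pi_norm v j) (norm_nonneg _)
  rw [← ofReal_norm]
  refine (ENNReal.ofReal_le_ofReal h1).trans (le_of_eq ?_)
  rw [ENNReal.ofReal_sum_of_nonneg fun _ _ => norm_nonneg _]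
  simp only [ofReal_norm]

/-- Well inside `Q`, mollification commutes with the weak derivatives. -/
lemma fderiv_mollify_indicator {Q : Cube d} {f : (Fin d → ℝ) → ℂ}
    {g : (Fin d → ℝ) → EuclideanSpace ℂ (Fin d)} (hfg : HasWeakGradient Q f g)
    (hf : IntegrableOn f Q.toSet) {n : ℕ} {x : Fin d → ℝ}
    (hx : Metric.closedBall x (bump d n).rOut ⊆ interior Q.toSet) (j : Fin d) :
    fderiv ℝ (mollify n (Q.toSet.indicator f)) x (Pi.single j 1) =
      mollify n (Q.toSet.indicator fun y => g y j) x := by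
  set ψ := (bump d n).normed volume with hψ
  have hψd : ContDiff ℝ (⊤ : ℕ∞) ψ := (bump d n).contDiff_normed
  have hψ1 : Differentiable ℝ ψ := hψd.differentiable (by simp)
  have hsupp (y : Fin d → ℝ) (hy : y ∉ Metric.closedBall x (bump d n).rOut) : ψ (x - y) = 0 := by
    by_contra h
    have h1 : x - y ∈ Function.support ψ := h
    rw [hψ, (bump d n).support_normed_eq, mem_ball_zero_iff] at h1
    exact hy (by rw [Metric.mem_closedBall, dist_comm, dist_eq_norm]; exact h1.le)
  have hts : tsupport (fun y => ψ (x - y)) ⊆ Metric.closedBall x (bump d n).rOut :=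
    closure_minimal (fun y hy => by_contra fun h => hy (hsupp y h)) Metric.isClosed_closedBall
  have h1 := hfg.integral_eq (fun y => ψ (x - y)) (hψd.comp (contDiff_const.sub contDiff_id))
    (HasCompactSupport.intro (isCompact_closedBall _ _) hsupp) (hts.trans hx) j
  have h2 (y : Fin d → ℝ) : fderiv ℝ (fun y => ψ (x - y)) y (Pi.single j 1) =
      - fderiv ℝ ψ (x - y) (Pi.single j 1) := by
    have h3 : HasFDerivAt (fun y => ψ (x - y)) ((fderiv ℝ ψ (x - y)).comp
        (-ContinuousLinearMap.id ℝ (Fin d → ℝ))) y :=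
      (hψ1 (x - y)).hasFDerivAt.comp y ((hasFDerivAt_id y).const_sub x)
    rw [h3.fderiv]
    simp
  simp only [h2, neg_smul, integral_neg, neg_inj] at h1
  rw [← integral_indicator Q.measurableSet, ← integral_indicator Q.measurableSet,
    Set.indicator_smul, Set.indicator_smul] at h1
  rw [fderiv_mollify_apply n ((integrable_indicator_iff Q.measurableSet).2 hf), mollify_apply]
  exact h1

lemma enorm_fderiv_mollify_indicator_le {Q : Cube d} {f : (Fin d → ℝ) → ℂ}
    {g : (Fin d → ℝ) → EuclideanSpace ℂ (Fin d)} (hfg : HasWeakGradient Q f g)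
    (hf : IntegrableOn f Q.toSet) {n : ℕ} {x : Fin d → ℝ}
    (hx : Metric.closedBall x (bump d n).rOut ⊆ interior Q.toSet) :
    ‖fderiv ℝ (mollify n (Q.toSet.indicator f)) x‖ₑ ≤
      ∑ j, ‖mollify n (Q.toSet.indicator fun y => g y j) x‖ₑ := by
  refine (enorm_le_sum_enorm_single _).trans (le_of_eq ?_)
  simp only [fderiv_mollify_indicator hfg hf hx]

section Chain

variable {F : Type*} [NormedAddCommGroup F] [NormedSpace ℝ F] [CompleteSpace F]

open Filter Topology in
/-- For cubes in the interior of `Q` the inequality passes to the limit from the mollifications of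
`f`: Fatou's lemma applies on the left, dominated convergence and the `L¹` convergence of the
mollified derivatives on the right. -/
lemma poincare_of_subset_interior {Q R : Cube d} (hR : R.toSet ⊆ interior Q.toSet)
    {f : (Fin d → ℝ) → ℂ} {g : (Fin d → ℝ) → EuclideanSpace ℂ (Fin d)}
    (hfg : HasWeakGradient Q f g) (hf : IntegrableOn f Q.toSet) (hg : IntegrableOn g Q.toSet)
    {Φ : ℂ → F} (hΦ : ContDiff ℝ 1 Φ) {L : ℝ≥0} (hL : ∀ z, ‖fderiv ℝ Φ z‖ₑ ≤ L) :
    ∫⁻ x in R.toSet, ∫⁻ y in R.toSet, ‖Φ (f x) - Φ (f y)‖ₑ ≤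
      2 ^ d * ENNReal.ofReal R.side * R.vol *
        ∫⁻ z in R.toSet, ‖fderiv ℝ Φ (f z)‖ₑ * ∑ j, ‖g z j‖ₑ := by
  have hRQ : R.toSet ⊆ Q.toSet := hR.trans interior_subset
  set f₀ := Q.toSet.indicator f with hf₀
  set g₀ : Fin d → (Fin d → ℝ) → ℂ := fun j => Q.toSet.indicator fun y => g y j with hg₀
  have hf₀i : Integrable f₀ := (integrable_indicator_iff Q.measurableSet).2 hf
  have hg₀i (j : Fin d) : Integrable (g₀ j) := by
    refine (integrable_indicator_iff Q.measurableSet).2 ?_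
    exact (EuclideanSpace.proj (𝕜 := ℂ) j).integrable_comp hg
  set u : ℕ → (Fin d → ℝ) → ℂ := fun n => mollify n f₀ with hu
  have hud (n : ℕ) : ContDiff ℝ 1 (u n) := contDiff_mollify n hf₀i
  have huc (n : ℕ) : Continuous (u n) := (hud n).continuous
  have hΦc : Continuous Φ := hΦ.continuous
  have hDc : Continuous (fderiv ℝ Φ) := hΦ.continuous_fderiv one_ne_zero
  have hlim : ∀ᵐ x ∂(volume.restrict R.toSet), Tendsto (fun n => u n x) atTop (𝓝 (f x)) := by
    filter_upwards [ae_restrict_of_ae (ae_tendsto_mollify hf₀i),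
      ae_restrict_mem R.measurableSet] with x hx hxR
    rwa [hf₀, Set.indicator_of_mem (hRQ hxR)] at hx
  set K : ℝ≥0∞ := 2 ^ d * ENNReal.ofReal R.side * R.vol with hK
  have hKt : K ≠ ⊤ := ENNReal.mul_ne_top (ENNReal.mul_ne_top (by simp) ENNReal.ofReal_ne_top)
    R.vol_ne_top
  have hGm : AEMeasurable (fun z => ∑ j, ‖g z j‖ₑ) (volume.restrict R.toSet) := by
    refine Finset.aemeasurable_fun_sum _ fun j _ => ?_
    exact ((EuclideanSpace.proj (𝕜 := ℂ) j).integrable_comp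
      (hg.mono_set hRQ)).aestronglyMeasurable.enorm
  have hGi : ∫⁻ z in R.toSet, ∑ j, ‖g z j‖ₑ ≠ ⊤ := by
    rw [lintegral_finsetSum' (f := fun j z => ‖g z j‖ₑ) _ fun j _ =>
      ((EuclideanSpace.proj (𝕜 := ℂ) j).integrable_comp
        (hg.mono_set hRQ)).aestronglyMeasurable.enorm]
    refine ENNReal.sum_ne_top.2 fun j _ => ?_
    exact ((EuclideanSpace.proj (𝕜 := ℂ) j).integrable_comp (hg.mono_set hRQ)).2.ne
  set b : ℕ → ℝ≥0∞ := fun n => (∫⁻ z in R.toSet, ‖fderiv ℝ Φ (u n z)‖ₑ * ∑ j, ‖g z j‖ₑ) +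
    L * ∑ j, ∫⁻ z, ‖mollify n (g₀ j) z - g₀ j z‖ₑ with hb
  have hblim : Tendsto b atTop (𝓝 (∫⁻ z in R.toSet, ‖fderiv ℝ Φ (f z)‖ₑ * ∑ j, ‖g z j‖ₑ)) := by
    have h1 : Tendsto (fun n => ∫⁻ z in R.toSet, ‖fderiv ℝ Φ (u n z)‖ₑ * ∑ j, ‖g z j‖ₑ) atTop
        (𝓝 (∫⁻ z in R.toSet, ‖fderiv ℝ Φ (f z)‖ₑ * ∑ j, ‖g z j‖ₑ)) := by
      refine tendsto_lintegral_of_dominated_convergence' (fun z => L * ∑ j, ‖g z j‖ₑ)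
        (fun n => ?_) (fun n => ?_) ?_ ?_
      · exact (hDc.comp (huc n)).enorm.aemeasurable.mul hGm
      · exact Eventually.of_forall fun z => mul_le_mul_left (hL _) _
      · rw [lintegral_const_mul' _ _ ENNReal.coe_ne_top]
        exact ENNReal.mul_ne_top ENNReal.coe_ne_top hGi
      · have h2 : ∀ᵐ z ∂(volume.restrict R.toSet), ∑ j, ‖g z j‖ₑ < ⊤ :=
          ae_lt_top' hGm hGi
        filter_upwards [hlim, h2] with z hz hz2
        exact ENNReal.Tendsto.mul_const (((hDc.tendsto _).comp hz).enorm) (Or.inr hz2.ne)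
    have h2 : Tendsto (fun n => L * ∑ j, ∫⁻ z, ‖mollify n (g₀ j) z - g₀ j z‖ₑ) atTop
        (𝓝 (L * ∑ j : Fin d, (0 : ℝ≥0∞))) :=
      ENNReal.Tendsto.const_mul (tendsto_finsetSum _ fun j _ =>
        tendsto_lintegral_mollify_sub (hg₀i j)) (Or.inr ENNReal.coe_ne_top)
    simpa using h1.add h2
  obtain ⟨δ, hδ, hδQ⟩ := R.isCompact.exists_cthickening_subset_open isOpen_interior hR
  have hbound : ∀ᶠ n in atTop, ∫⁻ x in R.toSet, ∫⁻ y in R.toSet, ‖Φ (u n x) - Φ (u n y)‖ₑ ≤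
      K * b n := by
    filter_upwards [(bump_rOut_tendsto d).eventually (gt_mem_nhds hδ)] with n hn
    refine (poincare_of_contDiff (hΦ.comp (hud n)) R).trans (mul_le_mul_right ?_ _)
    calc ∫⁻ z in R.toSet, ‖fderiv ℝ (Φ ∘ u n) z‖ₑ
        ≤ ∫⁻ z in R.toSet, (‖fderiv ℝ Φ (u n z)‖ₑ * ∑ j, ‖g z j‖ₑ +
            L * ∑ j, ‖mollify n (g₀ j) z - g₀ j z‖ₑ) := by
          refine setLIntegral_mono' R.measurableSet fun z hz => ?_
          rw [fderiv_comp z (hΦ.differentiable one_ne_zero _) ((hud n).differentiable one_ne_zero _)]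
          have h1 : ‖(fderiv ℝ Φ (u n z)).comp (fderiv ℝ (u n) z)‖ₑ ≤
              ‖fderiv ℝ Φ (u n z)‖ₑ * ‖fderiv ℝ (u n) z‖ₑ := by
            simp only [← ofReal_norm]
            rw [← ENNReal.ofReal_mul (norm_nonneg _)]
            exact ENNReal.ofReal_le_ofReal (ContinuousLinearMap.opNorm_comp_le _ _)
          have h2 : ‖fderiv ℝ (u n) z‖ₑ ≤ ∑ j, (‖g z j‖ₑ + ‖mollify n (g₀ j) z - g₀ j z‖ₑ) := by
            refine (enorm_fderiv_mollify_indicator_le hfg hf ?_).trans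
              (Finset.sum_le_sum fun j _ => ?_)
            · refine (Metric.closedBall_subset_closedBall hn.le).trans (Set.Subset.trans ?_ hδQ)
              exact Metric.closedBall_subset_cthickening hz δ
            · have e : g z j = g₀ j z := by
                exact (Set.indicator_of_mem (hRQ hz) fun y => g y j).symm
              rw [e]
              calc _ = ‖g₀ j z + (mollify n (g₀ j) z - g₀ j z)‖ₑ := by
                    rw [add_sub_cancel]
                _ ≤ _ := enorm_add_le _ _
          refine h1.trans ((mul_le_mul_right h2 _).trans ?_)
          rw [Finset.sum_add_distrib, mul_add]
          exact add_le_add_right (mul_le_mul_left (hL _) _) _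
      _ = (∫⁻ z in R.toSet, ‖fderiv ℝ Φ (u n z)‖ₑ * ∑ j, ‖g z j‖ₑ) +
            L * ∑ j, ∫⁻ z in R.toSet, ‖mollify n (g₀ j) z - g₀ j z‖ₑ := by
          rw [lintegral_add_left' (f := fun z => ‖fderiv ℝ Φ (u n z)‖ₑ * ∑ j, ‖g z j‖ₑ)
              ((hDc.comp (huc n)).enorm.aemeasurable.mul hGm),
            lintegral_const_mul' _ _ ENNReal.coe_ne_top, lintegral_finsetSum']
          exact fun j _ => (((contDiff_mollify n (hg₀i j)).continuous.aestronglyMeasurable.sub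
            (hg₀i j).aestronglyMeasurable).enorm).restrict
      _ ≤ b n := by
          refine add_le_add_right (mul_le_mul_right (Finset.sum_le_sum fun j _ => ?_) _) _
          exact setLIntegral_le_lintegral _ _
  have hm (n : ℕ) : Measurable (Function.uncurry fun x y => ‖Φ (u n x) - Φ (u n y)‖ₑ) := by
    have : Continuous (Function.uncurry fun x y => ‖Φ (u n x) - Φ (u n y)‖ₑ) := by
      have := huc n
      simp only [Function.uncurry_def]
      fun_prop
    exact this.measurable
  calc ∫⁻ x in R.toSet, ∫⁻ y in R.toSet, ‖Φ (f x) - Φ (f y)‖ₑ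
      ≤ ∫⁻ x in R.toSet, liminf (fun n => ∫⁻ y in R.toSet, ‖Φ (u n x) - Φ (u n y)‖ₑ) atTop := by
        refine lintegral_mono_ae ?_
        filter_upwards [hlim] with x hx
        calc ∫⁻ y in R.toSet, ‖Φ (f x) - Φ (f y)‖ₑ
            ≤ ∫⁻ y in R.toSet, liminf (fun n => ‖Φ (u n x) - Φ (u n y)‖ₑ) atTop := by
              refine lintegral_mono_ae ?_
              filter_upwards [hlim] with y hy
              exact (Tendsto.liminf_eq ((((hΦc.tendsto _).comp hx).sub
                ((hΦc.tendsto _).comp hy)).enorm)).ge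
          _ ≤ _ := lintegral_liminf_le fun n => (hm n).of_uncurry_left
    _ ≤ liminf (fun n => ∫⁻ x in R.toSet, ∫⁻ y in R.toSet, ‖Φ (u n x) - Φ (u n y)‖ₑ) atTop :=
        lintegral_liminf_le fun n => (hm n).lintegral_prod_right'
    _ ≤ liminf (fun n => K * b n) atTop := liminf_le_liminf hbound
    _ = K * ∫⁻ z in R.toSet, ‖fderiv ℝ Φ (f z)‖ₑ * ∑ j, ‖g z j‖ₑ :=
        (ENNReal.Tendsto.const_mul hblim (Or.inr hKt)).liminf_eq

/-- The concentric cube shrunk by the factor `1 - 2 / (m + 3)`. -/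
noncomputable def Cube.shrink (R : Cube d) (m : ℕ) : Cube d where
  corner := fun i => R.corner i + R.side / (m + 3)
  side := R.side * (1 - 2 / (m + 3))
  side_pos := by
    refine mul_pos R.side_pos (sub_pos.2 ?_)
    rw [div_lt_one (by positivity)]
    have : (0 : ℝ) ≤ m := m.cast_nonneg
    linarith

lemma Cube.interior_toSet (R : Cube d) :
    interior R.toSet = {x | ∀ i, x i ∈ Set.Ioo (R.corner i) (R.corner i + R.side)} := by
  rw [R.toSet_eq_pi, interior_pi_set Set.finite_univ]
  ext x
  simp [interior_Icc]

lemma Cube.mem_shrink {R : Cube d} {m : ℕ} {x : Fin d → ℝ} : x ∈ (R.shrink m).toSet ↔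
    ∀ i, R.corner i + R.side / (m + 3) ≤ x i ∧ x i ≤ R.corner i + R.side - R.side / (m + 3) := by
  refine forall_congr' fun i => ?_
  have : (R.shrink m).corner i + (R.shrink m).side =
      R.corner i + R.side - R.side / (m + 3) := by
    simp only [Cube.shrink]; ring
  rw [Set.mem_Icc, this]; rfl

lemma Cube.shrink_subset_interior (R : Cube d) (m : ℕ) :
    (R.shrink m).toSet ⊆ interior R.toSet := by
  intro x hx
  rw [R.interior_toSet]
  have h0 : 0 < R.side / (m + 3) := div_pos R.side_pos (by positivity)
  exact fun i => ⟨by linarith [(Cube.mem_shrink.1 hx i).1], by linarith [(Cube.mem_shrink.1 hx i).2]⟩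

lemma Cube.shrink_mono (R : Cube d) : Monotone fun m => (R.shrink m).toSet := by
  intro m n hmn x hx
  refine Cube.mem_shrink.2 fun i => ?_
  have h1 := Cube.mem_shrink.1 hx i
  have h2 : R.side / ((n : ℝ) + 3) ≤ R.side / (m + 3) := by
    have : (m : ℝ) ≤ n := Nat.cast_le.2 hmn
    exact div_le_div_of_nonneg_left R.side_pos.le (by positivity) (by linarith)
  exact ⟨by linarith [h1.1], by linarith [h1.2]⟩

open Filter Topology in
lemma Cube.iUnion_shrink (R : Cube d) : ⋃ m, (R.shrink m).toSet = interior R.toSet := by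
  refine (Set.iUnion_subset R.shrink_subset_interior).antisymm fun x hx => ?_
  rw [R.interior_toSet] at hx
  have hlim : Tendsto (fun m : ℕ => R.side / ((m : ℝ) + 3)) atTop (𝓝 0) :=
    tendsto_const_nhds.div_atTop
      (tendsto_atTop_add_const_right _ _ tendsto_natCast_atTop_atTop)
  have h1 : ∀ᶠ m : ℕ in atTop, ∀ i, R.side / ((m : ℝ) + 3) < x i - R.corner i ∧
      R.side / ((m : ℝ) + 3) < R.corner i + R.side - x i := by
    refine eventually_all.2 fun i => ?_
    exact (hlim.eventually (gt_mem_nhds (sub_pos.2 (hx i).1))).and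
      (hlim.eventually (gt_mem_nhds (sub_pos.2 (hx i).2)))
  obtain ⟨m, hm⟩ := h1.exists
  exact Set.mem_iUnion.2 ⟨m, Cube.mem_shrink.2 fun i =>
    ⟨by linarith [(hm i).1], by linarith [(hm i).2]⟩⟩

/-- The `L¹` Poincaré inequality on the subcubes of `Q` for `Φ ∘ f`, where `f` has an integrable
weak gradient on `Q` and `Φ` is a `C¹` function with bounded derivative. -/
lemma poincare_of_hasWeakGradient {Q R : Cube d} (hR : R.toSet ⊆ Q.toSet)
    {f : (Fin d → ℝ) → ℂ} {g : (Fin d → ℝ) → EuclideanSpace ℂ (Fin d)}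
    (hfg : HasWeakGradient Q f g) (hf : IntegrableOn f Q.toSet) (hg : IntegrableOn g Q.toSet)
    {Φ : ℂ → F} (hΦ : ContDiff ℝ 1 Φ) {L : ℝ≥0} (hL : ∀ z, ‖fderiv ℝ Φ z‖ₑ ≤ L) :
    ∫⁻ x in R.toSet, ∫⁻ y in R.toSet, ‖Φ (f x) - Φ (f y)‖ₑ ≤
      (2 ^ d * d : ℝ≥0∞) * ENNReal.ofReal R.side * R.vol *
        ∫⁻ z in R.toSet, ‖fderiv ℝ Φ (f z)‖ₑ * ‖g z‖ₑ := by
  have hsum (z : Fin d → ℝ) : ∑ j, ‖g z j‖ₑ ≤ d * ‖g z‖ₑ := by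
    refine (Finset.sum_le_card_nsmul _ _ ‖g z‖ₑ fun j _ => ?_).trans (le_of_eq (by simp))
    rw [← ofReal_norm, ← ofReal_norm]
    exact ENNReal.ofReal_le_ofReal (PiLp.norm_apply_le (g z) j)
  have hm : AEMeasurable (Function.uncurry fun x y => ‖Φ (f x) - Φ (f y)‖ₑ)
      ((volume.restrict R.toSet).prod (volume.restrict R.toSet)) := by
    have h1 : AEStronglyMeasurable (fun x => Φ (f x)) (volume.restrict R.toSet) :=
      hΦ.continuous.comp_aestronglyMeasurable (hf.mono_set hR).aestronglyMeasurable
    exact (h1.comp_fst.sub h1.comp_snd).enorm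
  have hU : volume.restrict R.toSet = volume.restrict (⋃ m, (R.shrink m).toSet) := by
    rw [R.iUnion_shrink, R.restrict_interior]
  have hprod : ⋃ m, (R.shrink m).toSet ×ˢ (R.shrink m).toSet =
      (⋃ m, (R.shrink m).toSet) ×ˢ (⋃ m, (R.shrink m).toSet) :=
    Set.iUnion_prod_of_monotone R.shrink_mono R.shrink_mono
  have hdir : Directed (· ⊆ ·) fun m => (R.shrink m).toSet ×ˢ (R.shrink m).toSet :=
    Monotone.directed_le fun m n hmn => Set.prod_mono (R.shrink_mono hmn) (R.shrink_mono hmn)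
  refine (lintegral_prod _ hm).symm.trans_le ?_
  rw [Measure.prod_restrict]
  have e1 : (volume.prod volume).restrict (R.toSet ×ˢ R.toSet) =
      ((volume : Measure (Fin d → ℝ)).prod volume).restrict
        (⋃ m, (R.shrink m).toSet ×ˢ (R.shrink m).toSet) := by
    rw [hprod, ← Measure.prod_restrict, ← Measure.prod_restrict, hU]
  rw [e1, setLIntegral_iUnion_of_directed _ hdir]
  refine iSup_le fun m => ?_
  have hsub : (R.shrink m).toSet ⊆ R.toSet := (R.shrink_subset_interior m).trans interior_subset
  have hle : (volume.restrict (R.shrink m).toSet).prod (volume.restrict (R.shrink m).toSet) ≤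
      (volume.restrict R.toSet).prod (volume.restrict R.toSet) := by
    rw [Measure.prod_restrict, Measure.prod_restrict]
    exact Measure.restrict_mono (Set.prod_mono hsub hsub) le_rfl
  rw [← Measure.prod_restrict, lintegral_prod _ (hm.mono_measure hle)]
  refine (poincare_of_subset_interior ((R.shrink_subset_interior m).trans (interior_mono hR))
    hfg hf hg hΦ hL).trans ?_
  calc _ ≤ 2 ^ d * ENNReal.ofReal R.side * R.vol *
        ∫⁻ z in R.toSet, d * (‖fderiv ℝ Φ (f z)‖ₑ * ‖g z‖ₑ) := by
        refine mul_le_mul' (mul_le_mul' (mul_le_mul_right (ENNReal.ofReal_le_ofReal ?_) _) ?_) ?_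
        · refine mul_le_of_le_one_right R.side_pos.le (sub_le_self _ (by positivity))
        · exact measure_mono hsub
        · refine (lintegral_mono_set hsub).trans (lintegral_mono fun z => ?_)
          rw [mul_left_comm]
          exact mul_le_mul_right (hsum z) _
    _ = _ := by
        rw [lintegral_const_mul' _ _ (ENNReal.natCast_ne_top d)]; ring

end Chain

/-! ### The subcritical inequality, cutoffs and truncation -/

section Norms

variable {Q : Cube d} {p q α : ℝ} {ω σ : (Fin d → ℝ) → ℝ}

lemma wLpNorm_eq_weightMeasure {F : Type*} [NormedAddCommGroup F] (Q : Cube d) (p : ℝ)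
    (σ : (Fin d → ℝ) → ℝ) (f : (Fin d → ℝ) → F) :
    wLpNorm Q p σ f =
      weightMeasure Q (fun x => ‖f x‖ₑ ^ p * ENNReal.ofReal (σ x) ^ p) Q.toSet ^ (1 / p) := by
  rw [weightMeasure_apply subset_rfl]; rfl

lemma wLpNorm_eq_lintegral {F : Type*} [NormedAddCommGroup F] (hω : IsWeight Q ω) (hq : 0 < q)
    (f : (Fin d → ℝ) → F) :
    wLpNorm Q q ω f = (∫⁻ x in Q.toSet, ‖f x‖ₑ ^ q
      ∂(weightMeasure Q fun x => ENNReal.ofReal (ω x) ^ q)) ^ (1 / q) := by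
  rw [lintegral_weightMeasure subset_rfl (hω.1.ennreal_ofReal.pow_const q) fun x _ =>
    ENNReal.rpow_lt_top_of_nonneg hq.le ENNReal.ofReal_ne_top]
  rfl

lemma integrableOn_of_wLpNorm_ne_top {F : Type*} [NormedAddCommGroup F]
    (h : MemApq Q p q α ω σ) (hp : 1 ≤ p) (hq : 0 < q) {f : (Fin d → ℝ) → F}
    (hm : AEStronglyMeasurable f (volume.restrict Q.toSet)) (hf : wLpNorm Q p σ f ≠ ⊤) :
    IntegrableOn f Q.toSet := by
  refine ⟨hm, lt_top_iff_ne_top.2 (lintegral_ne_top_of_weighted h hp hq hm.enorm fun h0 => hf ?_)⟩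
  rw [wLpNorm, h0, ENNReal.top_rpow_of_pos (by positivity)]

lemma HasWeakGradient.aestronglyMeasurable_grad {f : (Fin d → ℝ) → ℂ}
    {g : (Fin d → ℝ) → EuclideanSpace ℂ (Fin d)} (hfg : HasWeakGradient Q f g) :
    AEStronglyMeasurable g (volume.restrict Q.toSet) := by
  have := hfg.locallyIntegrableOn_grad.aestronglyMeasurable
  rwa [Q.restrict_interior] at this

/-- The `L¹` Poincaré inequality for a function with an integrable weak gradient. -/
lemma poincare {f : (Fin d → ℝ) → ℂ} {g : (Fin d → ℝ) → EuclideanSpace ℂ (Fin d)}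
    (hfg : HasWeakGradient Q f g) (hf : IntegrableOn f Q.toSet) (hg : IntegrableOn g Q.toSet)
    (R : Cube d) (hR : R.toSet ⊆ Q.toSet) :
    ∫⁻ x in R.toSet, ∫⁻ y in R.toSet, ‖f x - f y‖ₑ ≤
      (2 ^ d * d : ℝ≥0∞) * ENNReal.ofReal R.side * R.vol * ∫⁻ z in R.toSet, ‖g z‖ₑ := by
  have hid (z : ℂ) : ‖fderiv ℝ (fun z : ℂ => z) z‖ₑ = 1 := by
    rw [fderiv_fun_id, ← ofReal_norm, ContinuousLinearMap.norm_id, ENNReal.ofReal_one]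
  have := poincare_of_hasWeakGradient hR hfg hf hg (Φ := fun z : ℂ => z) contDiff_id (L := 1)
    fun z => by rw [hid]; simp
  simpa only [hid, one_mul] using this

end Norms

/-- The subcritical inequality for a gradient of finite norm. -/
lemma subcritical_poincareSobolev (hd : 1 ≤ d) {p q α ε : ℝ} (hp : 1 ≤ p) (hpq : p ≤ q)
    (hα : 0 ≤ α) (hε : ε = 1 / (d : ℝ) - (1 / p - 1 / q) - α) (hε0 : 0 < ε) {Q : Cube d}
    {ω σ : (Fin d → ℝ) → ℝ} (h : MemApq Q p q α ω σ) {f : (Fin d → ℝ) → ℂ}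
    {g : (Fin d → ℝ) → EuclideanSpace ℂ (Fin d)} (hfg : HasWeakGradient Q f g)
    (hf : IntegrableOn f Q.toSet) (hg : IntegrableOn g Q.toSet) :
    wLpNorm Q q ω (fun x => f x - ⨍ y in Q.toSet, f y) ≤
      (2 ^ d * (2 ^ d * d)) * 2 * apqChar Q p q α ω σ * (Q.vol ^ ε / ENNReal.ofReal ε) *
        wLpNorm Q p σ g := by
  have hq0 : 0 < q := by linarith
  set w := weightMeasure Q fun x => ENNReal.ofReal (ω x) ^ q with hw
  set D : ℝ≥0∞ := 2 ^ d * (2 ^ d * d) with hD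
  have hDt : D ≠ ⊤ := by
    rw [hD]; exact ENNReal.mul_ne_top (by simp) (ENNReal.mul_ne_top (by simp) (by simp))
  have hdom := ae_enorm_sub_average_le Q hf (poincare hfg hf hg)
  have hac : w.restrict Q.toSet ≪ volume.restrict Q.toSet :=
    (weightMeasure_absolutelyContinuous Q _).restrict _
  rw [wLpNorm_eq_lintegral h.1 hq0, wLpNorm_eq_weightMeasure Q p σ g]
  calc (∫⁻ x in Q.toSet, ‖f x - ⨍ y in Q.toSet, f y‖ₑ ^ q ∂w) ^ (1 / q)
      ≤ (∫⁻ x in Q.toSet, D ^ q * (⨆ n, fullSum (fun S => ENNReal.ofReal S.side *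
          lavg (fun z => ‖g z‖ₑ) S) n Q x) ^ q ∂w) ^ (1 / q) := by
        refine ENNReal.rpow_le_rpow (lintegral_mono_ae ?_) (by positivity)
        filter_upwards [hac.ae_le hdom] with x hx
        rw [← ENNReal.mul_rpow_of_nonneg _ _ hq0.le]
        exact ENNReal.rpow_le_rpow hx hq0.le
    _ = D * (∫⁻ x in Q.toSet, (⨆ n, fullSum (fun S => ENNReal.ofReal S.side *
          lavg (fun z => ‖g z‖ₑ) S) n Q x) ^ q ∂w) ^ (1 / q) := by
        rw [lintegral_const_mul' _ _ (ENNReal.rpow_ne_top_of_nonneg hq0.le hDt),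
          ENNReal.mul_rpow_of_nonneg _ _ (by positivity), ← ENNReal.rpow_mul,
          mul_one_div_cancel hq0.ne', ENNReal.rpow_one]
    _ ≤ D * (2 * apqChar Q p q α ω σ * (Q.vol ^ ε / ENNReal.ofReal ε) *
          weightMeasure Q (fun x => ‖g x‖ₑ ^ p * ENNReal.ofReal (σ x) ^ p) Q.toSet ^ (1 / p)) :=
        mul_le_mul_right (subcritical_fullSum hd hp hpq hα hε hε0 Q h hg.1.enorm) _
    _ = _ := by ring

/-- A smooth function on `ℂ` which is `1` on the unit disc and `0` off the disc of radius `2`. -/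
noncomputable def cutoff : ContDiffBump (0 : ℂ) := ⟨1, 2, one_pos, one_lt_two⟩

lemma cutoff_one {z : ℂ} (hz : ‖z‖ ≤ 1) : cutoff z = 1 :=
  cutoff.one_of_mem_closedBall (mem_closedBall_zero_iff.2 hz)

lemma cutoff_zero {z : ℂ} (hz : 2 ≤ ‖z‖) : cutoff z = 0 :=
  cutoff.zero_of_le_dist (by rwa [dist_zero_right])

lemma exists_enorm_fderiv_cutoff_le : ∃ L : ℝ≥0, ∀ z, ‖fderiv ℝ cutoff z‖ₑ ≤ L := by
  have h1 : ContDiff ℝ 1 cutoff := cutoff.contDiff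
  obtain ⟨M, hM⟩ := (cutoff.hasCompactSupport.fderiv ℝ).exists_bound_of_continuous
    (h1.continuous_fderiv one_ne_zero)
  refine ⟨M.toNNReal, fun z => ?_⟩
  rw [← ofReal_norm]
  exact ENNReal.ofReal_le_ofReal (hM z)

/-- The derivative of the cutoff lives on the annulus: elsewhere the cutoff attains its maximum or
its minimum. -/
lemma fderiv_cutoff_eq_zero {z : ℂ} (hz : ‖z‖ ≤ 1 ∨ 2 ≤ ‖z‖) : fderiv ℝ cutoff z = 0 := by
  rcases hz with hz | hz
  · refine IsLocalMax.fderiv_eq_zero (Filter.Eventually.of_forall fun y => ?_)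
    rw [cutoff_one hz]; exact cutoff.le_one
  · refine IsLocalMin.fderiv_eq_zero (Filter.Eventually.of_forall fun y => ?_)
    rw [cutoff_zero hz]; exact cutoff.nonneg

/-- The cutoff adapted to the annulus `s ≤ |z - c| ≤ 2 s`. -/
noncomputable def cutoffAt (c : ℂ) (s : ℝ) (z : ℂ) : ℝ := cutoff (s⁻¹ • (z - c))

lemma cutoffAt_nonneg (c : ℂ) (s : ℝ) (z : ℂ) : 0 ≤ cutoffAt c s z := cutoff.nonneg

lemma cutoffAt_le_one (c : ℂ) (s : ℝ) (z : ℂ) : cutoffAt c s z ≤ 1 := cutoff.le_one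

lemma contDiff_cutoffAt (c : ℂ) (s : ℝ) : ContDiff ℝ 1 (cutoffAt c s) :=
  cutoff.contDiff.comp ((contDiff_id.sub contDiff_const).const_smul s⁻¹)

lemma fderiv_cutoffAt (c : ℂ) (s : ℝ) (z : ℂ) :
    fderiv ℝ (cutoffAt c s) z = s⁻¹ • fderiv ℝ cutoff (s⁻¹ • (z - c)) := by
  have h1 : HasFDerivAt (fun z => s⁻¹ • (z - c)) (s⁻¹ • ContinuousLinearMap.id ℝ ℂ) z :=
    ((hasFDerivAt_id z).sub_const c).const_smul s⁻¹
  have h2 : ContDiff ℝ 1 cutoff := cutoff.contDiff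
  have h3 := ((h2.differentiable one_ne_zero) (s⁻¹ • (z - c))).hasFDerivAt.comp z h1
  refine h3.fderiv.trans ?_
  ext v
  simp

lemma norm_inv_smul_sub {s : ℝ} (hs : 0 < s) (c z : ℂ) : ‖s⁻¹ • (z - c)‖ = ‖z - c‖ / s := by
  rw [norm_smul, norm_inv, Real.norm_of_nonneg hs.le, inv_mul_eq_div]

lemma enorm_fderiv_cutoffAt_le {L : ℝ≥0} (hL : ∀ z, ‖fderiv ℝ cutoff z‖ₑ ≤ L) (c : ℂ) {s : ℝ}
    (hs : 0 < s) (z : ℂ) : ‖fderiv ℝ (cutoffAt c s) z‖ₑ ≤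
      {z : ℂ | s < ‖z - c‖ ∧ ‖z - c‖ < 2 * s}.indicator (fun _ => L / ENNReal.ofReal s) z := by
  rw [fderiv_cutoffAt]
  by_cases hz : s < ‖z - c‖ ∧ ‖z - c‖ < 2 * s
  · rw [Set.indicator_of_mem (by exact hz), enorm_smul, enorm_inv hs.ne', mul_comm,
      Real.enorm_of_nonneg hs.le, div_eq_mul_inv]
    exact mul_le_mul_left (hL _) _
  · rw [fderiv_cutoff_eq_zero, smul_zero]
    · exact (enorm_zero (E := ℂ →L[ℝ] ℝ)).trans_le zero_le
    · rw [norm_inv_smul_sub hs, div_le_one hs, le_div_iff₀ hs]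
      by_contra! h
      exact hz h

lemma enorm_fderiv_cutoffAt_le_const {L : ℝ≥0} (hL : ∀ z, ‖fderiv ℝ cutoff z‖ₑ ≤ L) (c : ℂ)
    {s : ℝ} (hs : 0 < s) (z : ℂ) :
    ‖fderiv ℝ (cutoffAt c s) z‖ₑ ≤ (L / s.toNNReal : ℝ≥0) := by
  refine (enorm_fderiv_cutoffAt_le hL c hs z).trans ((Set.indicator_le_self' (by simp) z).trans ?_)
  rw [ENNReal.coe_div (by simpa using hs)]
  rfl

/-- Where `f` is far from its mean `c`, the truncation of `f` at height `s` deviates from its own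
mean by `1 / 2`, provided `s` is at least twice the mean oscillation of `f`. -/
lemma one_half_le_enorm_cutoffAt_sub_average {Q : Cube d} {f : (Fin d → ℝ) → ℂ}
    {c : ℂ} {s : ℝ} (hs : 0 < s)
    (hA : 2 * lavg (fun x => ‖f x - c‖ₑ) Q ≤ ENNReal.ofReal s)
    (hv : IntegrableOn (fun x => cutoffAt c s (f x)) Q.toSet) {x : Fin d → ℝ}
    (hx : 2 * s ≤ ‖f x - c‖) :
    1 / 2 ≤ ‖cutoffAt c s (f x) - ⨍ y in Q.toSet, cutoffAt c s (f y)‖ₑ := by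
  have hx0 : cutoffAt c s (f x) = 0 :=
    cutoff_zero (by rwa [norm_inv_smul_sub hs, le_div_iff₀ hs])
  have hs0 : ENNReal.ofReal s ≠ 0 := by simpa using hs
  have hpt (y : Fin d → ℝ) : ‖1 - cutoffAt c s (f y)‖ₑ ≤ (ENNReal.ofReal s)⁻¹ * ‖f y - c‖ₑ := by
    by_cases hy : ‖f y - c‖ ≤ s
    · rw [cutoffAt, cutoff_one (by rwa [norm_inv_smul_sub hs, div_le_one hs])]
      simp
    · have h1 : ‖1 - cutoffAt c s (f y)‖ₑ ≤ 1 := by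
        rw [Real.enorm_of_nonneg (sub_nonneg.2 (cutoffAt_le_one c s _)), ← ENNReal.ofReal_one]
        exact ENNReal.ofReal_le_ofReal (sub_le_self _ (cutoffAt_nonneg c s _))
      refine h1.trans ?_
      rw [← ENNReal.inv_mul_cancel hs0 ENNReal.ofReal_ne_top, ← ofReal_norm (f y - c)]
      exact mul_le_mul_right (ENNReal.ofReal_le_ofReal (not_le.1 hy).le) _
  have h1 : ‖1 - ⨍ y in Q.toSet, cutoffAt c s (f y)‖ₑ ≤ 1 / 2 := by
    refine (enorm_sub_average_le Q hv 1).trans ?_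
    calc _ ≤ Q.vol⁻¹ * ∫⁻ y in Q.toSet, (ENNReal.ofReal s)⁻¹ * ‖f y - c‖ₑ :=
          mul_le_mul_right (lintegral_mono hpt) _
      _ = (ENNReal.ofReal s)⁻¹ * lavg (fun x => ‖f x - c‖ₑ) Q := by
          rw [lintegral_const_mul' _ _ (ENNReal.inv_ne_top.2 hs0), lavg, div_eq_mul_inv]; ring
      _ ≤ (ENNReal.ofReal s)⁻¹ * (ENNReal.ofReal s * (1 / 2)) := by
          refine mul_le_mul_right ?_ _
          refine le_trans (le_of_eq ?_) (mul_le_mul_left hA _)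
          rw [mul_comm, ← mul_assoc, one_div, ENNReal.inv_mul_cancel (by simp) (by simp), one_mul]
      _ = 1 / 2 := by
          rw [← mul_assoc, ENNReal.inv_mul_cancel hs0 ENNReal.ofReal_ne_top, one_mul]
  rw [hx0, zero_sub, enorm_neg]
  have h2 : (1 : ℝ≥0∞) ≤ 1 / 2 + ‖⨍ y in Q.toSet, cutoffAt c s (f y)‖ₑ := by
    calc (1 : ℝ≥0∞) = ‖(1 - ⨍ y in Q.toSet, cutoffAt c s (f y)) +
          ⨍ y in Q.toSet, cutoffAt c s (f y)‖ₑ := by rw [sub_add_cancel]; simp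
      _ ≤ _ := (enorm_add_le _ _).trans (add_le_add_left h1 _)
  have h3 : (1 / 2 : ℝ≥0∞) + 1 / 2 ≤ 1 / 2 + ‖⨍ y in Q.toSet, cutoffAt c s (f y)‖ₑ := by
    rwa [ENNReal.add_halves]
  exact (ENNReal.add_le_add_iff_left (by simp)).1 h3

/-- Dyadic decomposition of the range of `F`. -/
lemma rpow_le_dyadic_sum {q A F : ℝ} (hq : 0 ≤ q) (hA : 0 < A) :
    ENNReal.ofReal F ^ q ≤ ENNReal.ofReal (2 * A) ^ q +
      ∑' k : ℕ, if 2 * (2 ^ k * A) ≤ F then ENNReal.ofReal (4 * (2 ^ k * A)) ^ q else 0 := by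
  by_cases h : F ≤ 2 * A
  · exact le_add_right (ENNReal.rpow_le_rpow (ENNReal.ofReal_le_ofReal h) hq)
  · obtain ⟨k, hk1, hk2⟩ := exists_nat_pow_near
      ((one_le_div (by positivity)).2 (not_le.1 h).le) one_lt_two
    rw [le_div_iff₀ (by positivity)] at hk1
    rw [div_lt_iff₀ (by positivity), pow_succ] at hk2
    refine le_add_left (le_trans ?_ (ENNReal.le_tsum k))
    rw [if_pos (by linarith)]
    exact ENNReal.rpow_le_rpow (ENNReal.ofReal_le_ofReal (by linarith)) hq

lemma tsum_rpow_le_rpow_tsum (f : ℕ → ℝ≥0∞) {θ : ℝ} (hθ : 1 ≤ θ) :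
    ∑' k, f k ^ θ ≤ (∑' k, f k) ^ θ := by
  refine ENNReal.tsum_le_of_sum_range_le fun n => ?_
  exact (sum_rpow_le_rpow_sum _ _ hθ).trans
    (ENNReal.rpow_le_rpow (ENNReal.sum_le_tsum _) (by linarith))

/-- Truncation turns a weak-type inequality, valid for all truncations at once, into a strong-type
inequality: the truncations have gradients living on disjoint sets. -/
lemma lintegral_le_of_truncation {m ν : Measure (Fin d → ℝ)} {F : (Fin d → ℝ) → ℝ}
    (hFm : AEMeasurable F m) (hFν : AEMeasurable F ν) {p q A : ℝ}
    (hp : 1 ≤ p) (hpq : p ≤ q) (hA : 0 < A) {K : ℝ≥0∞} (hK : ∀ k : ℕ,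
      m {x | 2 * (2 ^ k * A) ≤ F x} ≤ (K / ENNReal.ofReal (2 ^ k * A)) ^ q *
        ν {x | 2 ^ k * A < F x ∧ F x < 2 * (2 ^ k * A)} ^ (q / p)) :
    ∫⁻ x, ENNReal.ofReal (F x) ^ q ∂m ≤ ENNReal.ofReal (2 * A) ^ q * m Set.univ +
      (4 * K) ^ q * ν Set.univ ^ (q / p) := by
  have hq0 : 0 < q := by linarith
  have hpos (k : ℕ) : 0 < 2 ^ k * A := by positivity
  set E : ℕ → Set (Fin d → ℝ) := fun k => {x | 2 ^ k * A < F x ∧ F x < 2 * (2 ^ k * A)} with hE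
  have hEm (k : ℕ) : NullMeasurableSet (E k) ν :=
    (nullMeasurableSet_lt aemeasurable_const hFν).inter
      (nullMeasurableSet_lt hFν aemeasurable_const)
  have hEd : Pairwise fun i j => Disjoint (E i) (E j) := by
    have key (i j : ℕ) (hij : i < j) : Disjoint (E i) (E j) := by
      refine Set.disjoint_left.2 fun x hi hj => ?_
      have h1 : (2 : ℝ) ^ (i + 1) ≤ 2 ^ j := pow_le_pow_right₀ one_le_two hij
      rw [pow_succ] at h1
      have h2 := mul_le_mul_of_nonneg_right h1 hA.le
      linarith [hi.2, hj.1]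
    intro i j hij
    rcases hij.lt_or_gt with h | h
    · exact key i j h
    · exact (key j i h).symm
  have hSm (k : ℕ) : NullMeasurableSet {x | 2 * (2 ^ k * A) ≤ F x} m :=
    nullMeasurableSet_le aemeasurable_const hFm
  have hterm (k : ℕ) : ENNReal.ofReal (4 * (2 ^ k * A)) ^ q * m {x | 2 * (2 ^ k * A) ≤ F x} ≤
      (4 * K) ^ q * ν (E k) ^ (q / p) := by
    have h0 : ENNReal.ofReal (2 ^ k * A) ≠ 0 := by simpa using hpos k
    refine (mul_le_mul_right (hK k) _).trans (le_of_eq ?_)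
    rw [← mul_assoc, ← ENNReal.mul_rpow_of_nonneg _ _ hq0.le, ENNReal.ofReal_mul (by norm_num),
      mul_assoc, ENNReal.mul_div_cancel h0 ENNReal.ofReal_ne_top]
    simp
    rfl
  calc ∫⁻ x, ENNReal.ofReal (F x) ^ q ∂m
      ≤ ∫⁻ x, (ENNReal.ofReal (2 * A) ^ q + ∑' k : ℕ, {x | 2 * (2 ^ k * A) ≤ F x}.indicator
          (fun _ => ENNReal.ofReal (4 * (2 ^ k * A)) ^ q) x) ∂m := by
        refine lintegral_mono fun x => (rpow_le_dyadic_sum hq0.le hA).trans (le_of_eq ?_)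
        simp only [Set.indicator_apply, Set.mem_ofPred_eq]
    _ = ENNReal.ofReal (2 * A) ^ q * m Set.univ + ∑' k : ℕ,
          ENNReal.ofReal (4 * (2 ^ k * A)) ^ q * m {x | 2 * (2 ^ k * A) ≤ F x} := by
        rw [lintegral_add_left measurable_const, lintegral_const,
          lintegral_tsum fun k => aemeasurable_const.indicator₀ (hSm k)]
        congr 2
        ext k
        exact lintegral_indicator_const₀ (hSm k) _
    _ ≤ ENNReal.ofReal (2 * A) ^ q * m Set.univ + ∑' k : ℕ, (4 * K) ^ q * ν (E k) ^ (q / p) :=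
        add_le_add_right (ENNReal.tsum_le_tsum hterm) _
    _ ≤ _ := by
        rw [ENNReal.tsum_mul_left]
        refine add_le_add_right (mul_le_mul_right ?_ _) _
        refine (tsum_rpow_le_rpow_tsum _ ((one_le_div (by linarith)).2 hpq)).trans ?_
        refine ENNReal.rpow_le_rpow ?_ (by positivity)
        exact (tsum_meas_le_meas_iUnion_of_disjoint₀ ν hEm
          fun i j hij => (hEd hij).aedisjoint).trans (measure_mono (Set.subset_univ _))

/-! ### The critical inequality -/

/-- The weight of a level set is controlled by the weak-type set of the fractional integral of the
gradient of a truncation. -/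
lemma measure_level_le {Q : Cube d} {f : (Fin d → ℝ) → ℂ}
    {g : (Fin d → ℝ) → EuclideanSpace ℂ (Fin d)} (hfg : HasWeakGradient Q f g)
    (hf : IntegrableOn f Q.toSet) (hg : IntegrableOn g Q.toSet) {m : Measure (Fin d → ℝ)}
    (hm : m ≪ volume.restrict Q.toSet) {c : ℂ} {s : ℝ} (hs : 0 < s)
    (hA : 2 * lavg (fun x => ‖f x - c‖ₑ) Q ≤ ENNReal.ofReal s) {t : ℝ≥0∞}
    (ht : 2 ^ d * (2 ^ d * d) * t < 1 / 2) :
    m {x | 2 * s ≤ ‖f x - c‖} ≤ m {x | t < ⨆ n, fullSum (fun S => ENNReal.ofReal S.side *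
      lavg (fun z => ‖fderiv ℝ (cutoffAt c s) (f z)‖ₑ * ‖g z‖ₑ) S) n Q x} := by
  obtain ⟨L, hL⟩ := exists_enorm_fderiv_cutoff_le
  have hv : IntegrableOn (fun x => cutoffAt c s (f x)) Q.toSet := by
    refine Integrable.mono' (integrableOn_const (C := (1 : ℝ)) Q.vol_ne_top)
      ((contDiff_cutoffAt c s).continuous.comp_aestronglyMeasurable hf.1) ?_
    refine Filter.Eventually.of_forall fun x => ?_
    rw [Real.norm_of_nonneg (cutoffAt_nonneg c s _)]
    exact cutoffAt_le_one c s _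
  have hdom := ae_enorm_sub_average_le Q hv fun S hS => poincare_of_hasWeakGradient hS hfg hf hg
    (contDiff_cutoffAt c s) (enorm_fderiv_cutoffAt_le_const hL c hs)
  refine measure_mono_ae ?_
  filter_upwards [hm.ae_le hdom] with x hx hxs
  have h1 := (one_half_le_enorm_cutoffAt_sub_average hs hA hv hxs).trans hx
  by_contra hlt
  exact (ht.trans_le (h1.trans (mul_le_mul_right (not_lt.1 hlt) _))).false

/-- The weighted norm of the gradient of a truncation. -/
lemma weightMeasure_cutoffAt_le (Q : Cube d) {f : (Fin d → ℝ) → ℂ}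
    (g : (Fin d → ℝ) → EuclideanSpace ℂ (Fin d)) (σ : (Fin d → ℝ) → ℝ) {p : ℝ} (hp : 0 < p)
    {L : ℝ≥0} (hL : ∀ z, ‖fderiv ℝ cutoff z‖ₑ ≤ L) (c : ℂ) {s : ℝ} (hs : 0 < s) :
    weightMeasure Q (fun x => (‖fderiv ℝ (cutoffAt c s) (f x)‖ₑ * ‖g x‖ₑ) ^ p *
        ENNReal.ofReal (σ x) ^ p) Q.toSet ≤
      (L / ENNReal.ofReal s) ^ p * weightMeasure Q (fun x => ‖g x‖ₑ ^ p *
        ENNReal.ofReal (σ x) ^ p) {x | s < ‖f x - c‖ ∧ ‖f x - c‖ < 2 * s} := by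
  have hLs : (L / ENNReal.ofReal s : ℝ≥0∞) ≠ ⊤ :=
    ENNReal.div_ne_top ENNReal.coe_ne_top (by simpa using hs)
  rw [weightMeasure_apply subset_rfl]
  calc _ ≤ ∫⁻ x in Q.toSet, (L / ENNReal.ofReal s) ^ p *
        {x | s < ‖f x - c‖ ∧ ‖f x - c‖ < 2 * s}.indicator
          (fun x => ‖g x‖ₑ ^ p * ENNReal.ofReal (σ x) ^ p) x := by
        refine lintegral_mono fun x => ?_
        have h1 := enorm_fderiv_cutoffAt_le hL c hs (f x)
        by_cases hx : s < ‖f x - c‖ ∧ ‖f x - c‖ < 2 * s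
        · rw [Set.indicator_of_mem (by exact hx)] at h1 ⊢
          rw [ENNReal.mul_rpow_of_nonneg _ _ hp.le, mul_assoc]
          exact mul_le_mul_left (ENNReal.rpow_le_rpow h1 hp.le) _
        · rw [Set.indicator_of_notMem (by exact hx), nonpos_iff_eq_zero] at h1
          rw [h1, zero_mul, ENNReal.zero_rpow_of_pos hp, zero_mul]
          exact zero_le
    _ ≤ _ := by
        rw [lintegral_const_mul' _ _ (ENNReal.rpow_ne_top_of_nonneg hp.le hLs)]
        exact mul_le_mul_right ((lintegral_indicator_le _ _).trans (withDensity_apply_le _ _)) _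

/-- The critical inequality for a gradient of finite norm. -/
lemma exists_critical_poincareSobolev (hd : 1 ≤ d) {p q : ℝ} (hp : 1 ≤ p) (hpq : p ≤ q) :
    ∃ C : ℝ≥0, C ≠ 0 ∧ ∀ α : ℝ, 0 ≤ α → α < 1 / q + (1 - 1 / p) →
      1 / (d : ℝ) - (1 / p - 1 / q) - α = 0 →
      ∀ (Q : Cube d) (ω σ : (Fin d → ℝ) → ℝ), MemApq Q p q α ω σ →
      ainftyChar Q (fun x => ω x ^ q) < ⊤ →
      ∀ (f : (Fin d → ℝ) → ℂ) (g : (Fin d → ℝ) → EuclideanSpace ℂ (Fin d)),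
      HasWeakGradient Q f g → IntegrableOn f Q.toSet → IntegrableOn g Q.toSet →
      wLpNorm Q q ω (fun x => f x - ⨍ y in Q.toSet, f y) ≤
        C * wLpNorm Q p σ g * apqChar Q p q α ω σ *
          ainftyChar Q (fun x => ω x ^ q) ^ (if 1 < p ∧ p < q then 1 - 1 / p else 1) := by
  have hp0 : 0 < p := by linarith
  have hq0 : 0 < q := by linarith
  have hd0 : (d : ℝ≥0) ≠ 0 := by exact_mod_cast (by omega : d ≠ 0)
  obtain ⟨C₁, hC₁⟩ := exists_critical_fullSum hd hp hpq
  obtain ⟨L, hL⟩ := exists_enorm_fderiv_cutoff_le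
  set D : ℝ≥0 := 2 ^ d * (2 ^ d * d) with hD
  have hD0 : D ≠ 0 := by positivity
  -- The threshold is chosen so that `D * t = 1 / 4 < 1 / 2`.
  set t : ℝ≥0 := (4 * D)⁻¹ with ht
  have ht0 : t ≠ 0 := by positivity
  have hDt : (2 ^ d * (2 ^ d * d) * t : ℝ≥0∞) < 1 / 2 := by
    have h1 : D * t < 1 / 2 := by
      rw [ht, mul_inv, mul_left_comm, mul_inv_cancel₀ hD0, mul_one, one_div]
      exact inv_strictAnti₀ (by norm_num) (by norm_num)
    have h2 : ((D * t : ℝ≥0) : ℝ≥0∞) < ((1 / 2 : ℝ≥0) : ℝ≥0∞) := by exact_mod_cast h1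
    rw [hD, ENNReal.coe_div (by norm_num)] at h2
    simpa using h2
  refine ⟨4 * (2 ^ d * d) + 4 * (C₁ / t * L), by positivity, ?_⟩
  intro α hα hα' hcrit Q ω σ h hA f g hfg hf hg
  set w := weightMeasure Q fun x => ENNReal.ofReal (ω x) ^ q with hw
  set ν := weightMeasure Q (fun x => ‖g x‖ₑ ^ p * ENNReal.ofReal (σ x) ^ p) with hν
  set e : ℝ := if 1 < p ∧ p < q then 1 - 1 / p else 1 with he
  set Ψ := apqChar Q p q α ω σ with hΨ
  set B := ainftyChar Q (fun x => ω x ^ q) with hB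
  set c := ⨍ y in Q.toSet, f y with hc
  set a := lavg (fun x => ‖f x - c‖ₑ) Q with ha
  have he0 : 0 < e := by
    rw [he]; split_ifs with h1
    · exact sub_pos.2 ((div_lt_one hp0).2 h1.1)
    · exact zero_lt_one
  have hB1 : 1 ≤ B ^ e :=
    ENNReal.one_le_rpow (one_le_ainftyChar h.1 (weightMeasure_omega_ne_top h hq0 subset_rfl)) he0
  have hacw : w.restrict Q.toSet ≪ volume.restrict Q.toSet :=
    (weightMeasure_absolutelyContinuous Q _).restrict _
  have hacν : ν ≪ volume.restrict Q.toSet := withDensity_absolutelyContinuous _ _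
  -- The part of the range below the first truncation is controlled by the mean oscillation.
  have hmean : a * w Q.toSet ^ (1 / q) ≤ (2 ^ d * d) * (Ψ * ν Q.toSet ^ (1 / p)) := by
    have h1 := side_mul_lavg_mul_le hd (subset_refl Q.toSet) hp hq0 hcrit.symm h.1 h.2.1
      hg.1.enorm
    rw [ENNReal.rpow_zero, mul_one] at h1
    have h2 := lavg_enorm_sub_average_le Q hf (poincare hfg hf hg Q subset_rfl)
    refine (mul_le_mul_left h2 _).trans ?_
    rw [mul_assoc]
    exact mul_le_mul_right h1 _
  have hfc : IntegrableOn (fun x => f x - c) Q.toSet :=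
    hf.sub (integrableOn_const Q.vol_ne_top)
  have hat : a ≠ ⊤ := ENNReal.div_ne_top hfc.2.ne Q.vol_ne_zero
  rw [wLpNorm_eq_lintegral h.1 hq0, wLpNorm_eq_weightMeasure Q p σ g]
  -- If the mean oscillation vanishes, `f` is constant and there is no height to truncate at.
  by_cases ha0 : a = 0
  · have h1 : ∫⁻ x in Q.toSet, ‖f x - c‖ₑ = 0 := by
      rw [← lavg_mul_vol]
      exact mul_eq_zero_of_left ha0 _
    rw [lintegral_eq_zero_iff' hfc.1.enorm] at h1
    have h2 : ∫⁻ x in Q.toSet, ‖f x - c‖ₑ ^ q ∂w = 0 := by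
      rw [lintegral_congr_ae (g := fun _ => 0), lintegral_zero]
      filter_upwards [hacw.ae_le h1] with x hx
      rw [hx]; exact ENNReal.zero_rpow_of_pos hq0
    rw [h2, ENNReal.zero_rpow_of_pos (by positivity)]
    exact zero_le
  set A : ℝ := 2 * a.toReal with hAdef
  have hApos : 0 < A := mul_pos two_pos (ENNReal.toReal_pos ha0 hat)
  have hofA : ENNReal.ofReal A = 2 * a := by
    rw [hAdef, ENNReal.ofReal_mul (by norm_num), ENNReal.ofReal_toReal hat]; simp
  have hweak (k : ℕ) : w.restrict Q.toSet {x | 2 * (2 ^ k * A) ≤ ‖f x - c‖} ≤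
      (C₁ * Ψ * B ^ e / t * L / ENNReal.ofReal (2 ^ k * A)) ^ q *
        ν {x | 2 ^ k * A < ‖f x - c‖ ∧ ‖f x - c‖ < 2 * (2 ^ k * A)} ^ (q / p) := by
    have hs : 0 < 2 ^ k * A := by positivity
    have hsA : 2 * a ≤ ENNReal.ofReal (2 ^ k * A) := by
      rw [← hofA]
      exact ENNReal.ofReal_le_ofReal (le_mul_of_one_le_left hApos.le (one_le_pow₀ one_le_two))
    have hDc : Continuous (fderiv ℝ (cutoffAt c (2 ^ k * A))) :=
      (contDiff_cutoffAt c _).continuous_fderiv one_ne_zero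
    have hHm : AEMeasurable (fun z => ‖fderiv ℝ (cutoffAt c (2 ^ k * A)) (f z)‖ₑ * ‖g z‖ₑ)
        (volume.restrict Q.toSet) :=
      (hDc.comp_aestronglyMeasurable hf.1).enorm.mul hg.1.enorm
    have hHi : ∫⁻ z in Q.toSet, ‖fderiv ℝ (cutoffAt c (2 ^ k * A)) (f z)‖ₑ * ‖g z‖ₑ ≠ ⊤ := by
      refine ne_top_of_le_ne_top (ENNReal.mul_ne_top
        (ENNReal.coe_ne_top (r := L / (2 ^ k * A).toNNReal)) hg.2.ne) ((lintegral_mono fun z => mul_le_mul_left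
          (enorm_fderiv_cutoffAt_le_const hL c hs (f z)) _).trans ?_)
      rw [lintegral_const_mul' _ _ ENNReal.coe_ne_top]
    refine (measure_level_le hfg hf hg hacw hs hsA hDt).trans
      ((hC₁ α hα hα' hcrit Q ω σ h hA _ hHm hHi t (by exact_mod_cast ht0)
        ENNReal.coe_ne_top).trans ?_)
    refine (mul_le_mul_right (ENNReal.rpow_le_rpow
      (weightMeasure_cutoffAt_le Q g σ hp0 hL c hs) (by positivity)) _).trans (le_of_eq ?_)
    rw [ENNReal.mul_rpow_of_nonneg _ _ (by positivity), ← ENNReal.rpow_mul,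
      mul_div_cancel₀ _ hp0.ne', ← mul_assoc, ← ENNReal.mul_rpow_of_nonneg _ _ hq0.le, mul_div_assoc
        (C₁ * Ψ * B ^ e / t)]
  have hFm : AEStronglyMeasurable (fun x => ‖f x - c‖) (volume.restrict Q.toSet) := hfc.1.norm
  have hmain := lintegral_le_of_truncation (hFm.aemeasurable.mono_ac hacw)
    (hFm.aemeasurable.mono_ac hacν) hp hpq hApos hweak
  simp only [ofReal_norm] at hmain
  rw [Measure.restrict_apply_univ] at hmain
  have hνQ : ν Set.univ = ν Q.toSet := by
    rw [hν, weightMeasure, withDensity_apply _ MeasurableSet.univ,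
      withDensity_apply _ Q.measurableSet, Measure.restrict_univ, Measure.restrict_restrict
        Q.measurableSet, Set.inter_self]
  have hofA2 : ENNReal.ofReal (2 * A) = 4 * a := by
    rw [ENNReal.ofReal_mul (by norm_num), hofA, ← mul_assoc]; norm_num
  rw [hνQ, hofA2] at hmain
  have h1q : 1 / q ≤ 1 := (div_le_one hq0).2 (hp.trans hpq)
  have hroot (x : ℝ≥0∞) : (x ^ q) ^ (1 / q) = x := by
    rw [← ENNReal.rpow_mul, mul_one_div_cancel hq0.ne', ENNReal.rpow_one]
  calc (∫⁻ x in Q.toSet, ‖f x - c‖ₑ ^ q ∂w) ^ (1 / q)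
      ≤ ((4 * a) ^ q * w Q.toSet +
          (4 * (C₁ * Ψ * B ^ e / t * L)) ^ q * ν Q.toSet ^ (q / p)) ^ (1 / q) :=
        ENNReal.rpow_le_rpow hmain (by positivity)
    _ ≤ ((4 * a) ^ q * w Q.toSet) ^ (1 / q) +
          ((4 * (C₁ * Ψ * B ^ e / t * L)) ^ q * ν Q.toSet ^ (q / p)) ^ (1 / q) :=
        ENNReal.rpow_add_le_add_rpow _ _ (by positivity) h1q
    _ = 4 * (a * w Q.toSet ^ (1 / q)) +
          4 * (C₁ * Ψ * B ^ e / t * L) * ν Q.toSet ^ (1 / p) := by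
        rw [ENNReal.mul_rpow_of_nonneg ((4 * a) ^ q) _ (by positivity),
          ENNReal.mul_rpow_of_nonneg (_ ^ q) (ν Q.toSet ^ (q / p)) (by positivity), hroot, hroot, ← ENNReal.rpow_mul,
          mul_assoc 4 a]
        congr 3
        field_simp
    _ ≤ 4 * ((2 ^ d * d) * (Ψ * ν Q.toSet ^ (1 / p))) * B ^ e +
          4 * (C₁ * Ψ * B ^ e / t * L) * ν Q.toSet ^ (1 / p) := by
        refine add_le_add_left ((mul_le_mul_right hmean _).trans ?_) _
        exact le_mul_of_one_le_right zero_le hB1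
    _ = _ := by
        push_cast
        rw [ENNReal.coe_div ht0, ← hν]
        simp only [div_eq_mul_inv]
        ring

end PoincareSobolev

theorem theorem4p1 (d : ℕ) (hd : 1 ≤ d) :
    -- subcritical case: the constant depends on `d` only
    (∃ C : ℝ≥0, ∀ (p q α ε : ℝ), 1 ≤ p → p ≤ q → 0 ≤ α → α < 1 / q + (1 - 1 / p) →
      ε = 1 / (d : ℝ) - (1 / p - 1 / q) - α → 0 < ε →
      ∀ (Q : PoincareSobolev.Cube d) (ω σ : (Fin d → ℝ) → ℝ),
      PoincareSobolev.MemApq Q p q α ω σ →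
      ∀ f : (Fin d → ℝ) → ℂ, PoincareSobolev.MemSobolev Q p σ f →
      ∀ g : (Fin d → ℝ) → EuclideanSpace ℂ (Fin d), PoincareSobolev.HasWeakGradient Q f g →
        PoincareSobolev.wLpNorm Q q ω (fun x => f x - ⨍ y in Q.toSet, f y) ≤
          C * PoincareSobolev.apqChar Q p q α ω σ * (Q.vol ^ ε / ENNReal.ofReal ε) *
            PoincareSobolev.wLpNorm Q p σ g) ∧
    -- critical case: the constant depends on `p`, `q`, `d` only
    (∀ (p q : ℝ), 1 ≤ p → p ≤ q → ∃ C : ℝ≥0, ∀ α : ℝ, 0 ≤ α → α < 1 / q + (1 - 1 / p) →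
      1 / (d : ℝ) - (1 / p - 1 / q) - α = 0 →
      ∀ (Q : PoincareSobolev.Cube d) (ω σ : (Fin d → ℝ) → ℝ),
      PoincareSobolev.MemApq Q p q α ω σ →
      PoincareSobolev.ainftyChar Q (fun x => ω x ^ q) < ⊤ →
      ∀ f : (Fin d → ℝ) → ℂ, PoincareSobolev.MemSobolev Q p σ f →
      ∀ g : (Fin d → ℝ) → EuclideanSpace ℂ (Fin d), PoincareSobolev.HasWeakGradient Q f g →
        PoincareSobolev.wLpNorm Q q ω (fun x => f x - ⨍ y in Q.toSet, f y) ≤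
          C * PoincareSobolev.wLpNorm Q p σ g * PoincareSobolev.apqChar Q p q α ω σ *
            PoincareSobolev.ainftyChar Q (fun x => ω x ^ q) ^
              (if 1 < p ∧ p < q then 1 - 1 / p else 1)) := by
  constructor
  · have hd0 : (d : ℝ≥0) ≠ 0 := by exact_mod_cast (by omega : d ≠ 0)
    set C : ℝ≥0 := 2 ^ d * (2 ^ d * d) * 2 with hC
    have hC0 : C ≠ 0 := by positivity
    refine ⟨C, fun p q α ε hp hpq hα _ hε hε0 Q ω σ h f hf g hfg => ?_⟩
    have hq0 : 0 < q := by linarith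
    -- If the gradient has infinite norm, the right-hand side is infinite: its other factors are
    -- not zero.
    by_cases hg : PoincareSobolev.wLpNorm Q p σ g = ⊤
    · rw [hg, ENNReal.mul_top]
      · exact le_top
      · refine mul_ne_zero (mul_ne_zero (by exact_mod_cast hC0)
          (PoincareSobolev.apqChar_ne_zero h hq0)) (ENNReal.div_ne_zero.2 ⟨?_, by simp⟩)
        simp [ENNReal.rpow_eq_zero_iff, Q.vol_ne_zero, Q.vol_ne_top]
    · have := PoincareSobolev.subcritical_poincareSobolev hd hp hpq hα hε hε0 h hfg
        (PoincareSobolev.integrableOn_of_wLpNorm_ne_top h hp hq0 hf.1.1 hf.1.2.ne)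
        (PoincareSobolev.integrableOn_of_wLpNorm_ne_top h hp hq0 hfg.aestronglyMeasurable_grad hg)
      rw [hC]
      push_cast
      exact this
  · intro p q hp hpq
    have hq0 : 0 < q := by linarith
    obtain ⟨C, hC0, hC⟩ := PoincareSobolev.exists_critical_poincareSobolev hd hp hpq
    refine ⟨C, fun α hα hα' hcrit Q ω σ h hA f hf g hfg => ?_⟩
    by_cases hg : PoincareSobolev.wLpNorm Q p σ g = ⊤
    · have hA0 := PoincareSobolev.one_le_ainftyChar h.1
        (PoincareSobolev.weightMeasure_omega_ne_top h hq0 subset_rfl)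
      rw [hg, ENNReal.mul_top (by exact_mod_cast hC0),
        ENNReal.top_mul (PoincareSobolev.apqChar_ne_zero h hq0), ENNReal.top_mul]
      · exact le_top
      · exact (ENNReal.rpow_pos (zero_lt_one.trans_le hA0) hA.ne).ne'
    · exact hC α hα hα' hcrit Q ω σ h hA f g hfg
        (PoincareSobolev.integrableOn_of_wLpNorm_ne_top h hp hq0 hf.1.1 hf.1.2.ne)
        (PoincareSobolev.integrableOn_of_wLpNorm_ne_top h hp hq0 hfg.aestronglyMeasurable_grad hg)
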